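/- \textbf{Setting.} Let $A=\{x\in\mathbb R^3:\ x_1+x_2+x_3=0\}$ with its Euclidean metric. The affine Weyl group is $S_3\ltimes A$ (permutations of coordinates and all translations). A \emph{root half-space} is $\{x_i-x_j\ge c\}$ ($i\ne j$, $c\in\mathbb R$), and an \emph{enclosure} is a bounded intersection of finitely many root half-spaces. Enclosures and restrictions of affine Weyl group elements form a category $\mathbf{Enc}$, with the Grothendieck topology in which a covering of $E$ is a finite collection of maps $E_i\to E$ whose images have union $E$. An enclosure is also regarded as the sheaf associated to the presheaf that it represents, and $A$ as the sheaf associated to $E\mapsto\{\text{affine Weyl maps }E\to A\}$. A sheaf $F$ of sets on $\mathbf{Enc}$ is \emph{finitely generated} if finitely many maps from enclosures to $F$ are jointly surjective in the sense of sheaves, and it is a \emph{construction} if $E\times_FE'$ is finitely generated for all maps $E\to F$, $E'\to F$ from enclosures. Its set of points $F(p)$ ($p$ a one-point enclosure) has the topology in which $U$ is open iff its preimage in $E$ is open for all $E\to F$. \textbf{Local structure.} For $x\in F(p)$ let $F_x$ be the following graph. Its edges are the germs at $0$ of maps to $F$, with $0\mapsto x$, of the triangles $\{x_1\ge x_2\ge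 x_3,\ x_1-x_3\le t\}$; its positive (negative) vertices are the germs of maps of the standard segments $S^{t,+}$ ($S^{t,-}$) of length $t>0$ issuing from $0$ in the direction $(2,-1,-1)$ (respectively $(1,1,-2)$); incidence is restriction. Maps of sheaves act on these graphs. The graph $F_x$ is a \emph{spherical building} if it is nonempty, any two vertices are at distance at most $3$ and lie in a common hexagon, and there are no loops of length at most $4$. A map $s:E\to F$ from an enclosure is \emph{immersive} if for all $z\in E$ the map $E_z\to F_{s(z)}$ preserves distances of vertices, where two directions of $E$ at $z$ that form an angle $n\cdot60^\circ$ have distance $n$. \textbf{Parallelograms.} For $a,b>0$ and either choice of orientation, $P^{a,b}\subset A$ is the parallelogram with a $120^\circ$ corner at the origin, whose edges at the origin are the standard segment of length $a$ and the standard segment of length $b$ of the same orientation, rotated by $120^\circ$; $V^{a,b}$ is the union of these two edges. \textbf{Buildings.} A \emph{building} is a construction $B$ with $B(p)$ connected and simply connected, with all $B_x$ spherical buildings, and such that, for either orientation: (i) if $\varphi$ is an immersive map from the standard segment of length $t$ to $B$ and $\nu$ is a vertex of $B_{\varphi(\text{end})}$ opposite to (of other parity and at distance $3$ from) the backward direction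 of $\varphi$ there, then for every $t'>t$ the map $\varphi$ extends to an immersive map from the standard segment of length $t'$ whose forward direction at the former endpoint is $\nu$; (ii) immersive maps on the two edges of $V^{a,b}$ with the same value and different directions at the origin extend to an immersive map $P^{a,b}\to B$. An \emph{apartment} of $B$ is a map $A\to B$ that is immersive on every enclosure in $A$. \textbf{Scaffoldings.} An \emph{edge germ} of $F$ consists of a point $x\in F(p)$, a vertex $v$ of $F_x$ and two different edges of $F_x$ with endpoint $v$. A map $f:F\to G$ \emph{folds} along it if the two edges have the same image, and \emph{opens} along it otherwise. A \emph{scaffolding} $\sigma=(\sigma^o,\sigma^f)$ is a pair of disjoint sets of edge germs of $F$; a map is \emph{compatible} with $\sigma$ if it opens along $\sigma^o$ and folds along $\sigma^f$; and $\sigma$ is \emph{coherent} if some map from $F$ to a building is compatible with it. A segment in $F$ is \emph{straight} for $\sigma$ if at each interior point its forward and backward directions are joined by a path of three edges $\alpha,\beta,\gamma$ such that the edge germs $\alpha\beta$ and $\beta\gamma$ are in $\sigma^o$. \textbf{Proposition.} Let $W^{a,b}=P^{a,b}\cup^{V^{a,b}}P^{a,b}$ be the pushout of sheaves, with the projection $\pi:W^{a,b}\to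 P^{a,b}$ that is the identity on both pieces. For $i=1,2$ let $v_i$ be the edge germ at the origin of $W^{a,b}$ formed by the two sectors of the $i$-th copy of $P^{a,b}$ at their common vertex. Let $\sigma_W$ be a coherent scaffolding of $W^{a,b}$ such that $v_1,v_2\in\sigma_W^o$ and the two edges of $V^{a,b}$ are straight. Then every map $h_W:W^{a,b}\to B$ to a building that is compatible with $\sigma_W$ factors as $h_W=h_P\circ\pi$, where $h_P:P^{a,b}\to B$ embeds the parallelogram isometrically into a single apartment of $B$, in the sense that $h_P$ is the composite of an isometric affine Weyl map $P^{a,b}\to A$ and an apartment $A\to B$. -/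

import Mathlib

open CategoryTheory CategoryTheory.Limits Opposite

namespace SL3

noncomputable section

/-! ### The model apartment and its affine Weyl group -/

/-- The model plane: triples of real numbers with sum zero, with its Weyl-invariant
Euclidean metric. -/
def aptSubmodule : Submodule ℝ (EuclideanSpace ℝ (Fin 3)) where
  carrier := {x | ∑ i, x i = 0}
  zero_mem' := by simp
  add_mem' := by
    intro x y hx hy
    simp only [Set.mem_ofPred_eq, PiLp.add_apply, Finset.sum_add_distrib] at *
    rw [hx, hy, add_zero]
  smul_mem' := by
    intro c x hx
    simp only [Set.mem_ofPred_eq, PiLp.smul_apply, smul_eq_mul, ← Finset.mul_sum] at *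
    rw [hx, mul_zero]

abbrev Apt : Type := aptSubmodule

theorem Apt.sum_eq (x : Apt) : ∑ i, x.1 i = 0 := x.2

theorem Apt.ext' {x y : Apt} (h : ∀ i, x.1 i = y.1 i) : x = y := by
  apply Subtype.ext
  ext i
  exact h i

/-- The point of the model plane with given coordinates. -/
def Apt.mk3 (p q r : ℝ) (h : p + q + r = 0) : Apt :=
  ⟨WithLp.toLp 2 ![p, q, r], by
    change ∑ i, (![p, q, r] : Fin 3 → ℝ) i = 0
    simp [Fin.sum_univ_three, h]⟩

/-- The element of the affine Weyl group with linear part the permutation `π` and translation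
part `t`. Root hyperplanes `x i - x j = c` occur for all real `c`, so the group that their
reflections generate contains all translations. -/
def weyl (π : Equiv.Perm (Fin 3)) (t x : Apt) : Apt :=
  ⟨WithLp.toLp 2 (fun i => x.1 (π i) + t.1 i), by
    change ∑ i, (x.1 (π i) + t.1 i) = 0
    rw [Finset.sum_add_distrib, t.sum_eq, add_zero, Equiv.sum_comp π (fun i => x.1 i), x.sum_eq]⟩

@[simp] theorem weyl_apply (π : Equiv.Perm (Fin 3)) (t x : Apt) (i : Fin 3) :
    (weyl π t x).1 i = x.1 (π i) + t.1 i := rfl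

theorem weyl_weyl (π ρ : Equiv.Perm (Fin 3)) (t s x : Apt) :
    weyl ρ s (weyl π t x) = weyl (π * ρ) (weyl ρ s t) x := by
  apply Apt.ext'
  intro i
  simp [add_assoc]

theorem weyl_one_zero (x : Apt) : weyl 1 0 x = x := by
  apply Apt.ext'
  intro i
  simp

/-- Translation part of the inverse of `weyl π t`. -/
def weylInvTrans (π : Equiv.Perm (Fin 3)) (t : Apt) : Apt := - weyl π⁻¹ 0 t

theorem weyl_inv_left (π : Equiv.Perm (Fin 3)) (t x : Apt) :
    weyl π⁻¹ (weylInvTrans π t) (weyl π t x) = x := by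
  apply Apt.ext'
  intro i
  simp [weylInvTrans]

theorem weyl_inv_right (π : Equiv.Perm (Fin 3)) (t x : Apt) :
    weyl π t (weyl π⁻¹ (weylInvTrans π t) x) = x := by
  apply Apt.ext'
  intro i
  simp [weylInvTrans]

/-- A map from a subset of the plane that is the restriction of an affine Weyl group element. -/
def IsWeyl {X : Set Apt} (f : X → Apt) : Prop :=
  ∃ (π : Equiv.Perm (Fin 3)) (t : Apt), ∀ x : X, f x = weyl π t x

/-! ### Enclosures -/

/-- The intersection of the root half-spaces `x i - x j ≥ c`, for `(i, j, c)` in a finite list. -/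
def halfSpaces (L : List (Fin 3 × Fin 3 × ℝ)) : Set Apt :=
  {x | ∀ h ∈ L, h.2.2 ≤ x.1 h.1 - x.1 h.2.1}

/-- An enclosure: a bounded (automatically closed, possibly empty) subset of the plane that is an
intersection of finitely many root half-spaces. -/
@[ext]
structure Enc : Type where
  carrier : Set Apt
  bounded : Bornology.IsBounded carrier
  finite_roots : ∃ L : List (Fin 3 × Fin 3 × ℝ), (∀ h ∈ L, h.1 ≠ h.2.1) ∧ carrier = halfSpaces L

/-- Affine maps of enclosures. -/
instance : Category.{0} Enc where
  Hom E E' := {f : E.carrier → E'.carrier // IsWeyl (fun x => (f x : Apt))}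
  id E := ⟨id, 1, 0, fun x => (weyl_one_zero x.1).symm⟩
  comp f g := ⟨g.1 ∘ f.1, by
    obtain ⟨π, t, h⟩ := f.2
    obtain ⟨ρ, s, k⟩ := g.2
    refine ⟨π * ρ, weyl ρ s t, fun x => ?_⟩
    have h1 := h x
    have h2 := k (f.1 x)
    simp only [Function.comp_apply] at *
    rw [h2, h1, weyl_weyl]⟩

theorem Enc.id_apply {E : Enc} (x : E.carrier) : (𝟙 E : E ⟶ E).1 x = x := rfl

theorem Enc.comp_apply {D E E' : Enc} (f : D ⟶ E) (g : E ⟶ E') (x : D.carrier) :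
    (f ≫ g).1 x = g.1 (f.1 x) := rfl

theorem Enc.hom_ext {D E : Enc} {f g : D ⟶ E} (h : ∀ x, (f.1 x : Apt) = g.1 x) : f = g :=
  Subtype.ext (funext fun x => Subtype.ext (h x))

/-- The morphism of enclosures that is the restriction of a given affine Weyl group element. -/
def Enc.homOf {E E' : Enc} (π : Equiv.Perm (Fin 3)) (t : Apt)
    (h : ∀ x ∈ E.carrier, weyl π t x ∈ E'.carrier) : E ⟶ E' :=
  ⟨fun x => ⟨weyl π t x.1, h x.1 x.2⟩, π, t, fun _ => rfl⟩

/-- The inclusion of enclosures. -/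
def Enc.incl {E E' : Enc} (h : E.carrier ⊆ E'.carrier) : E ⟶ E' :=
  ⟨fun x => ⟨x.1, h x.2⟩, 1, 0, fun x => (weyl_one_zero x.1).symm⟩

/-! ### The Grothendieck topology of finite coverings -/

/-- The part of an enclosure that an affine Weyl group element sends to another enclosure. -/
def Enc.inter (E D : Enc) (π : Equiv.Perm (Fin 3)) (t : Apt) : Enc where
  carrier := {y | y ∈ E.carrier ∧ weyl π t y ∈ D.carrier}
  bounded := E.bounded.subset fun _ h => h.1
  finite_roots := by
    obtain ⟨L, hL, hE⟩ := E.finite_roots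
    obtain ⟨M, hM, hD⟩ := D.finite_roots
    refine ⟨L ++ M.map (fun h => (π h.1, π h.2.1, h.2.2 - t.1 h.1 + t.1 h.2.1)), ?_, ?_⟩
    · intro h hh
      rcases List.mem_append.1 hh with hh | hh
      · exact hL h hh
      · obtain ⟨k, hk, rfl⟩ := List.mem_map.1 hh
        exact fun h => hM k hk (π.injective h)
    · ext y
      rw [hE, hD]
      simp only [halfSpaces, Set.mem_ofPred_eq, List.mem_append, List.mem_map, weyl_apply]
      constructor
      · rintro ⟨h1, h2⟩ h (hh | ⟨k, hk, rfl⟩)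
        · exact h1 h hh
        · have := h2 k hk
          simp only
          linarith
      · intro h
        refine ⟨fun k hk => h k (Or.inl hk), fun k hk => ?_⟩
        have := h _ (Or.inr ⟨k, hk, rfl⟩)
        simp only at this
        linarith

/-- The topology in which a covering of `E` is a finite collection of affine maps of enclosures
to `E` such that `E` is the union of their images; a sieve is covering if it contains such a
collection. -/
def encTopology : GrothendieckTopology Enc where
  sieves E := {S | ∃ (n : ℕ) (D : Fin n → Enc) (f : ∀ k, D k ⟶ E),
    (∀ k, S (f k)) ∧ ∀ x : E.carrier, ∃ k, ∃ y : (D k).carrier, (f k).1 y = x}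
  top_mem' E := ⟨1, fun _ => E, fun _ => 𝟙 E, fun _ => trivial, fun x => ⟨0, x, rfl⟩⟩
  pullback_stable' := by
    rintro E E' S g ⟨n, D, f, hS, hf⟩
    obtain ⟨ρ, s, hg⟩ := g.2
    choose π t hπ using fun k => (f k).2
    have key : ∀ k (y : Apt) (hy : y ∈ (E'.inter (D k) (ρ * (π k)⁻¹)
        (weyl (π k)⁻¹ (weylInvTrans (π k) (t k)) s)).carrier),
        (f k).1 ⟨_, hy.2⟩ = g.1 ⟨y, hy.1⟩ := by
      intro k y hy
      apply Subtype.ext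
      have h1 := hπ k ⟨_, hy.2⟩
      have h2 := hg ⟨y, hy.1⟩
      simp only at h1 h2
      rw [h1, h2, ← weyl_weyl, weyl_inv_right]
    refine ⟨n, fun k => E'.inter (D k) (ρ * (π k)⁻¹)
      (weyl (π k)⁻¹ (weylInvTrans (π k) (t k)) s), fun k => Enc.incl fun _ h => h.1, ?_, ?_⟩
    · intro k
      have : (Enc.incl (fun _ h => h.1) : E'.inter (D k) (ρ * (π k)⁻¹)
          (weyl (π k)⁻¹ (weylInvTrans (π k) (t k)) s) ⟶ E') ≫ g =
          (Enc.homOf (E := E'.inter (D k) (ρ * (π k)⁻¹)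
            (weyl (π k)⁻¹ (weylInvTrans (π k) (t k)) s)) (ρ * (π k)⁻¹)
            (weyl (π k)⁻¹ (weylInvTrans (π k) (t k)) s) (fun _ h => h.2)) ≫ f k := by
        apply Enc.hom_ext
        intro y
        exact congrArg Subtype.val (key k y.1 y.2).symm
      rw [Sieve.pullback_apply, this]
      exact S.downward_closed (hS k) _
    · intro x
      obtain ⟨k, y, hy⟩ := hf (g.1 x)
      have hyx : weyl (ρ * (π k)⁻¹) (weyl (π k)⁻¹ (weylInvTrans (π k) (t k)) s) x.1 = y.1 := by
        have h1 := hπ k y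
        have h2 := hg x
        simp only at h1 h2
        rw [hy, h2] at h1
        rw [← weyl_weyl, h1, weyl_inv_left]
      exact ⟨k, ⟨x.1, x.2, by rw [hyx]; exact y.2⟩, rfl⟩
  transitive' := by
    rintro E S ⟨n, D, f, hS, hf⟩ R hR
    choose m C g hg hc using fun k => hR (hS k)
    have e := Fintype.equivFin (Σ k, Fin (m k))
    refine ⟨Fintype.card (Σ k, Fin (m k)), fun i => C (e.symm i).1 (e.symm i).2,
      fun i => g (e.symm i).1 (e.symm i).2 ≫ f (e.symm i).1, fun i => hg _ _, fun x => ?_⟩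
    obtain ⟨k, y, rfl⟩ := hf x
    obtain ⟨l, z, rfl⟩ := hc k y
    obtain ⟨i, hi⟩ := e.symm.surjective ⟨k, l⟩
    have key : ∀ p : Σ k, Fin (m k), p = ⟨k, l⟩ →
        ∃ y : (C p.1 p.2).carrier, (g p.1 p.2 ≫ f p.1).1 y = (f k).1 ((g k l).1 z) := by
      rintro _ rfl
      exact ⟨z, rfl⟩
    exact ⟨i, key _ hi⟩

/-- Sheaves of sets on the site of enclosures. -/
abbrev Sh : Type 1 := Sheaf encTopology (Type)

/-- The sections of `F` over an enclosure `E`, i.e. the maps `E ⟶ F`. -/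
abbrev Sec (F : Sh) (E : Enc) : Type := F.obj.obj (op E)

/-- Restriction of a section along an affine map. -/
abbrev res {F : Sh} {D E : Enc} (u : D ⟶ E) (s : Sec F E) : Sec F D := F.obj.map u.op s

/-- Composition of a section `E ⟶ F` with a map of sheaves `F ⟶ G`. -/
abbrev push {F G : Sh} (f : F ⟶ G) {E : Enc} (s : Sec F E) : Sec G E := f.hom.app (op E) s

theorem res_comp {F : Sh} {C D E : Enc} (u : C ⟶ D) (v : D ⟶ E) (s : Sec F E) :
    res (u ≫ v) s = res u (res v s) := by
  simp [res]

theorem res_push {F G : Sh} (f : F ⟶ G) {D E : Enc} (u : D ⟶ E) (s : Sec F E) :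
    res u (push f s) = push f (res u s) := by
  exact (NatTrans.naturality_apply f.hom u.op s).symm

/-- The functor that sends an enclosure `E` to the sheaf associated to the presheaf represented by
`E`. -/
def tilde : Enc ⥤ Sh := yoneda ⋙ presheafToSheaf encTopology (Type)

/-- The tautological section of the sheaf of `E` over `E`. -/
def taut (E : Enc) : Sec (tilde.obj E) E :=
  (toSheafify encTopology (yoneda.obj E)).app (op E) (𝟙 E)

/-! ### Constructions -/

/-- `G` is finitely generated: there is a finite collection of maps from enclosures to `G` that
is jointly surjective in the sheaf-theoretical sense. -/
def FinGenerated (G : Encᵒᵖ ⥤ Type) : Prop :=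
  ∃ (n : ℕ) (D : Fin n → Enc) (s : ∀ k, G.obj (op (D k))),
    ∀ (E : Enc) (t : G.obj (op E)), ∃ S ∈ encTopology E, ∀ (E' : Enc) (u : E' ⟶ E), S u →
      ∃ (k : Fin n) (v : E' ⟶ D k), G.map u.op t = G.map v.op (s k)

/-- The fiber product `E ×_F E'` of two maps `E ⟶ F` and `E' ⟶ F` from enclosures. -/
def fiberProduct {F : Sh} {E E' : Enc} (s : Sec F E) (s' : Sec F E') : Encᵒᵖ ⥤ Type where
  obj D := {q : (D.unop ⟶ E) × (D.unop ⟶ E') // res q.1 s = res q.2 s'}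
  map u := TypeCat.ofHom fun q => ⟨(u.unop ≫ q.1.1, u.unop ≫ q.1.2), by
    rw [res_comp, res_comp, q.2]⟩

/-- A construction is a finitely related sheaf on the site of enclosures. -/
def IsConstruction (F : Sh) : Prop :=
  ∀ (E E' : Enc) (s : Sec F E) (s' : Sec F E'), FinGenerated (fiberProduct s s')

/-! ### Standard enclosures -/

/-- The two parities (orientations) of vertices. -/
inductive Parity : Type
  | pos
  | neg

def Parity.flip : Parity → Parity
  | pos => neg
  | neg => pos

/-- Positive real numbers, used as lengths. Lengths are measured in the multiple of the Euclidean
metric for which the vector `(2/3, -1/3, -1/3)` has length one. -/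
abbrev Len : Type := {r : ℝ // 0 < r}

theorem isBounded_of_diff {X : Set Apt} (M : ℝ)
    (h : ∀ x ∈ X, ∀ i j, x.1 i - x.1 j ≤ M) : Bornology.IsBounded X := by
  rw [isBounded_iff_forall_norm_le]
  refine ⟨√(∑ _i : Fin 3, M ^ 2), fun x hx => ?_⟩
  change ‖x.1‖ ≤ _
  rw [EuclideanSpace.norm_eq]
  apply Real.sqrt_le_sqrt
  apply Finset.sum_le_sum
  intro i _
  rw [Real.norm_eq_abs, sq_abs]
  have hs := x.sum_eq
  rw [Fin.sum_univ_three] at hs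
  have h1 := h x hx
  have hM : 0 ≤ M := by simpa using h1 0 0
  have a1 := h1 i 0
  have a2 := h1 i 1
  have a3 := h1 i 2
  have b1 := h1 0 i
  have b2 := h1 1 i
  have b3 := h1 2 i
  apply sq_le_sq'
  · linarith
  · linarith

/-- The enclosure that is a single point (at the origin). -/
def pt : Enc where
  carrier := {0}
  bounded := Bornology.isBounded_singleton
  finite_roots := by
    refine ⟨[(0, 1, 0), (1, 0, 0), (1, 2, 0), (2, 1, 0)], by simp, ?_⟩
    ext x
    have hs := x.sum_eq
    rw [Fin.sum_univ_three] at hs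
    simp only [Set.mem_singleton_iff, halfSpaces, List.mem_cons, List.not_mem_nil, or_false,
      Set.mem_ofPred_eq, forall_eq_or_imp, forall_eq]
    constructor
    · rintro rfl
      simp
    · rintro ⟨h1, h2, h3, h4⟩
      apply Apt.ext'
      intro i
      fin_cases i <;> simp <;> linarith

/-- The map from the one-point enclosure to `E` with image `z`. -/
def ptTo {E : Enc} (z : E.carrier) : pt ⟶ E :=
  Enc.homOf 1 z.1 fun x hx => by
    have hx : x = 0 := hx
    have : weyl 1 z.1 x = z.1 := by
      apply Apt.ext'
      intro i
      simp [hx]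
    rw [this]
    exact z.2

/-- The list of root half-spaces that cut out the standard segment. -/
def segRoots : Parity → ℝ → List (Fin 3 × Fin 3 × ℝ)
  | .pos, t => [(1, 2, 0), (2, 1, 0), (0, 1, 0), (1, 0, -t)]
  | .neg, t => [(0, 1, 0), (1, 0, 0), (1, 2, 0), (2, 1, -t)]

/-- The standard segment of length `t` that starts at the origin in the direction `(2, -1, -1)`
(positive orientation) or `(1, 1, -2)` (negative orientation). -/
def seg (ε : Parity) (t : Len) : Enc where
  carrier := halfSpaces (segRoots ε t)
  bounded := by
    apply isBounded_of_diff t.1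
    intro x hx i j
    have ht := t.2
    cases ε <;>
    · simp only [halfSpaces, segRoots, List.mem_cons, List.not_mem_nil, or_false,
        Set.mem_ofPred_eq, forall_eq_or_imp, forall_eq] at hx
      obtain ⟨h1, h2, h3, h4⟩ := hx
      fin_cases i <;> fin_cases j <;> simp <;> linarith
  finite_roots := ⟨segRoots ε t, by cases ε <;> simp [segRoots], rfl⟩

/-- The standard triangle `x 0 ≥ x 1 ≥ x 2`, `x 0 - x 2 ≤ t` with side length `t` and a corner at
the origin. The standard segments of length `t` are its two edges at the origin. -/
def tri (t : Len) : Enc where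
  carrier := halfSpaces [(0, 1, 0), (1, 2, 0), (2, 0, -t.1)]
  bounded := by
    apply isBounded_of_diff t.1
    intro x hx i j
    have ht := t.2
    simp only [halfSpaces, List.mem_cons, List.not_mem_nil, or_false,
      Set.mem_ofPred_eq, forall_eq_or_imp, forall_eq] at hx
    obtain ⟨h1, h2, h3⟩ := hx
    fin_cases i <;> fin_cases j <;> simp <;> linarith
  finite_roots := ⟨_, by simp, rfl⟩

/-- The list of root half-spaces that cut out the parallelogram. -/
def paraRoots : Parity → ℝ → ℝ → List (Fin 3 × Fin 3 × ℝ)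
  | .pos, a, b => [(0, 2, 0), (2, 0, -a), (1, 2, 0), (2, 1, -b)]
  | .neg, a, b => [(1, 2, 0), (2, 1, -a), (1, 0, 0), (0, 1, -b)]

/-- The parallelogram `P^{a,b}` with either orientation: it has a corner with angle 120 degrees at
the origin, its first edge at the origin is the standard segment of length `a`, and its second edge
is the standard segment of length `b` of the same orientation, rotated by 120 degrees. -/
def para (ε : Parity) (a b : Len) : Enc where
  carrier := halfSpaces (paraRoots ε a b)
  bounded := by
    apply isBounded_of_diff (a.1 + b.1)
    intro x hx i j
    have ha := a.2
    have hb := b.2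
    cases ε <;>
    · simp only [halfSpaces, paraRoots, List.mem_cons, List.not_mem_nil, or_false,
        Set.mem_ofPred_eq, forall_eq_or_imp, forall_eq] at hx
      obtain ⟨h1, h2, h3, h4⟩ := hx
      fin_cases i <;> fin_cases j <;> simp <;> linarith
  finite_roots := ⟨paraRoots ε a b, by cases ε <;> simp [paraRoots], rfl⟩

/-- The origin as a point of the standard segment. -/
def segOrigin (ε : Parity) (t : Len) : (seg ε t).carrier :=
  ⟨0, by
    have ht := t.2
    cases ε <;> simp [seg, segRoots, halfSpaces, ht.le]⟩

/-- The unit vector in the direction of the standard segment, times `r`. -/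
def ray : Parity → ℝ → Apt
  | .pos, r => Apt.mk3 (2 / 3 * r) (-(1 / 3) * r) (-(1 / 3) * r) (by ring)
  | .neg, r => Apt.mk3 (1 / 3 * r) (1 / 3 * r) (-(2 / 3) * r) (by ring)

/-- The point of the standard segment at distance `r` from the origin. -/
def segPoint (ε : Parity) (t r : Len) (h : r.1 ≤ t.1) : (seg ε t).carrier :=
  ⟨ray ε r.1, by
    have hr := r.2
    cases ε <;> simp [seg, segRoots, halfSpaces, ray, Apt.mk3] <;> constructor <;> linarith⟩

/-- The endpoint of the standard segment other than the origin. -/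
def segTip (ε : Parity) (t : Len) : (seg ε t).carrier := segPoint ε t t le_rfl

/-- The origin as a point of the standard triangle. -/
def triOrigin (t : Len) : (tri t).carrier :=
  ⟨0, by
    have ht := t.2
    simp [tri, halfSpaces, ht.le]⟩

/-- The origin as a point of the parallelogram. -/
def paraOrigin (ε : Parity) (a b : Len) : (para ε a b).carrier :=
  ⟨0, by
    have ha := a.2
    have hb := b.2
    cases ε <;> simp [para, paraRoots, halfSpaces, ha.le, hb.le]⟩

/-- Inclusion of a shorter standard segment in a longer one. -/
def segIncl (ε : Parity) {r t : Len} (h : r ≤ t) : seg ε r ⟶ seg ε t :=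
  Enc.incl fun x hx => by
    have h' : r.1 ≤ t.1 := h
    cases ε <;>
    · simp only [seg, segRoots, halfSpaces, List.mem_cons, List.not_mem_nil, or_false,
        Set.mem_ofPred_eq, forall_eq_or_imp, forall_eq] at hx ⊢
      obtain ⟨h1, h2, h3, h4⟩ := hx
      exact ⟨h1, h2, h3, by linarith⟩

/-- Inclusion of a smaller standard triangle in a larger one. -/
def triIncl {r t : Len} (h : r ≤ t) : tri r ⟶ tri t :=
  Enc.incl fun x hx => by
    have h' : r.1 ≤ t.1 := h
    simp only [tri, halfSpaces, List.mem_cons, List.not_mem_nil, or_false,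
      Set.mem_ofPred_eq, forall_eq_or_imp, forall_eq] at hx ⊢
    obtain ⟨h1, h2, h3⟩ := hx
    exact ⟨h1, h2, by linarith⟩

/-- The standard segment as an edge of the standard triangle. -/
def segToTri (ε : Parity) (t : Len) : seg ε t ⟶ tri t :=
  Enc.incl fun x hx => by
    have ht := t.2
    cases ε <;>
    · simp only [seg, tri, segRoots, halfSpaces, List.mem_cons, List.not_mem_nil, or_false,
        Set.mem_ofPred_eq, forall_eq_or_imp, forall_eq] at hx ⊢
      obtain ⟨h1, h2, h3, h4⟩ := hx
      exact ⟨by linarith, by linarith, by linarith⟩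

/-- The first edge of the parallelogram. -/
def edge₁ (ε : Parity) (a b : Len) : seg ε a ⟶ para ε a b :=
  Enc.incl fun x hx => by
    have hb := b.2
    cases ε <;>
    · simp only [seg, para, segRoots, paraRoots, halfSpaces, List.mem_cons, List.not_mem_nil,
        or_false, Set.mem_ofPred_eq, forall_eq_or_imp, forall_eq] at hx ⊢
      obtain ⟨h1, h2, h3, h4⟩ := hx
      refine ⟨?_, ?_, ?_, ?_⟩ <;> linarith

/-- The second edge of the parallelogram: the standard segment of length `b`, rotated by 120 degrees
by cyclic permutation of the coordinates. -/
def edge₂ (ε : Parity) (a b : Len) : seg ε b ⟶ para ε a b :=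
  Enc.homOf (finRotate 3)⁻¹ 0 fun x hx => by
    have ha := a.2
    have e0 : (finRotate 3)⁻¹ (0 : Fin 3) = 2 := by decide
    have e1 : (finRotate 3)⁻¹ (1 : Fin 3) = 0 := by decide
    have e2 : (finRotate 3)⁻¹ (2 : Fin 3) = 1 := by decide
    cases ε <;>
    · simp only [seg, para, segRoots, paraRoots, halfSpaces, List.mem_cons, List.not_mem_nil,
        or_false, Set.mem_ofPred_eq, forall_eq_or_imp, forall_eq, weyl_apply, e0, e1, e2] at hx ⊢
      obtain ⟨h1, h2, h3, h4⟩ := hx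
      simp only [ZeroMemClass.coe_zero, PiLp.zero_apply, add_zero]
      refine ⟨?_, ?_, ?_, ?_⟩ <;> linarith

/-! ### The underlying topological space -/

/-- The set `F(p)` of points of a sheaf. -/
def Pts (F : Sh) : Type := Sec F pt

/-- The value of a map `s : E ⟶ F` at a point of the enclosure `E`. -/
def ev {F : Sh} {E : Enc} (s : Sec F E) (z : E.carrier) : Pts F := res (ptTo z) s

/-- A set of points is open if its preimage under every map from an enclosure is open. -/
instance (F : Sh) : TopologicalSpace (Pts F) :=
  ⨆ (E : Enc), ⨆ (s : Sec F E), TopologicalSpace.coinduced (ev s) inferInstance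

theorem ev_res {F : Sh} {D E : Enc} (u : D ⟶ E) (s : Sec F E) (z : D.carrier) :
    ev (res u s) z = ev s (u.1 z) := by
  have : ptTo z ≫ u = ptTo (u.1 z) := by
    apply Enc.hom_ext
    intro x
    have h0 : ∀ {E : Enc} (w : E.carrier), (ptTo w).1 x = w := by
      intro E w
      apply Subtype.ext
      apply Apt.ext'
      intro i
      have hx : x.1 = 0 := x.2
      simp [ptTo, Enc.homOf, hx]
    rw [Enc.comp_apply, h0, h0]
  rw [ev, ev, ← this, res_comp]

/-! ### Spherical constructions -/

/-- A spherical construction: a graph, possibly with multiple edges, in which every vertex has a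
parity and every edge has one endpoint of each parity. -/
structure Spherical : Type 1 where
  Edge : Type
  Vert : Parity → Type
  face : ∀ ε, Edge → Vert ε

namespace Spherical

variable (H : Spherical)

abbrev Vertex : Type := Σ ε, H.Vert ε

/-- `p` and `q` are joined by an edge. -/
def Joined (p : H.Vert .pos) (q : H.Vert .neg) : Prop :=
  ∃ e : H.Edge, H.face .pos e = p ∧ H.face .neg e = q

/-- The underlying simple graph, used for the distance between vertices. -/
def graph : SimpleGraph H.Vertex where
  Adj u v := ∃ p q, H.Joined p q ∧ ((u = ⟨.pos, p⟩ ∧ v = ⟨.neg, q⟩) ∨ (u = ⟨.neg, q⟩ ∧ v = ⟨.pos, p⟩))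
  symm := ⟨by
    rintro u v ⟨p, q, h, h' | h'⟩
    · exact ⟨p, q, h, Or.inr ⟨h'.2, h'.1⟩⟩
    · exact ⟨p, q, h, Or.inl ⟨h'.2, h'.1⟩⟩⟩
  loopless := ⟨by
    rintro u ⟨p, q, h, h' | h'⟩
    · have := h'.1.symm.trans h'.2
      cases this
    · have := h'.1.symm.trans h'.2
      cases this⟩

/-- There are no loops of length at most 4. (The length of a loop is even.) -/
def NoShortLoops : Prop :=
  (∀ e e' : H.Edge, (∀ ε, H.face ε e = H.face ε e') → e = e') ∧
  (∀ (p p' : H.Vert .pos) (q q' : H.Vert .neg),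
    H.Joined p q → H.Joined p' q → H.Joined p' q' → H.Joined p q' → p = p' ∨ q = q')

/-- Spherical buildings: nonempty, any two vertices are at distance at most 3 and lie in a common
hexagon, and there are no loops of length at most 4. -/
structure IsBuilding : Prop where
  nonempty : Nonempty H.Vertex
  edist_le : ∀ u v, H.graph.edist u v ≤ 3
  hexagon : ∀ u v, ∃ c : ZMod 6 → H.Vertex, Function.Injective c ∧
    (∀ i, H.graph.Adj (c i) (c (i + 1))) ∧ u ∈ Set.range c ∧ v ∈ Set.range c
  noShortLoops : H.NoShortLoops

end Spherical

/-! ### The local spherical construction at a point -/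

section Germs

variable (F : Sh)

/-- Two maps from standard segments to `F` have the same germ if they agree on a smaller one. -/
def vertSetoid (ε : Parity) : Setoid (Σ t : Len, Sec F (seg ε t)) where
  r s s' := ∃ (r : Len) (h : r ≤ s.1) (h' : r ≤ s'.1),
    res (segIncl ε h) s.2 = res (segIncl ε h') s'.2
  iseqv := {
    refl := fun s => ⟨s.1, le_rfl, le_rfl, rfl⟩
    symm := fun ⟨r, h, h', e⟩ => ⟨r, h', h, e.symm⟩
    trans := by
      rintro s s' s'' ⟨r, h, h', e⟩ ⟨q, k, k', e'⟩
      refine ⟨min r q, (min_le_left _ _).trans h, (min_le_right _ _).trans k', ?_⟩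
      have e1 := congrArg (res (segIncl ε (min_le_left r q))) e
      have e2 := congrArg (res (segIncl ε (min_le_right r q))) e'
      rw [← res_comp, ← res_comp] at e1 e2
      exact e1.trans e2 }

/-- Two maps from standard triangles to `F` have the same germ if they agree on a smaller one. -/
def edgeSetoid : Setoid (Σ t : Len, Sec F (tri t)) where
  r s s' := ∃ (r : Len) (h : r ≤ s.1) (h' : r ≤ s'.1),
    res (triIncl h) s.2 = res (triIncl h') s'.2
  iseqv := {
    refl := fun s => ⟨s.1, le_rfl, le_rfl, rfl⟩
    symm := fun ⟨r, h, h', e⟩ => ⟨r, h', h, e.symm⟩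
    trans := by
      rintro s s' s'' ⟨r, h, h', e⟩ ⟨q, k, k', e'⟩
      refine ⟨min r q, (min_le_left _ _).trans h, (min_le_right _ _).trans k', ?_⟩
      have e1 := congrArg (res (triIncl (min_le_left r q))) e
      have e2 := congrArg (res (triIncl (min_le_right r q))) e'
      rw [← res_comp, ← res_comp] at e1 e2
      exact e1.trans e2 }

/-- The vertices of parity `ε` of all local spherical constructions of `F`: germs at the origin of
maps from one-dimensional sectors to `F`. (The standard segments are cofinal among the enclosures
whose corner at the origin is the one-dimensional sector.) -/
def VGerm (ε : Parity) : Type := Quotient (vertSetoid F ε)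

/-- The edges of all local spherical constructions of `F`: germs at the origin of maps from the
two-dimensional sector to `F`. (The standard triangles are cofinal among the enclosures whose corner
at the origin is the two-dimensional sector.) -/
def EGerm : Type := Quotient (edgeSetoid F)

variable {F}

def VGerm.mk {ε : Parity} {t : Len} (s : Sec F (seg ε t)) : VGerm F ε :=
  Quotient.mk (vertSetoid F ε) ⟨t, s⟩

def EGerm.mk {t : Len} (s : Sec F (tri t)) : EGerm F := Quotient.mk (edgeSetoid F) ⟨t, s⟩

/-- The point at which a germ is based. -/
def VGerm.base {ε : Parity} : VGerm F ε → Pts F :=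
  Quotient.lift (fun s => ev s.2 (segOrigin ε s.1)) (by
    rintro s s' ⟨r, h, h', e⟩
    have := congrArg (fun w => ev w (segOrigin ε r)) e
    simp only [ev_res] at this
    exact this)

@[simp] theorem VGerm.base_mk {ε : Parity} {t : Len} (s : Sec F (seg ε t)) :
    (VGerm.mk s).base = ev s (segOrigin ε t) := rfl

/-- The point at which a germ is based. -/
def EGerm.base : EGerm F → Pts F :=
  Quotient.lift (fun s => ev s.2 (triOrigin s.1)) (by
    rintro s s' ⟨r, h, h', e⟩
    have := congrArg (fun w => ev w (triOrigin r)) e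
    simp only [ev_res] at this
    exact this)

@[simp] theorem EGerm.base_mk {t : Len} (s : Sec F (tri t)) :
    (EGerm.mk s).base = ev s (triOrigin t) := rfl

/-- The endpoint of parity `ε` of an edge. -/
def EGerm.face (ε : Parity) : EGerm F → VGerm F ε :=
  Quotient.map (fun s => ⟨s.1, res (segToTri ε s.1) s.2⟩) (by
    rintro s s' ⟨r, h, h', e⟩
    refine ⟨r, h, h', ?_⟩
    have := congrArg (res (segToTri ε r)) e
    rw [← res_comp, ← res_comp] at this
    simp only [← res_comp]
    exact this)

@[simp] theorem EGerm.face_mk (ε : Parity) {t : Len} (s : Sec F (tri t)) :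
    (EGerm.mk s).face ε = VGerm.mk (res (segToTri ε t) s) := rfl

theorem EGerm.base_face (ε : Parity) (e : EGerm F) : (e.face ε).base = e.base := by
  induction e using Quotient.inductionOn with
  | h s => exact ev_res (segToTri ε s.1) s.2 (segOrigin ε s.1)

/-- The map of edges of local spherical constructions induced by a map of sheaves. -/
def EGerm.push {G : Sh} (f : F ⟶ G) : EGerm F → EGerm G :=
  Quotient.map (fun s => ⟨s.1, SL3.push f s.2⟩) (by
    rintro s s' ⟨r, h, h', e⟩
    refine ⟨r, h, h', ?_⟩
    have := congrArg (SL3.push f) e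
    simp only [res_push]
    exact this)

@[simp] theorem EGerm.push_mk {G : Sh} (f : F ⟶ G) {t : Len} (s : Sec F (tri t)) :
    (EGerm.mk s).push f = EGerm.mk (SL3.push f s) := rfl

end Germs

/-- The local spherical construction `F_x`. -/
def link (F : Sh) (x : Pts F) : Spherical where
  Edge := {e : EGerm F // e.base = x}
  Vert ε := {v : VGerm F ε // v.base = x}
  face ε e := ⟨e.1.face ε, (EGerm.base_face ε e.1).trans e.2⟩

/-- A vertex of the local spherical construction `E_z` of an enclosure: represented by an affine map
from a standard segment to `E` that starts at `z`. -/
structure Dir (E : Enc) (z : E.carrier) (ε : Parity) : Type where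
  len : Len
  map : seg ε len ⟶ E
  start : map.1 (segOrigin ε len) = z

/-- The vector by which a direction moves along `E`. -/
def Dir.vec {E : Enc} {z : E.carrier} {ε : Parity} (d : Dir E z ε) : Apt :=
  (d.map.1 (segTip ε d.len)).1 - z.1

/-- The image of a direction of `E` at `z` under a map `s : E ⟶ F`. -/
def Dir.image {F : Sh} {E : Enc} {z : E.carrier} {ε : Parity} (d : Dir E z ε) (s : Sec F E) :
    (link F (ev s z)).Vert ε :=
  ⟨VGerm.mk (res d.map s), by rw [VGerm.base_mk, ev_res, d.start]⟩

/-- An edge of the local spherical construction `E_z` of an enclosure: represented by an affine map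
from a standard triangle to `E` that starts at `z`. -/
structure Corner (E : Enc) (z : E.carrier) : Type where
  len : Len
  map : tri len ⟶ E
  start : map.1 (triOrigin len) = z

/-- The image of an edge of `E_z` under a map `s : E ⟶ F`. -/
def Corner.image {F : Sh} {E : Enc} {z : E.carrier} (c : Corner E z) (s : Sec F E) : EGerm F :=
  EGerm.mk (res c.map s)

/-- A map `s : E ⟶ F` is immersive if at every point `z` the map `E_z ⟶ F_{s(z)}` preserves distances
of vertices. The distances in `E_z` are those of the hexagon of the six directions of the plane:
two directions are at distance `n` if their angle is `n` times 60 degrees. -/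
def Immersive {F : Sh} {E : Enc} (s : Sec F E) : Prop :=
  ∀ (z : E.carrier) (ε ε' : Parity) (d : Dir E z ε) (d' : Dir E z ε'), ∃ n : ℕ,
    (link F (ev s z)).graph.edist ⟨ε, d.image s⟩ ⟨ε', d'.image s⟩ = n ∧
    InnerProductGeometry.angle d.vec d'.vec = n * (Real.pi / 3)

/-! ### Buildings -/

/-- Extension of straight segments: an immersive segment `φ` of length `t` extends to an immersive
segment of any length `t' > t`, whose direction at the former endpoint is any given vertex opposite
to the backward direction of `φ` there. -/
def ExSeg (F : Sh) : Prop :=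
  ∀ (ε : Parity) (t : Len) (φ : Sec F (seg ε t)), Immersive φ →
    ∀ (d : Dir (seg ε t) (segTip ε t) ε.flip) (ν : (link F (ev φ (segTip ε t))).Vert ε),
      (link F (ev φ (segTip ε t))).graph.edist ⟨ε.flip, d.image φ⟩ ⟨ε, ν⟩ = 3 →
      ∀ (t' : Len) (h : t < t'), ∃ φ' : Sec F (seg ε t'), Immersive φ' ∧
        res (segIncl ε h.le) φ' = φ ∧
        ∀ d' : Dir (seg ε t') (segPoint ε t' t h.le) ε, (d'.image φ').1 = ν.1

/-- Extension for obtuse angles: two immersive segments of the same orientation that start at the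
same point in different directions (that is, directions at distance at least 2) are the two edges at
the origin of an immersive parallelogram. -/
def ExObt (F : Sh) : Prop :=
  ∀ (ε : Parity) (a b : Len) (φ : Sec F (seg ε a)) (ψ : Sec F (seg ε b)),
    ev φ (segOrigin ε a) = ev ψ (segOrigin ε b) → VGerm.mk φ ≠ VGerm.mk ψ →
    Immersive φ → Immersive ψ →
    ∃ ζ : Sec F (para ε a b), Immersive ζ ∧ res (edge₁ ε a b) ζ = φ ∧ res (edge₂ ε a b) ζ = ψ

/-- Buildings: constructions whose space of points is connected and simply connected, whose
local spherical constructions are spherical buildings, and which satisfy the two extension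
properties. -/
structure IsBuilding (F : Sh) : Prop where
  construction : IsConstruction F
  connected : ConnectedSpace (Pts F)
  simplyConnected : SimplyConnectedSpace (Pts F)
  spherical : ∀ x : Pts F, (link F x).IsBuilding
  exSeg : ExSeg F
  exObt : ExObt F

/-! ### Apartments -/

/-- The presheaf of affine maps (restrictions of affine Weyl group elements) from enclosures to the
plane. -/
def aptPresheaf : Encᵒᵖ ⥤ Type where
  obj E := {f : E.unop.carrier → Apt // IsWeyl f}
  map u := TypeCat.ofHom fun f => ⟨f.1 ∘ u.unop.1, by
    obtain ⟨π, t, h⟩ := f.2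
    obtain ⟨ρ, s, k⟩ := u.unop.2
    refine ⟨ρ * π, weyl π t s, fun x => ?_⟩
    have h1 := k x
    have h2 := h (u.unop.1 x)
    simp only [Function.comp_apply] at *
    rw [h2, h1, weyl_weyl]⟩

/-- The sheaf of the plane: its sections over `E` are the folding maps from `E` to the plane. -/
def aptSheaf : Sh := (presheafToSheaf encTopology (Type)).obj aptPresheaf

/-- The map of sheaves given by an affine map from an enclosure to the plane. -/
def toAptSheaf {E : Enc} (j : {f : E.carrier → Apt // IsWeyl f}) : tilde.obj E ⟶ aptSheaf :=
  (presheafToSheaf encTopology (Type)).map (yonedaEquiv.symm (show aptPresheaf.obj (op E) from j))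

/-- The inclusion of an enclosure in the plane. -/
def aptIncl (E : Enc) : {f : E.carrier → Apt // IsWeyl f} :=
  ⟨Subtype.val, 1, 0, fun x => (weyl_one_zero x.1).symm⟩

/-- An apartment of `B` is a map from the plane to `B` that is immersive on every enclosure in
the plane. -/
def IsApartment {B : Sh} (α : aptSheaf ⟶ B) : Prop :=
  ∀ E : Enc, Immersive (push (toAptSheaf (aptIncl E) ≫ α) (taut E))

/-- The map `h : E ⟶ B` is an isometric embedding of the enclosure `E` into a single apartment of
`B`: it is an isometric affine map from `E` to the plane followed by an apartment. -/
def IsIsometricInApartment {B : Sh} {E : Enc} (h : tilde.obj E ⟶ B) : Prop :=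
  ∃ (α : aptSheaf ⟶ B) (j : {f : E.carrier → Apt // IsWeyl f}),
    IsApartment α ∧ Isometry j.1 ∧ toAptSheaf j ≫ α = h

/-! ### Scaffoldings -/

/-- An edge germ `(x, v, a, b)` of `F`: a vertex `v` of some `F_x` and two different edges `a`, `b` of
`F_x` with common endpoint `v`. The point `x` is the base point of `v`. -/
@[ext]
structure EdgeGerm (F : Sh) : Type where
  parity : Parity
  v : VGerm F parity
  a : EGerm F
  b : EGerm F
  face_a : a.face parity = v
  face_b : b.face parity = v
  ne : a ≠ b

/-- The map `f` folds along the edge germ. -/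
def EdgeGerm.Folds {F G : Sh} (f : F ⟶ G) (g : EdgeGerm F) : Prop := g.a.push f = g.b.push f

/-- A scaffolding: disjoint sets of edge germs marked "open" and "fold". -/
structure Scaffolding (F : Sh) : Type where
  opn : Set (EdgeGerm F)
  fold : Set (EdgeGerm F)
  disjoint : Disjoint opn fold

namespace Scaffolding

variable {F : Sh} (σ : Scaffolding F)

/-- The map `f` is compatible with the scaffolding. -/
def Compatible {G : Sh} (f : F ⟶ G) : Prop :=
  (∀ g ∈ σ.fold, g.Folds f) ∧ ∀ g ∈ σ.opn, ¬ g.Folds f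

/-- There is a compatible map to a building. -/
def Coherent : Prop := ∃ (B : Sh) (h : F ⟶ B), IsBuilding B ∧ σ.Compatible h

/-- The edge germ formed by the edges `a` and `b` at their common endpoint of parity `ε` is marked
"open". -/
def OpenAt (ε : Parity) (a b : EGerm F) : Prop :=
  ∃ g ∈ σ.opn, g.parity = ε ∧ ((g.a = a ∧ g.b = b) ∨ (g.a = b ∧ g.b = a))

/-- A segment `φ : S ⟶ F` is straight: at every interior point of `S`, the forward (positive) and
backward (negative) directions along `φ` are joined by a path of three edges `a`, `b`, `c` such that
the edge germs `ab` and `bc` are marked "open". (The interior points of a segment are those at which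
it has directions of both parities.) -/
def Straight {S : Enc} (φ : Sec F S) : Prop :=
  ∀ (z : S.carrier) (d : Dir S z .pos) (d' : Dir S z .neg), ∃ a b c : EGerm F,
    a.face .pos = (d.image φ).1 ∧ a.face .neg = b.face .neg ∧ b.face .pos = c.face .pos ∧
    c.face .neg = (d'.image φ).1 ∧ σ.OpenAt .neg a b ∧ σ.OpenAt .pos b c

end Scaffolding

/-! ### The union of two parallelograms along two edges -/

section Patch

variable (ε : Parity) (a b : Len)

/-- `V^{a,b}`: the union of two segments of lengths `a` and `b` at the origin. -/
def V : Sh := pushout (tilde.map (ptTo (segOrigin ε a))) (tilde.map (ptTo (segOrigin ε b)))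

theorem ptTo_edge : ptTo (segOrigin ε a) ≫ edge₁ ε a b = ptTo (segOrigin ε b) ≫ edge₂ ε a b := by
  apply Enc.hom_ext
  intro x
  have hx : x.1 = 0 := x.2
  apply Apt.ext'
  intro i
  simp [Enc.comp_apply, ptTo, edge₁, edge₂, Enc.homOf, Enc.incl, hx, segOrigin]

/-- `V^{a,b}` as the union of the two edges of `P^{a,b}` at the origin. -/
def VtoP : V ε a b ⟶ tilde.obj (para ε a b) :=
  pushout.desc (tilde.map (edge₁ ε a b)) (tilde.map (edge₂ ε a b)) (by
    rw [← tilde.map_comp, ← tilde.map_comp, ptTo_edge])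

/-- `W^{a,b}`: two copies of `P^{a,b}` glued along `V^{a,b}`. -/
def W : Sh := pushout (VtoP ε a b) (VtoP ε a b)

/-- The two copies of `P^{a,b}` in `W^{a,b}`. -/
def piece₁ : tilde.obj (para ε a b) ⟶ W ε a b := pushout.inl _ _

def piece₂ : tilde.obj (para ε a b) ⟶ W ε a b := pushout.inr _ _

/-- The projection that is the identity on each of the two pieces. -/
def proj : W ε a b ⟶ tilde.obj (para ε a b) := pushout.desc (𝟙 _) (𝟙 _) rfl

variable {ε a b}

/-- The edge germ `g` of `F` is the image, under a map `s : P^{a,b} ⟶ F`, of the middle edge germ of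
`P^{a,b}` at the origin. Of the three vertices of the spherical construction of `P^{a,b}` at the
origin, the two end vertices have parity `ε` and the middle one has the other parity; its two edges
are the only edges. -/
def IsMiddle {F : Sh} (s : Sec F (para ε a b)) (g : EdgeGerm F) : Prop :=
  g.parity = ε.flip ∧ ∃ c c' : Corner (para ε a b) (paraOrigin ε a b),
    g.a = c.image s ∧ g.b = c'.image s

end Patch

end

end SL3

/-!
The theorem says that a compatible map `h` from the union of two parallelograms along two edges to a
building `B` identifies the two parallelograms and maps them to one apartment. There are three
ideas.

*Working with points.* The finiteness condition on a construction says that two sections over an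
enclosure have the same value exactly at the points of a finite union of enclosures on which they
are equal as sections (`IsConstruction.exists_coincidence`). Hence sections are determined by their
values at points, they can be glued from compatible pieces, and vertices and edges of the local
spherical buildings are germs of functions with values in the set of points. What is used of the
local buildings is that distances are at most three, that opposite vertices exist, that an edge is
determined by its endpoints (`EGerm.eq_of_face`), and that a closed path of length four backtracks
(`JoinedG.eq_or_eq`). Two consequences are used throughout: a map is immersive if it does not fold
two directions at 120 degrees and does not join opposite directions (`immersive_of`), and two maps
that agree on the sides of an angle of 120 degrees and do not fold it agree near its vertex
(`agree_para`).

*Uniqueness.* An immersive map from a parallelogram is determined, among all maps, by its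
restriction to the two edges at a corner of 120 degrees (`para_unique`). One looks at the
lexicographically first point of the closure of the set where two such maps differ, and applies
`agree_para` there.

*Apartments.* A map that is compatible with the scaffolding is immersive on straight edges
(`Scaffolding.Straight.immersive`), and does not fold the corner of the parallelogram, since the
edge germ there is open (`not_fold_of_middle`). The two edges therefore extend to immersive rays
with different directions at the origin, and span a sector of 120 degrees. Extending the bisector of
this sector beyond the origin gives a third ray, and the three rays bound three sectors that
together form a function on the plane, a tripod (`IsBuilding.exists_tripod`). A tripod does not fold
at the origin by the choice of the third ray, and not in the interior of the sectors. If it folded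
at a point of a ray, then it would be invariant near this point under the reflection in the ray, and
by uniqueness it would fold at the origin (`IsTripod.not_fold_ray`). Thus a tripod does not fold at
all, and is an apartment (`IsTripod.immersive`). The two maps from the parallelogram agree with the
tripod on the edges, hence everywhere.
-/

namespace SL3

/-! ### Sections of a construction as functions on points -/

theorem ptTo_apply {E : Enc} (w : E.carrier) (x : pt.carrier) : (ptTo w).1 x = w := by
  apply Subtype.ext
  apply Apt.ext'
  intro i
  have hx : x.1 = 0 := x.2
  simp [ptTo, Enc.homOf, hx]

/-- The fixed points of an affine Weyl group element are cut out by finitely many root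
half-spaces. -/
theorem exists_halfSpaces_fixed (π : Equiv.Perm (Fin 3)) (t : Apt) :
    ∃ L : List (Fin 3 × Fin 3 × ℝ), (∀ h ∈ L, h.1 ≠ h.2.1) ∧
      ∀ x, x ∈ halfSpaces L ↔ weyl π t x = x := by
  -- the equation in the `i`-th coordinate is a root equation if `π i ≠ i`, and otherwise it
  -- holds everywhere or nowhere
  have key : ∀ i : Fin 3, ∃ L : List (Fin 3 × Fin 3 × ℝ), (∀ h ∈ L, h.1 ≠ h.2.1) ∧
      ∀ x, x ∈ halfSpaces L ↔ x.1 (π i) + t.1 i = x.1 i := by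
    intro i
    by_cases hi : π i = i
    · by_cases ht : t.1 i = 0
      · exact ⟨[], by simp, fun x => by simp [halfSpaces, hi, ht]⟩
      · refine ⟨[(0, 1, 1), (1, 0, 0)], by simp, fun x => ?_⟩
        simp only [halfSpaces, List.mem_cons, List.not_mem_nil, or_false, Set.mem_ofPred_eq,
          forall_eq_or_imp, forall_eq, hi, add_eq_left, ht, iff_false, not_and, not_le]
        intro h
        linarith
    · refine ⟨[(π i, i, -t.1 i), (i, π i, t.1 i)], by simp [hi, Ne.symm hi], fun x => ?_⟩
      simp only [halfSpaces, List.mem_cons, List.not_mem_nil, or_false, Set.mem_ofPred_eq,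
        forall_eq_or_imp, forall_eq]
      constructor
      · rintro ⟨h1, h2⟩
        linarith
      · intro h
        constructor <;> linarith
  choose L hL hx using key
  refine ⟨L 0 ++ L 1 ++ L 2, ?_, fun x => ?_⟩
  · intro h hh
    simp only [List.mem_append] at hh
    rcases hh with (hh | hh) | hh
    exacts [hL _ _ hh, hL _ _ hh, hL _ _ hh]
  · have h1 : x ∈ halfSpaces (L 0 ++ L 1 ++ L 2) ↔
        x ∈ halfSpaces (L 0) ∧ x ∈ halfSpaces (L 1) ∧ x ∈ halfSpaces (L 2) := by
      simp only [halfSpaces, List.mem_append, Set.mem_ofPred_eq]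
      constructor
      · intro h
        exact ⟨fun k hk => h k (Or.inl (Or.inl hk)), fun k hk => h k (Or.inl (Or.inr hk)),
          fun k hk => h k (Or.inr hk)⟩
      · rintro ⟨h1, h2, h3⟩ k ((hk | hk) | hk)
        exacts [h1 k hk, h2 k hk, h3 k hk]
    rw [h1, hx, hx, hx]
    constructor
    · rintro ⟨h1, h2, h3⟩
      apply Apt.ext'
      intro i
      rw [weyl_apply]
      fin_cases i <;> assumption
    · intro h
      have h2 : ∀ i, x.1 (π i) + t.1 i = x.1 i := fun i => by
        rw [← weyl_apply, h]
      exact ⟨h2 0, h2 1, h2 2⟩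

/-- The fixed points in an enclosure of an affine Weyl group element. -/
def Enc.fixed (E : Enc) (π : Equiv.Perm (Fin 3)) (t : Apt) : Enc where
  carrier := {y | y ∈ E.carrier ∧ weyl π t y = y}
  bounded := E.bounded.subset fun _ h => h.1
  finite_roots := by
    obtain ⟨L, hL, hE⟩ := E.finite_roots
    obtain ⟨M, hM, hx⟩ := exists_halfSpaces_fixed π t
    refine ⟨L ++ M, ?_, ?_⟩
    · intro h hh
      rcases List.mem_append.1 hh with hh | hh
      exacts [hL h hh, hM h hh]
    · ext y
      change (y ∈ E.carrier ∧ _) ↔ _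
      rw [← hx, hE]
      simp only [halfSpaces, List.mem_append, Set.mem_ofPred_eq]
      constructor
      · rintro ⟨h1, h2⟩ k (hk | hk)
        exacts [h1 k hk, h2 k hk]
      · intro h
        exact ⟨fun k hk => h k (Or.inl hk), fun k hk => h k (Or.inr hk)⟩

/-- The finiteness condition on constructions, for two sections over the same enclosure: the set of
points where they have the same value is a finite union of enclosures on which they are equal. -/
theorem IsConstruction.exists_coincidence {F : Sh} (hF : IsConstruction F) {E : Enc}
    (s s' : Sec F E) :
    ∃ (n : ℕ) (C : Fin n → Enc) (hC : ∀ k, (C k).carrier ⊆ E.carrier),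
      (∀ k, res (Enc.incl (hC k)) s = res (Enc.incl (hC k)) s') ∧
      ∀ z : E.carrier, ev s z = ev s' z → ∃ k, z.1 ∈ (C k).carrier := by
  obtain ⟨n, D, q, hq⟩ := hF E E s s'
  choose π t hπ using fun k => (q k).1.1.2
  choose ρ r hρ using fun k => (q k).1.2.2
  -- the enclosure `C k` is the image in `E` of the equalizer of the two maps `D k ⟶ E`
  let C : Fin n → Enc := fun k =>
    (E.inter (D k) (π k)⁻¹ (weylInvTrans (π k) (t k))).fixed
      ((π k)⁻¹ * (ρ k)) (weyl (ρ k) (r k) (weylInvTrans (π k) (t k)))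
  have hC : ∀ k, (C k).carrier ⊆ E.carrier := fun k x hx => hx.1.1
  refine ⟨n, C, hC, fun k => ?_, fun z hz => ?_⟩
  · let v : C k ⟶ D k := Enc.homOf (π k)⁻¹ (weylInvTrans (π k) (t k)) fun x hx => hx.1.2
    have h1 : v ≫ (q k).1.1 = Enc.incl (hC k) := by
      apply Enc.hom_ext
      intro x
      rw [Enc.comp_apply]
      exact (hπ k (v.1 x)).trans (weyl_inv_right _ _ _)
    have h2 : v ≫ (q k).1.2 = Enc.incl (hC k) := by
      apply Enc.hom_ext
      intro x
      rw [Enc.comp_apply]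
      refine (hρ k (v.1 x)).trans ?_
      have h3 := x.2.2
      rw [← weyl_weyl] at h3
      exact h3
    rw [← h1, res_comp, h1, ← h2, res_comp, (q k).2]
  · obtain ⟨S, hS, hSq⟩ := hq pt ⟨(ptTo z, ptTo z), hz⟩
    obtain ⟨m, D', f', hf', hc⟩ := hS
    obtain ⟨l, y, -⟩ := hc ⟨0, rfl⟩
    obtain ⟨k, v, hv⟩ := hSq _ (f' l) (hf' l)
    have h1 : f' l ≫ ptTo z = v ≫ (q k).1.1 := congrArg (fun w => w.1.1) hv
    have h2 : f' l ≫ ptTo z = v ≫ (q k).1.2 := congrArg (fun w => w.1.2) hv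
    have e1 : z.1 = ((q k).1.1.1 (v.1 y)).1 := by
      have := congrArg (fun w => (w.1 y).1) h1
      simpa [Enc.comp_apply, ptTo_apply] using this
    have e2 : z.1 = ((q k).1.2.1 (v.1 y)).1 := by
      have := congrArg (fun w => (w.1 y).1) h2
      simpa [Enc.comp_apply, ptTo_apply] using this
    have e3 : weyl (π k)⁻¹ (weylInvTrans (π k) (t k)) z.1 = (v.1 y).1 := by
      rw [e1]
      refine Eq.trans (congrArg _ (hπ k (v.1 y))) (weyl_inv_left _ _ _)
    refine ⟨k, ⟨z.2, ?_⟩, ?_⟩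
    · rw [e3]
      exact (v.1 y).2
    · rw [← weyl_weyl, e3]
      exact (hρ k (v.1 y)).symm.trans e2.symm

theorem Sh.isSheaf (F : Sh) : Presieve.IsSheaf encTopology F.obj :=
  (isSheaf_iff_isSheaf_of_type _ _).1 F.property

theorem generate_mem_encTopology {E : Enc} {n : ℕ} (D : Fin n → Enc) (f : ∀ k, D k ⟶ E)
    (hf : ∀ x : E.carrier, ∃ k, ∃ y : (D k).carrier, (f k).1 y = x) :
    Sieve.generate (Presieve.ofArrows D f) ∈ encTopology E :=
  ⟨n, D, f, fun k => Sieve.le_generate _ _ _ (Presieve.ofArrows.mk k), hf⟩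

/-- A section of a construction is determined by its values at points. -/
theorem IsConstruction.sec_ext {F : Sh} (hF : IsConstruction F) {E : Enc} {s s' : Sec F E}
    (h : ∀ z, ev s z = ev s' z) : s = s' := by
  obtain ⟨n, C, hC, he, hz⟩ := hF.exists_coincidence s s'
  refine (F.isSheaf _ (generate_mem_encTopology C (fun k => Enc.incl (hC k)) fun x => ?_)
    ).isSeparatedFor.ext ?_
  · obtain ⟨k, hk⟩ := hz x (h x)
    exact ⟨k, ⟨x.1, hk⟩, rfl⟩
  · rintro Y _ ⟨Z, g, _, ⟨k⟩, rfl⟩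
    change res _ s = res _ s'
    rw [res_comp, res_comp, he]

/-- Sections over the pieces of a finite covering that have compatible values at points can be
glued. -/
theorem IsConstruction.exists_glue {F : Sh} (hF : IsConstruction F) {E : Enc} {n : ℕ}
    (D : Fin n → Enc) (f : ∀ k, D k ⟶ E)
    (hf : ∀ x : E.carrier, ∃ k, ∃ y : (D k).carrier, (f k).1 y = x)
    (s : ∀ k, Sec F (D k)) (g : E.carrier → Pts F) (hs : ∀ k y, ev (s k) y = g ((f k).1 y)) :
    ∃ t : Sec F E, ∀ x, ev t x = g x := by
  have h1 := F.isSheaf _ (generate_mem_encTopology D f hf)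
  rw [← Presieve.isSheafFor_iff_generate, Presieve.isSheafFor_arrows_iff] at h1
  obtain ⟨t, ht, -⟩ := h1 s (by
    intro i j Z gi gj e
    change res gi (s i) = res gj (s j)
    apply hF.sec_ext
    intro z
    rw [ev_res, ev_res, hs, hs, ← Enc.comp_apply, e, Enc.comp_apply])
  refine ⟨t, fun x => ?_⟩
  obtain ⟨k, y, rfl⟩ := hf x
  rw [← hs, ← ht k]
  exact (ev_res (f k) t y).symm

variable {F : Sh}

/-- The section `s` over `E` has the values of `g` at the points of `E`. -/
def Rep {E : Enc} (s : Sec F E) (g : Apt → Pts F) : Prop := ∀ z : E.carrier, ev s z = g z.1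

/-- The restriction of `g` to `E` is the function on points of a map `E ⟶ F`. -/
def Plot (E : Enc) (g : Apt → Pts F) : Prop := ∃ s : Sec F E, Rep s g

/-- The restriction of `g` to `E` is the function on points of an immersive map `E ⟶ F`. -/
def IPlot (E : Enc) (g : Apt → Pts F) : Prop := ∃ s : Sec F E, Immersive s ∧ Rep s g

theorem IPlot.plot {E : Enc} {g : Apt → Pts F} (h : IPlot E g) : Plot E g :=
  ⟨h.choose, h.choose_spec.2⟩

theorem IsConstruction.rep_ext (hF : IsConstruction F) {E : Enc} {s s' : Sec F E}
    {g g' : Apt → Pts F} (h : Rep s g) (h' : Rep s' g') (e : ∀ x ∈ E.carrier, g x = g' x) :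
    s = s' :=
  hF.sec_ext fun z => by rw [h, h', e z.1 z.2]

theorem Rep.res {D E : Enc} {s : Sec F E} {g : Apt → Pts F} (h : Rep s g) (u : D ⟶ E)
    {π : Equiv.Perm (Fin 3)} {t : Apt} (hu : ∀ x, (u.1 x).1 = weyl π t x.1) :
    Rep (res u s) (fun x => g (weyl π t x)) := fun z => by
  rw [ev_res, h, hu]

theorem Rep.congr {E : Enc} {s : Sec F E} {g g' : Apt → Pts F} (h : Rep s g)
    (e : ∀ x ∈ E.carrier, g x = g' x) : Rep s g' := fun z => by rw [h, e z.1 z.2]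

theorem Plot.congr {E : Enc} {g g' : Apt → Pts F} (h : Plot E g)
    (e : ∀ x ∈ E.carrier, g x = g' x) : Plot E g' :=
  ⟨h.choose, h.choose_spec.congr e⟩

theorem IPlot.congr {E : Enc} {g g' : Apt → Pts F} (h : IPlot E g)
    (e : ∀ x ∈ E.carrier, g x = g' x) : IPlot E g' :=
  ⟨h.choose, h.choose_spec.1, h.choose_spec.2.congr e⟩

theorem Plot.comp_weyl {D E : Enc} {g : Apt → Pts F} (h : Plot E g)
    (π : Equiv.Perm (Fin 3)) (t : Apt) (hD : ∀ x ∈ D.carrier, weyl π t x ∈ E.carrier) :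
    Plot D (fun x => g (weyl π t x)) :=
  ⟨_, h.choose_spec.res (Enc.homOf π t hD) fun _ => rfl⟩

theorem Plot.mono {D E : Enc} {g : Apt → Pts F} (h : Plot E g) (hD : D.carrier ⊆ E.carrier) :
    Plot D g :=
  (h.comp_weyl 1 0 fun x hx => by rw [weyl_one_zero]; exact hD hx).congr fun x _ => by
    rw [weyl_one_zero]

theorem weyl_add (π : Equiv.Perm (Fin 3)) (t x y : Apt) :
    weyl π t (x + y) = weyl π t x + weyl π 0 y := by
  apply Apt.ext'
  intro i
  simp
  ring

theorem weyl_smul (π : Equiv.Perm (Fin 3)) (c : ℝ) (x : Apt) :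
    weyl π 0 (c • x) = c • weyl π 0 x := by
  apply Apt.ext'
  intro i
  simp

theorem inner_weyl (π : Equiv.Perm (Fin 3)) (x y : Apt) :
    inner ℝ (weyl π 0 x) (weyl π 0 y) = inner ℝ x y := by
  change inner ℝ (weyl π 0 x).1 (weyl π 0 y).1 = inner ℝ x.1 y.1
  simp only [PiLp.inner_apply, weyl_apply, ZeroMemClass.coe_zero, PiLp.zero_apply, add_zero]
  exact Equiv.sum_comp π (fun i => inner ℝ (x.1 i) (y.1 i))

theorem angle_weyl (π : Equiv.Perm (Fin 3)) (x y : Apt) :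
    InnerProductGeometry.angle (weyl π 0 x) (weyl π 0 y) = InnerProductGeometry.angle x y := by
  have h : ∀ x : Apt, ‖weyl π 0 x‖ = ‖x‖ := fun x => by
    rw [norm_eq_sqrt_real_inner, norm_eq_sqrt_real_inner (F := Apt) x, inner_weyl]
  rw [InnerProductGeometry.angle, InnerProductGeometry.angle, inner_weyl, h, h]

/-- Restrictions of immersive maps along affine maps of enclosures are immersive. -/
theorem Immersive.res {D E : Enc} {s : Sec F E} (h : Immersive s) (u : D ⟶ E) :
    Immersive (res u s) := by
  intro z ε ε' d d'
  obtain ⟨π, t, hu⟩ := u.2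
  have push : ∀ ε (d : Dir D z ε), ∃ e : Dir E (u.1 z) ε, e.len = d.len ∧ e.vec = weyl π 0 d.vec ∧
      (e.image s).1 = (d.image (SL3.res u s)).1 := by
    intro ε d
    refine ⟨⟨d.len, d.map ≫ u, by rw [Enc.comp_apply, d.start]⟩, rfl, ?_, ?_⟩
    · have h1 := hu (d.map.1 (segTip ε d.len))
      have h2 := hu z
      simp only at h1 h2
      apply Apt.ext'
      intro i
      simp [Dir.vec, Enc.comp_apply, h1, h2]
    · simp [Dir.image, res_comp]
  obtain ⟨e, -, hv, hi⟩ := push ε d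
  obtain ⟨e', -, hv', hi'⟩ := push ε' d'
  obtain ⟨n, hn, ha⟩ := h (u.1 z) ε ε' e e'
  refine ⟨n, ?_, by rw [← ha, hv, hv', angle_weyl]⟩
  rw [← hn]
  have key : ∀ (x y : Pts F) (hxy : x = y) (v : (link F x).Vert ε) (w : (link F y).Vert ε)
      (v' : (link F x).Vert ε') (w' : (link F y).Vert ε'), v.1 = w.1 → v'.1 = w'.1 →
      (link F x).graph.edist ⟨ε, v⟩ ⟨ε', v'⟩ = (link F y).graph.edist ⟨ε, w⟩ ⟨ε', w'⟩ := by
    rintro x _ rfl v w v' w' h1 h2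
    rw [Subtype.ext h1, Subtype.ext h2]
  exact key _ _ (ev_res u s z) _ _ _ _ hi.symm hi'.symm

theorem IPlot.comp_weyl {D E : Enc} {g : Apt → Pts F} (h : IPlot E g)
    (π : Equiv.Perm (Fin 3)) (t : Apt) (hD : ∀ x ∈ D.carrier, weyl π t x ∈ E.carrier) :
    IPlot D (fun x => g (weyl π t x)) :=
  ⟨_, h.choose_spec.1.res _, h.choose_spec.2.res (Enc.homOf π t hD) fun _ => rfl⟩

theorem IPlot.mono {D E : Enc} {g : Apt → Pts F} (h : IPlot E g) (hD : D.carrier ⊆ E.carrier) :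
    IPlot D g :=
  (h.comp_weyl 1 0 fun x hx => by rw [weyl_one_zero]; exact hD hx).congr fun x _ => by
    rw [weyl_one_zero]

/-! ### Directions in the plane -/

theorem Parity.flip_ne (ε : Parity) : ε.flip ≠ ε := by cases ε <;> simp [Parity.flip]

theorem Parity.eq_or_eq_flip (ε ε' : Parity) : ε' = ε ∨ ε' = ε.flip := by
  cases ε <;> cases ε' <;> simp [Parity.flip]

/-- The sign that belongs to a parity. -/
noncomputable def Parity.sgn : Parity → ℝ
  | .pos => 1
  | .neg => -1

/-- The index `i` such that the standard segment of parity `ε` issues from the origin in the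
direction `dv ε i`. -/
def Parity.std : Parity → Fin 3
  | .pos => 0
  | .neg => 2

theorem Parity.sgn_flip (ε : Parity) : ε.flip.sgn = -ε.sgn := by
  cases ε <;> simp [Parity.sgn, Parity.flip]

theorem Parity.std_ne (ε : Parity) : ε.std ≠ ε.flip.std := by
  cases ε <;> simp [Parity.std, Parity.flip]

/-- The unit vectors of parity `ε`: up to the sign of `ε`, the projections to the plane of the
standard basis vectors of `ℝ³`. -/
noncomputable def dv (ε : Parity) (i : Fin 3) : Apt :=
  ⟨WithLp.toLp 2 (fun j => ε.sgn * ((if j = i then 1 else 0) - 1 / 3)), by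
    change ∑ j, (ε.sgn * ((if j = i then 1 else 0) - 1 / 3) : ℝ) = 0
    rw [← Finset.mul_sum, Finset.sum_sub_distrib]
    simp⟩

theorem dv_apply (ε : Parity) (i j : Fin 3) :
    (dv ε i).1 j = ε.sgn * ((if j = i then 1 else 0) - 1 / 3) := rfl

theorem dv_flip (ε : Parity) (i : Fin 3) : dv ε.flip i = -dv ε i := by
  apply Apt.ext'
  intro j
  simp [dv_apply, Parity.sgn_flip]

theorem dv_add_dv (ε : Parity) {i j k : Fin 3} (hij : i ≠ j) (hik : i ≠ k) (hjk : j ≠ k) :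
    dv ε i + dv ε j = -dv ε k := by
  apply Apt.ext'
  intro l
  simp only [Submodule.coe_add, PiLp.add_apply, NegMemClass.coe_neg, PiLp.neg_apply, dv_apply]
  have : (if l = i then (1 : ℝ) else 0) + (if l = j then 1 else 0) + (if l = k then 1 else 0)
      = 1 := by
    have hl : l = i ∨ l = j ∨ l = k := by
      clear * - hij hik hjk
      revert i j k l
      decide
    rcases hl with rfl | rfl | rfl <;> simp [*, Ne.symm hij, Ne.symm hik, Ne.symm hjk]
  linear_combination ε.sgn * this

theorem weyl_dv (π : Equiv.Perm (Fin 3)) (ε : Parity) (i : Fin 3) :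
    weyl π 0 (dv ε i) = dv ε (π⁻¹ i) := by
  apply Apt.ext'
  intro j
  have h : π j = i ↔ j = π⁻¹ i := Equiv.Perm.eq_inv_iff_eq.symm
  simp only [weyl_apply, dv_apply, h]
  simp

theorem weyl_add_smul_dv (π : Equiv.Perm (Fin 3)) (t z : Apt) (ε : Parity) (c : ℝ) (i : Fin 3) :
    weyl π t (z + c • dv ε i) = weyl π t z + c • dv ε (π⁻¹ i) := by
  rw [weyl_add, weyl_smul, weyl_dv]

theorem weyl_smul_dv (π : Equiv.Perm (Fin 3)) (t : Apt) (ε : Parity) (c : ℝ) (i : Fin 3) :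
    weyl π t (c • dv ε i) = t + c • dv ε (π⁻¹ i) := by
  rw [← zero_add (c • dv ε i), weyl_add_smul_dv]
  congr 1
  apply Apt.ext'
  intro j
  simp

/-- The values of a root on two different unit vectors of the same parity. -/
theorem root_dv (ε : Parity) {i j p q : Fin 3} (hij : i ≠ j) (hpq : p ≠ q) :
    ∃ a b : ℝ, (dv ε i).1 p - (dv ε i).1 q = a ∧ (dv ε j).1 p - (dv ε j).1 q = b ∧
      ((a = 1 ∧ b = 0) ∨ (a = -1 ∧ b = 0) ∨ (a = 0 ∧ b = 1) ∨ (a = 0 ∧ b = -1) ∨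
        (a = 1 ∧ b = -1) ∨ (a = -1 ∧ b = 1)) := by
  refine ⟨_, _, rfl, rfl, ?_⟩
  simp only [dv_apply]
  have h : (p = i ∧ q = j) ∨ (p = j ∧ q = i) ∨ (p = i ∧ q ≠ i ∧ q ≠ j) ∨
      (p = j ∧ q ≠ i ∧ q ≠ j) ∨ (q = i ∧ p ≠ i ∧ p ≠ j) ∨ (q = j ∧ p ≠ i ∧ p ≠ j) := by
    revert i j p q
    decide
  rcases h with ⟨rfl, rfl⟩ | ⟨rfl, rfl⟩ | ⟨rfl, h1, h2⟩ | ⟨rfl, h1, h2⟩ | ⟨rfl, h1, h2⟩ |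
    ⟨rfl, h1, h2⟩ <;> cases ε <;> simp [Parity.sgn, *, Ne.symm hij, Ne.symm hpq] <;> norm_num

/-- An enclosure contains every point that no root separates from a set of points of the
enclosure. -/
theorem Enc.mem_of_roots (C : Enc) {w : Apt}
    (h : ∀ p q : Fin 3, p ≠ q → ∃ x ∈ C.carrier, x.1 p - x.1 q ≤ w.1 p - w.1 q) :
    w ∈ C.carrier := by
  obtain ⟨L, hL, hC⟩ := C.finite_roots
  rw [hC]
  intro k hk
  obtain ⟨x, hx, hxw⟩ := h k.1 k.2.1 (hL k hk)
  rw [hC] at hx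
  exact (hx k hk).trans hxw

/-- Two points on the sides of an angle of 120 degrees span a parallelogram with its corner at the
vertex of the angle. -/
theorem Enc.mem_of_tips (C : Enc) {z : Apt} {ε : Parity} {i j : Fin 3} (hij : i ≠ j) {a b u v : ℝ}
    (ha : z + a • dv ε i ∈ C.carrier) (hb : z + b • dv ε j ∈ C.carrier)
    (hu : 0 ≤ u) (hua : u ≤ a) (hv : 0 ≤ v) (hvb : v ≤ b) :
    z + u • dv ε i + v • dv ε j ∈ C.carrier := by
  apply C.mem_of_roots
  intro p q hpq
  obtain ⟨c, d, hc, hd, h⟩ := root_dv ε hij hpq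
  have hw : (z + u • dv ε i + v • dv ε j).1 p - (z + u • dv ε i + v • dv ε j).1 q =
      z.1 p - z.1 q + u * c + v * d := by
    rw [← hc, ← hd]
    simp
    ring
  have h1 : (z + a • dv ε i).1 p - (z + a • dv ε i).1 q = z.1 p - z.1 q + a * c := by
    rw [← hc]
    simp
    ring
  have h2 : (z + b • dv ε j).1 p - (z + b • dv ε j).1 q = z.1 p - z.1 q + b * d := by
    rw [← hd]
    simp
    ring
  rcases h with ⟨rfl, rfl⟩ | ⟨rfl, rfl⟩ | ⟨rfl, rfl⟩ | ⟨rfl, rfl⟩ | ⟨rfl, rfl⟩ | ⟨rfl, rfl⟩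
  · exact ⟨_, hb, by linarith⟩
  · exact ⟨_, ha, by linarith⟩
  · exact ⟨_, ha, by linarith⟩
  · exact ⟨_, hb, by linarith⟩
  · exact ⟨_, hb, by linarith⟩
  · exact ⟨_, ha, by linarith⟩

theorem Enc.mem_segment (C : Enc) {z : Apt} {ε : Parity} {i : Fin 3} {a t : ℝ}
    (hz : z ∈ C.carrier) (ha : z + a • dv ε i ∈ C.carrier) (ht : 0 ≤ t) (hta : t ≤ a) :
    z + t • dv ε i ∈ C.carrier := by
  have hij : i ≠ i + 1 := by clear * -; revert i; decide
  have := C.mem_of_tips (ε := ε) hij ha (b := 0) (by simpa using hz) ht hta le_rfl le_rfl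
  simpa using this

/-- The first coordinate with respect to the basis of unit vectors along the edges of a standard
parallelogram. -/
noncomputable def cU (ε : Parity) (x : Apt) : ℝ := ε.sgn * (x.1 ε.std - x.1 (ε.std + 2))

/-- The second coordinate with respect to the basis of unit vectors along the edges of a standard
parallelogram. -/
noncomputable def cV (ε : Parity) (x : Apt) : ℝ := ε.sgn * (x.1 (ε.std + 1) - x.1 (ε.std + 2))

theorem eq_cU_cV (ε : Parity) (x : Apt) :
    x = cU ε x • dv ε ε.std + cV ε x • dv ε (ε.std + 1) := by
  have hs := x.sum_eq
  rw [Fin.sum_univ_three] at hs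
  apply Apt.ext'
  intro l
  cases ε <;> fin_cases l <;> simp [dv_apply, cU, cV, Parity.std, Parity.sgn] <;> linarith

theorem cU_eq (ε : Parity) (u v : ℝ) : cU ε (u • dv ε ε.std + v • dv ε (ε.std + 1)) = u := by
  cases ε <;> simp [dv_apply, cU, Parity.std, Parity.sgn] <;> ring

theorem cV_eq (ε : Parity) (u v : ℝ) : cV ε (u • dv ε ε.std + v • dv ε (ε.std + 1)) = v := by
  cases ε <;> simp [dv_apply, cV, Parity.std, Parity.sgn] <;> ring

theorem mem_para_iff {ε : Parity} {a b : Len} {x : Apt} : x ∈ (para ε a b).carrier ↔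
    0 ≤ cU ε x ∧ cU ε x ≤ a.1 ∧ 0 ≤ cV ε x ∧ cV ε x ≤ b.1 := by
  cases ε <;>
  · simp only [para, paraRoots, halfSpaces, List.mem_cons, List.not_mem_nil, or_false,
      Set.mem_ofPred_eq, forall_eq_or_imp, forall_eq, cU, cV, Parity.std, Parity.sgn,
      Fin.reduceAdd]
    constructor
    · rintro ⟨h1, h2, h3, h4⟩
      refine ⟨?_, ?_, ?_, ?_⟩ <;> linarith
    · rintro ⟨h1, h2, h3, h4⟩
      refine ⟨?_, ?_, ?_, ?_⟩ <;> linarith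

theorem mem_para {ε : Parity} {a b : Len} {u v : ℝ} (hu : 0 ≤ u) (hua : u ≤ a.1) (hv : 0 ≤ v)
    (hvb : v ≤ b.1) : u • dv ε ε.std + v • dv ε (ε.std + 1) ∈ (para ε a b).carrier := by
  rw [mem_para_iff, cU_eq, cV_eq]
  exact ⟨hu, hua, hv, hvb⟩

theorem exists_of_mem_para {ε : Parity} {a b : Len} {x : Apt} (hx : x ∈ (para ε a b).carrier) :
    ∃ u v : ℝ, 0 ≤ u ∧ u ≤ a.1 ∧ 0 ≤ v ∧ v ≤ b.1 ∧ x = u • dv ε ε.std + v • dv ε (ε.std + 1) := by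
  obtain ⟨h1, h2, h3, h4⟩ := mem_para_iff.1 hx
  exact ⟨_, _, h1, h2, h3, h4, eq_cU_cV ε x⟩

theorem ray_eq (ε : Parity) (r : ℝ) : ray ε r = r • dv ε ε.std := by
  apply Apt.ext'
  intro l
  cases ε <;> fin_cases l <;> simp [ray, Apt.mk3, dv_apply, Parity.std, Parity.sgn] <;> ring

theorem mem_seg_iff {ε : Parity} {t : Len} {x : Apt} : x ∈ (seg ε t).carrier ↔
    0 ≤ cU ε x ∧ cU ε x ≤ t.1 ∧ cV ε x = 0 := by
  cases ε <;>
  · simp only [seg, segRoots, halfSpaces, List.mem_cons, List.not_mem_nil, or_false,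
      Set.mem_ofPred_eq, forall_eq_or_imp, forall_eq, cU, cV, Parity.std, Parity.sgn,
      Fin.reduceAdd]
    constructor
    · rintro ⟨h1, h2, h3, h4⟩
      refine ⟨?_, ?_, ?_⟩ <;> linarith
    · rintro ⟨h1, h2, h3⟩
      refine ⟨?_, ?_, ?_, ?_⟩ <;> linarith

theorem mem_seg {ε : Parity} {t : Len} {r : ℝ} (h0 : 0 ≤ r) (h : r ≤ t.1) :
    r • dv ε ε.std ∈ (seg ε t).carrier := by
  have h1 : r • dv ε ε.std = r • dv ε ε.std + (0 : ℝ) • dv ε (ε.std + 1) := by simp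
  rw [mem_seg_iff, h1, cU_eq, cV_eq]
  exact ⟨h0, h, rfl⟩

theorem exists_of_mem_seg {ε : Parity} {t : Len} {x : Apt} (hx : x ∈ (seg ε t).carrier) :
    ∃ r : ℝ, 0 ≤ r ∧ r ≤ t.1 ∧ x = r • dv ε ε.std := by
  obtain ⟨h1, h2, h3⟩ := mem_seg_iff.1 hx
  refine ⟨_, h1, h2, ?_⟩
  conv_lhs => rw [eq_cU_cV ε x, h3, zero_smul, add_zero]

theorem mem_tri (ε : Parity) {t : Len} {u v : ℝ} (hu : 0 ≤ u) (hv : 0 ≤ v) (h : u + v ≤ t.1) :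
    u • dv ε ε.std + v • dv ε.flip ε.flip.std ∈ (tri t).carrier := by
  cases ε <;> simp [tri, halfSpaces, dv_apply, Parity.std, Parity.sgn, Parity.flip] <;>
  · refine ⟨?_, ?_, ?_⟩ <;> linarith

theorem exists_of_mem_tri (ε : Parity) {t : Len} {x : Apt} (hx : x ∈ (tri t).carrier) :
    ∃ u v : ℝ, 0 ≤ u ∧ 0 ≤ v ∧ u + v ≤ t.1 ∧ x = u • dv ε ε.std + v • dv ε.flip ε.flip.std := by
  have hs := x.sum_eq
  rw [Fin.sum_univ_three] at hs
  simp only [tri, halfSpaces, List.mem_cons, List.not_mem_nil, or_false,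
    Set.mem_ofPred_eq, forall_eq_or_imp, forall_eq] at hx
  obtain ⟨h1, h2, h3⟩ := hx
  have key : x = (x.1 0 - x.1 1) • dv .pos 0 + (x.1 1 - x.1 2) • dv .neg 2 := by
    apply Apt.ext'
    intro l
    fin_cases l <;> simp [dv_apply, Parity.sgn] <;> linarith
  cases ε
  · exact ⟨_, _, by linarith, by linarith, by linarith, key⟩
  · refine ⟨x.1 1 - x.1 2, x.1 0 - x.1 1, by linarith, by linarith, by linarith, ?_⟩
    rw [add_comm]
    exact key

theorem exists_perm (ε : Parity) {i j : Fin 3} (h : i ≠ j) :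
    ∃ π : Equiv.Perm (Fin 3), π⁻¹ ε.std = i ∧ π⁻¹ ε.flip.std = j := by
  have key : ∀ i j : Fin 3, i ≠ j → ∃ π : Equiv.Perm (Fin 3), π⁻¹ 0 = i ∧ π⁻¹ 2 = j := by decide
  cases ε
  · exact key i j h
  · obtain ⟨π, h1, h2⟩ := key j i h.symm
    exact ⟨π, h2, h1⟩

theorem exists_perm_add_one (p : Fin 3) {i j : Fin 3} (h : i ≠ j) :
    ∃ π : Equiv.Perm (Fin 3), π⁻¹ p = i ∧ π⁻¹ (p + 1) = j := by
  revert p i j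
  decide

theorem inner_dv_self (ε : Parity) (i : Fin 3) : inner ℝ (dv ε i) (dv ε i) = (2 / 3 : ℝ) := by
  change inner ℝ (dv ε i).1 (dv ε i).1 = _
  rw [PiLp.inner_apply, Fin.sum_univ_three]
  cases ε <;> fin_cases i <;> simp [dv_apply, Parity.sgn] <;> norm_num

theorem inner_dv_of_ne (ε : Parity) {i j : Fin 3} (h : i ≠ j) :
    inner ℝ (dv ε i) (dv ε j) = (-(1 / 3) : ℝ) := by
  change inner ℝ (dv ε i).1 (dv ε j).1 = _
  rw [PiLp.inner_apply, Fin.sum_univ_three]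
  cases ε <;> fin_cases i <;> fin_cases j <;> simp at h <;>
    simp [dv_apply, Parity.sgn] <;> norm_num

theorem norm_dv (ε : Parity) (i : Fin 3) : ‖dv ε i‖ = √(2 / 3) := by
  rw [norm_eq_sqrt_real_inner, inner_dv_self]

theorem dv_ne_zero (ε : Parity) (i : Fin 3) : dv ε i ≠ 0 := by
  intro h
  have := inner_dv_self ε i
  rw [h, inner_zero_left] at this
  norm_num at this

theorem angle_dv_of_ne (ε : Parity) {i j : Fin 3} (h : i ≠ j) :
    InnerProductGeometry.angle (dv ε i) (dv ε j) = (2 : ℕ) * (Real.pi / 3) := by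
  rw [InnerProductGeometry.angle, inner_dv_of_ne ε h, norm_dv, norm_dv,
    Real.mul_self_sqrt (by norm_num)]
  have h1 : (-(1 / 3) / (2 / 3) : ℝ) = -(1 / 2) := by norm_num
  rw [h1, Real.arccos_neg, ← Real.cos_pi_div_three, Real.arccos_cos (by positivity)
    (by linarith [Real.pi_pos])]
  push_cast
  ring

theorem angle_dv_self (ε : Parity) (i : Fin 3) :
    InnerProductGeometry.angle (dv ε i) (dv ε i) = (0 : ℕ) * (Real.pi / 3) := by
  rw [InnerProductGeometry.angle_self (dv_ne_zero ε i)]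
  simp

theorem angle_dv_flip_self (ε : Parity) (i : Fin 3) :
    InnerProductGeometry.angle (dv ε i) (dv ε.flip i) = (3 : ℕ) * (Real.pi / 3) := by
  rw [dv_flip, InnerProductGeometry.angle_self_neg_of_nonzero (dv_ne_zero ε i)]
  push_cast
  ring

theorem angle_dv_flip_of_ne (ε : Parity) {i j : Fin 3} (h : i ≠ j) :
    InnerProductGeometry.angle (dv ε i) (dv ε.flip j) = (1 : ℕ) * (Real.pi / 3) := by
  rw [dv_flip, InnerProductGeometry.angle_neg_right, angle_dv_of_ne ε h]
  push_cast
  ring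

/-! ### Spherical buildings -/

namespace Spherical

variable {H : Spherical}

theorem adj_pos_neg {p : H.Vert .pos} {q : H.Vert .neg} :
    H.graph.Adj ⟨.pos, p⟩ ⟨.neg, q⟩ ↔ H.Joined p q := by
  constructor
  · rintro ⟨p', q', h, ⟨h1, h2⟩ | ⟨h1, h2⟩⟩
    · cases h1
      cases h2
      exact h
    · cases h1
  · exact fun h => ⟨p, q, h, Or.inl ⟨rfl, rfl⟩⟩

theorem adj_neg_pos {p : H.Vert .pos} {q : H.Vert .neg} :
    H.graph.Adj ⟨.neg, q⟩ ⟨.pos, p⟩ ↔ H.Joined p q := by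
  rw [SimpleGraph.adj_comm, adj_pos_neg]

theorem parity_ne_of_adj {u v : H.Vertex} (h : H.graph.Adj u v) : u.1 ≠ v.1 := by
  obtain ⟨p', q', h, ⟨rfl, rfl⟩ | ⟨rfl, rfl⟩⟩ := h <;> simp

/-- The parities as colours. -/
def colour : Parity → Bool
  | .pos => true
  | .neg => false

/-- The parity as a colouring of the graph. -/
def coloring (H : Spherical) : H.graph.Coloring Bool :=
  SimpleGraph.Coloring.mk (fun u => colour u.1) (by
    rintro ⟨ε, p⟩ ⟨ε', q⟩ h
    have := parity_ne_of_adj h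
    cases ε <;> cases ε' <;> simp_all [colour])

theorem coloring_iff {u v : H.Vertex} : (H.coloring u ↔ H.coloring v) ↔ u.1 = v.1 := by
  obtain ⟨ε, p⟩ := u
  obtain ⟨ε', q⟩ := v
  change (colour ε ↔ colour ε') ↔ ε = ε'
  cases ε <;> cases ε' <;> simp [colour]

/-- A closed path of length four backtracks. -/
theorem NoShortLoops.eq_or_eq (h : H.NoShortLoops) {u v w x : H.Vertex} (h1 : H.graph.Adj u v)
    (h2 : H.graph.Adj w v) (h3 : H.graph.Adj w x) (h4 : H.graph.Adj u x) : u = w ∨ v = x := by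
  have p1 := parity_ne_of_adj h1
  have p2 := parity_ne_of_adj h2
  have p3 := parity_ne_of_adj h3
  obtain ⟨_ | _, u⟩ := u <;> obtain ⟨_ | _, v⟩ := v <;> obtain ⟨_ | _, w⟩ := w <;>
    obtain ⟨_ | _, x⟩ := x <;> simp only [ne_eq, not_true_eq_false] at p1 p2 p3
  · rw [adj_pos_neg] at h1 h2 h3 h4
    rcases h.2 u w v x h1 h2 h3 h4 with rfl | rfl
    · exact Or.inl rfl
    · exact Or.inr rfl
  · rw [adj_neg_pos] at h1 h2 h3 h4
    rcases h.2 v x w u h2 h3 h4 h1 with rfl | rfl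
    · exact Or.inr rfl
    · exact Or.inl rfl

theorem IsBuilding.edist_cases (h : H.IsBuilding) (u v : H.Vertex) :
    ∃ n : ℕ, n ≤ 3 ∧ H.graph.edist u v = n ∧ (Even n ↔ u.1 = v.1) := by
  have h3 := h.edist_le u v
  have ht : H.graph.edist u v ≠ ⊤ := fun e => by
    rw [e] at h3
    exact absurd h3 (by simp)
  obtain ⟨w, hw⟩ := SimpleGraph.exists_walk_of_edist_ne_top ht
  refine ⟨w.length, ?_, hw.symm, ?_⟩
  · rw [← hw] at h3
    exact_mod_cast h3
  · rw [H.coloring.even_length_iff_congr w, coloring_iff]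

theorem IsBuilding.edist_eq_two (h : H.IsBuilding) {u v : H.Vertex} (hp : u.1 = v.1)
    (hne : u ≠ v) : H.graph.edist u v = (2 : ℕ) := by
  obtain ⟨n, hn, he, hpar⟩ := h.edist_cases u v
  have h0 : n ≠ 0 := by
    rintro rfl
    exact hne (SimpleGraph.edist_eq_zero_iff.1 he)
  have h2 := hpar.2 hp
  interval_cases n
  · exact absurd rfl h0
  · exact absurd h2 (by decide)
  · exact he
  · exact absurd h2 (by decide)

theorem IsBuilding.edist_eq_three (h : H.IsBuilding) {u v : H.Vertex} (hp : u.1 ≠ v.1)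
    (hne : ¬H.graph.Adj u v) : H.graph.edist u v = (3 : ℕ) := by
  obtain ⟨n, hn, he, hpar⟩ := h.edist_cases u v
  have h2 := fun k => hp (hpar.1 k)
  interval_cases n
  · exact absurd (by decide) h2
  · exact absurd (SimpleGraph.edist_eq_one_iff_adj.1 he) hne
  · exact absurd (by decide) h2
  · exact he

/-- Every vertex of a spherical building has an opposite vertex. -/
theorem IsBuilding.exists_opposite (h : H.IsBuilding) {ε : Parity} (q : H.Vert ε.flip) :
    ∃ p : H.Vert ε, ¬H.graph.Adj ⟨ε.flip, q⟩ ⟨ε, p⟩ := by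
  obtain ⟨c, hinj, hadj, ⟨i, hi⟩, -⟩ := h.hexagon ⟨ε.flip, q⟩ ⟨ε.flip, q⟩
  have a0 := hadj i
  have a1 := hadj (i + 1)
  have a2 := hadj (i + 1 + 1)
  -- the vertex of the hexagon that is opposite in the hexagon has the other parity
  have hp : (c (i + 1 + 1 + 1)).1 = ε := by
    have p0 := parity_ne_of_adj a0
    have p1 := parity_ne_of_adj a1
    have p2 := parity_ne_of_adj a2
    rw [hi] at p0
    revert p0 p1 p2
    generalize (c (i + 1)).1 = x
    generalize (c (i + 1 + 1)).1 = y
    generalize (c (i + 1 + 1 + 1)).1 = w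
    cases ε <;> cases x <;> cases y <;> cases w <;> simp [Parity.flip]
  obtain ⟨p, hp'⟩ : ∃ p : H.Vert ε, c (i + 1 + 1 + 1) = ⟨ε, p⟩ := by
    generalize c (i + 1 + 1 + 1) = y at hp
    obtain ⟨ε', p⟩ := y
    cases hp
    exact ⟨p, rfl⟩
  refine ⟨p, fun ha => ?_⟩
  rw [← hi, ← hp'] at ha
  rcases h.noShortLoops.eq_or_eq a0 a1.symm a2 ha with h' | h'
  · have := hinj h'
    revert this
    generalize i = j
    revert j
    decide
  · have := hinj h'
    revert this
    generalize i = j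
    revert j
    decide

end Spherical

/-! ### Germs -/

/-- Two germs of one-dimensional sectors are the endpoints of an edge. -/
def JoinedG (ε : Parity) (p : VGerm F ε) (q : VGerm F ε.flip) : Prop :=
  ∃ e : EGerm F, e.face ε = p ∧ e.face ε.flip = q

theorem JoinedG.base_eq {ε : Parity} {p : VGerm F ε} {q : VGerm F ε.flip} (h : JoinedG ε p q) :
    p.base = q.base := by
  obtain ⟨e, rfl, rfl⟩ := h
  rw [EGerm.base_face, EGerm.base_face]

theorem link_adj_iff {x : Pts F} {ε : Parity} {p : (link F x).Vert ε}
    {q : (link F x).Vert ε.flip} :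
    (link F x).graph.Adj ⟨ε, p⟩ ⟨ε.flip, q⟩ ↔ JoinedG ε p.1 q.1 := by
  cases ε
  · refine Spherical.adj_pos_neg.trans ⟨?_, ?_⟩
    · rintro ⟨e, rfl, rfl⟩
      exact ⟨e.1, rfl, rfl⟩
    · rintro ⟨e, h1, h2⟩
      exact ⟨⟨e, by rw [← EGerm.base_face .pos, h1]; exact p.2⟩, Subtype.ext h1, Subtype.ext h2⟩
  · refine Spherical.adj_neg_pos.trans ⟨?_, ?_⟩
    · rintro ⟨e, rfl, rfl⟩
      exact ⟨e.1, rfl, rfl⟩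
    · rintro ⟨e, h1, h2⟩
      exact ⟨⟨e, by rw [← EGerm.base_face .neg, h1]; exact p.2⟩, Subtype.ext h2, Subtype.ext h1⟩

theorem link_vertex_ne {x : Pts F} {ε : Parity} {p q : (link F x).Vert ε} (h : p.1 ≠ q.1) :
    (⟨ε, p⟩ : (link F x).Vertex) ≠ ⟨ε, q⟩ := fun e => by
  simp only [Sigma.mk.injEq, heq_eq_eq, true_and] at e
  exact h (congrArg Subtype.val e)

/-- A closed path of length four in a local spherical construction backtracks. -/
theorem JoinedG.eq_or_eq (hS : ∀ x : Pts F, (link F x).IsBuilding) {ε : Parity} {p p' : VGerm F ε}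
    {q q' : VGerm F ε.flip} (h1 : JoinedG ε p q) (h2 : JoinedG ε p' q) (h3 : JoinedG ε p' q')
    (h4 : JoinedG ε p q') : p = p' ∨ q = q' := by
  have b1 := h1.base_eq
  have b2 := h2.base_eq
  have b3 := h3.base_eq
  by_contra hne
  rw [not_or] at hne
  have := (hS p.base).noShortLoops.eq_or_eq (u := ⟨ε, ⟨p, rfl⟩⟩) (v := ⟨ε.flip, ⟨q, b1.symm⟩⟩)
    (w := ⟨ε, ⟨p', b2.trans b1.symm⟩⟩)
    (x := ⟨ε.flip, ⟨q', b3.symm.trans (b2.trans b1.symm)⟩⟩)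
    (link_adj_iff.2 h1) (link_adj_iff.2 h2) (link_adj_iff.2 h3) (link_adj_iff.2 h4)
  rcases this with h | h
  · exact link_vertex_ne hne.1 h
  · exact link_vertex_ne hne.2 h

/-- The endpoints of a path of length three that does not backtrack are not joined. -/
theorem not_joinedG_of_path (hS : ∀ x : Pts F, (link F x).IsBuilding) {ε : Parity}
    {p p' : VGerm F ε} {q q' : VGerm F ε.flip} (h1 : JoinedG ε p q) (h2 : JoinedG ε p' q)
    (h3 : JoinedG ε p' q') (hp : p ≠ p') (hq : q ≠ q') : ¬JoinedG ε p q' := fun h4 => by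
  rcases JoinedG.eq_or_eq hS h1 h2 h3 h4 with h | h
  exacts [hp h, hq h]

/-- An edge of a local spherical construction is determined by its endpoints. -/
theorem EGerm.eq_of_face (hS : ∀ x : Pts F, (link F x).IsBuilding) {e e' : EGerm F} (ε : Parity)
    (h : e.face ε = e'.face ε) (h' : e.face ε.flip = e'.face ε.flip) : e = e' := by
  have hb : e'.base = e.base := by rw [← EGerm.base_face ε, ← EGerm.base_face ε, h]
  have := (hS e.base).noShortLoops.1 ⟨e, rfl⟩ ⟨e', hb⟩ (by
    intro ε'
    apply Subtype.ext
    change e.face ε' = e'.face ε'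
    rcases ε.eq_or_eq_flip ε' with rfl | rfl
    exacts [h, h'])
  exact congrArg Subtype.val this

/-- The functions `g` and `g'` agree along short segments that issue from `z` in the direction
`dv ε i` and from `z'` in the direction `dv ε i'`. -/
def Agree (g : Apt → Pts F) (z : Apt) (ε : Parity) (i : Fin 3) (g' : Apt → Pts F) (z' : Apt)
    (i' : Fin 3) : Prop :=
  ∃ r : ℝ, 0 < r ∧ ∀ t, 0 ≤ t → t ≤ r → g (z + t • dv ε i) = g' (z' + t • dv ε i')

/-- The function `g` folds two different directions of the same parity at `z`. -/
def Fold (g : Apt → Pts F) (z : Apt) (ε : Parity) (i j : Fin 3) : Prop := Agree g z ε i g z j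

theorem Agree.symm {g g' : Apt → Pts F} {z z' : Apt} {ε : Parity} {i i' : Fin 3}
    (h : Agree g z ε i g' z' i') : Agree g' z' ε i' g z i := by
  obtain ⟨r, hr, h⟩ := h
  exact ⟨r, hr, fun t h0 h1 => (h t h0 h1).symm⟩

/-- The vertex `p` is the germ at `z` of the function `g` in the direction `dv ε i`. -/
def IsGerm (g : Apt → Pts F) (z : Apt) (ε : Parity) (i : Fin 3) (p : VGerm F ε) : Prop :=
  ∃ (t : Len) (s : Sec F (seg ε t)), VGerm.mk s = p ∧ Rep s (fun x => g (z + cU ε x • dv ε i))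

theorem cU_smul (ε : Parity) (r : ℝ) : cU ε (r • dv ε ε.std) = r := by
  simpa using cU_eq ε r 0

theorem Rep.incl {D E : Enc} {s : Sec F E} {g : Apt → Pts F} (h : Rep s g) (u : D ⟶ E)
    (hu : ∀ x, (u.1 x).1 = x.1) : Rep (SL3.res u s) g := fun z => by
  rw [ev_res, h, hu]

theorem Agree.exists_lt {g g' : Apt → Pts F} {z z' : Apt} {ε : Parity} {i i' : Fin 3}
    (h : Agree g z ε i g' z' i') {R : ℝ} (hR : 0 < R) : ∃ r : ℝ, 0 < r ∧ r ≤ R ∧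
      ∀ t, 0 ≤ t → t ≤ r → g (z + t • dv ε i) = g' (z' + t • dv ε i') := by
  obtain ⟨r, hr, h⟩ := h
  exact ⟨min r R, lt_min hr hR, min_le_right _ _, fun t h0 h1 =>
    h t h0 (h1.trans (min_le_left _ _))⟩

/-- Since sections of a construction are determined by their values at points, a germ of a
one-dimensional sector is determined by the function on points that it represents. -/
theorem vGerm_eq_iff (hF : IsConstruction F) {g g' : Apt → Pts F} {z z' : Apt} {ε : Parity}
    {i i' : Fin 3} {p p' : VGerm F ε} (h : IsGerm g z ε i p) (h' : IsGerm g' z' ε i' p') :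
    p = p' ↔ Agree g z ε i g' z' i' := by
  obtain ⟨t, s, rfl, hs⟩ := h
  obtain ⟨t', s', rfl, hs'⟩ := h'
  constructor
  · intro h
    obtain ⟨r, hr, hr', e⟩ := Quotient.exact h
    refine ⟨r.1, r.2, fun q h0 h1 => ?_⟩
    have := congrArg (fun w => ev w ⟨q • dv ε ε.std, mem_seg h0 h1⟩) e
    simp only at this
    rw [(hs.incl (segIncl ε hr) fun _ => rfl) _, (hs'.incl (segIncl ε hr') fun _ => rfl) _] at this
    simpa only [cU_smul] using this
  · rintro ⟨r, hr, h⟩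
    apply Quotient.sound
    let q : Len := ⟨min r (min t.1 t'.1), lt_min hr (lt_min t.2 t'.2)⟩
    have h1 : q ≤ t := (min_le_right r (min t.1 t'.1)).trans (min_le_left t.1 t'.1)
    have h2 : q ≤ t' := (min_le_right r (min t.1 t'.1)).trans (min_le_right t.1 t'.1)
    refine ⟨q, h1, h2, ?_⟩
    refine hF.rep_ext (hs.incl (segIncl ε h1) fun _ => rfl)
      (hs'.incl (segIncl ε h2) fun _ => rfl) ?_
    intro x hx
    obtain ⟨c, h0, hc, rfl⟩ := exists_of_mem_seg hx
    simp only [cU_smul]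
    exact h c h0 (hc.trans (min_le_left _ _))

theorem exists_perm_std (ε : Parity) (i : Fin 3) : ∃ π : Equiv.Perm (Fin 3), π⁻¹ ε.std = i :=
  ⟨Equiv.swap ε.std i, by simp⟩

/-- A segment in the enclosure `E` that issues from `z`, as a direction of `E` at `z`. -/
theorem exists_dir {E : Enc} (z : E.carrier) {ε : Parity} {i : Fin 3} (r : Len)
    (hr : z.1 + r.1 • dv ε i ∈ E.carrier) : ∃ (π : Equiv.Perm (Fin 3)) (d : Dir E z ε),
      π⁻¹ ε.std = i ∧ d.len = r ∧ ∀ x, (d.map.1 x).1 = weyl π z.1 x.1 := by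
  obtain ⟨π, hπ⟩ := exists_perm_std ε i
  have hm : ∀ x ∈ (seg ε r).carrier, weyl π z.1 x ∈ E.carrier := by
    intro x hx
    obtain ⟨c, h0, hc, rfl⟩ := exists_of_mem_seg hx
    rw [weyl_smul_dv, hπ]
    exact E.mem_segment z.2 hr h0 hc
  refine ⟨π, ⟨r, Enc.homOf π z.1 hm, ?_⟩, hπ, rfl, fun x => rfl⟩
  apply Subtype.ext
  change weyl π z.1 0 = z.1
  apply Apt.ext'
  intro i
  simp

theorem isGerm_mk {g : Apt → Pts F} {z : Apt} {ε : Parity} {i : Fin 3} {π : Equiv.Perm (Fin 3)}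
    (hπ : π⁻¹ ε.std = i) {t : Len} {s : Sec F (seg ε t)} (hs : Rep s fun x => g (weyl π z x)) :
    IsGerm g z ε i (VGerm.mk s) := by
  refine ⟨t, s, rfl, hs.congr fun x hx => ?_⟩
  obtain ⟨c, h0, hc, rfl⟩ := exists_of_mem_seg hx
  rw [weyl_smul_dv, hπ, cU_smul]

theorem Plot.exists_isGerm {E : Enc} {g : Apt → Pts F} (hg : Plot E g) {z : Apt}
    (hz : z ∈ E.carrier) {ε : Parity} {i : Fin 3} {r : ℝ} (hr : 0 < r)
    (h : z + r • dv ε i ∈ E.carrier) : ∃ p, IsGerm g z ε i p := by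
  obtain ⟨s, hs⟩ := hg
  obtain ⟨π, d, hπ, -, hd⟩ := exists_dir ⟨z, hz⟩ ⟨r, hr⟩ h
  exact ⟨_, isGerm_mk hπ (hs.res d.map hd)⟩

theorem Dir.exists_idx {E : Enc} {z : E.carrier} {ε : Parity} (d : Dir E z ε) :
    ∃ π : Equiv.Perm (Fin 3), ∀ x, (d.map.1 x).1 = weyl π z.1 x.1 := by
  obtain ⟨π, t, h⟩ := d.map.2
  simp only at h
  refine ⟨π, fun x => ?_⟩
  have h1 := h (segOrigin ε d.len)
  rw [d.start] at h1
  rw [h x, h1]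
  apply Apt.ext'
  intro i
  simp [segOrigin, add_comm]

theorem Dir.vec_eq {E : Enc} {z : E.carrier} {ε : Parity} (d : Dir E z ε)
    {π : Equiv.Perm (Fin 3)} (h : ∀ x, (d.map.1 x).1 = weyl π z.1 x.1) :
    d.vec = d.len.1 • dv ε (π⁻¹ ε.std) := by
  rw [Dir.vec, h]
  change weyl π z.1 (ray ε d.len.1) - z.1 = _
  rw [ray_eq, weyl_smul_dv, add_sub_cancel_left]

theorem Dir.mem {E : Enc} {z : E.carrier} {ε : Parity} (d : Dir E z ε)
    {π : Equiv.Perm (Fin 3)} (h : ∀ x, (d.map.1 x).1 = weyl π z.1 x.1) :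
    z.1 + d.len.1 • dv ε (π⁻¹ ε.std) ∈ E.carrier := by
  have h1 := (d.map.1 (segTip ε d.len)).2
  rw [h] at h1
  change weyl π z.1 (ray ε d.len.1) ∈ _ at h1
  rwa [ray_eq, weyl_smul_dv] at h1

theorem Dir.isGerm {E : Enc} {z : E.carrier} {ε : Parity} (d : Dir E z ε)
    {π : Equiv.Perm (Fin 3)} (h : ∀ x, (d.map.1 x).1 = weyl π z.1 x.1) {s : Sec F E}
    {g : Apt → Pts F} (hs : Rep s g) : IsGerm g z.1 ε (π⁻¹ ε.std) (d.image s).1 :=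
  isGerm_mk rfl (hs.res d.map h)

/-- Two adjacent directions span a sector, on which a plot has a germ. -/
theorem Plot.exists_tri {E : Enc} {g : Apt → Pts F} (hg : Plot E g) {z : Apt} {ε : Parity}
    {i j : Fin 3} (hij : i ≠ j) (r : Len)
    (h : ∀ u v : ℝ, 0 ≤ u → 0 ≤ v → u + v ≤ r.1 →
      z + u • dv ε i + v • dv ε.flip j ∈ E.carrier) :
    ∃ (π : Equiv.Perm (Fin 3)) (s : Sec F (tri r)), π⁻¹ ε.std = i ∧ π⁻¹ ε.flip.std = j ∧
      Rep s fun x => g (weyl π z x) := by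
  obtain ⟨s, hs⟩ := hg
  obtain ⟨π, h1, h2⟩ := exists_perm ε hij
  refine ⟨π, _, h1, h2, hs.res (Enc.homOf π z fun x hx => ?_) fun _ => rfl⟩
  obtain ⟨u, v, hu, hv, huv, rfl⟩ := exists_of_mem_tri ε hx
  rw [weyl_add_smul_dv, weyl_smul_dv, h1, h2]
  exact h u v hu hv huv

theorem isGerm_face {g : Apt → Pts F} {z : Apt} {ε : Parity} {π : Equiv.Perm (Fin 3)}
    {r : Len} {s : Sec F (tri r)} (hs : Rep s fun x => g (weyl π z x)) :
    IsGerm g z ε (π⁻¹ ε.std) ((EGerm.mk s).face ε) :=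
  isGerm_mk (g := g) (z := z) rfl (hs.incl (segToTri ε r) fun _ => rfl)

theorem Agree.refl {g : Apt → Pts F} {z : Apt} {ε : Parity} {i : Fin 3} : Agree g z ε i g z i :=
  ⟨1, one_pos, fun _ _ _ => rfl⟩

/-- The germs of a plot in adjacent directions are joined by an edge. -/
theorem Plot.joinedG (hF : IsConstruction F) {E : Enc} {g : Apt → Pts F} (hg : Plot E g) {z : Apt}
    {ε : Parity} {i j : Fin 3} (hij : i ≠ j) {r : ℝ} (hr : 0 < r)
    (h : ∀ u v : ℝ, 0 ≤ u → 0 ≤ v → u + v ≤ r →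
      z + u • dv ε i + v • dv ε.flip j ∈ E.carrier) {p : VGerm F ε} {q : VGerm F ε.flip}
    (hp : IsGerm g z ε i p) (hq : IsGerm g z ε.flip j q) : JoinedG ε p q := by
  obtain ⟨π, s, rfl, rfl, hs⟩ := hg.exists_tri hij ⟨r, hr⟩ h
  exact ⟨EGerm.mk s, (vGerm_eq_iff hF (isGerm_face hs) hp).2 Agree.refl,
    (vGerm_eq_iff hF (isGerm_face hs) hq).2 Agree.refl⟩

/-- Plots with the same germ of a two-dimensional sector agree near its vertex. -/
theorem eGerm_eq (ε : Parity) {g g' : Apt → Pts F} {z : Apt}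
    {π π' : Equiv.Perm (Fin 3)} {i j : Fin 3} (hi : π⁻¹ ε.std = i) (hj : π⁻¹ ε.flip.std = j)
    (hi' : π'⁻¹ ε.std = i) (hj' : π'⁻¹ ε.flip.std = j) {r r' : Len} {s : Sec F (tri r)}
    {s' : Sec F (tri r')} (hs : Rep s fun x => g (weyl π z x))
    (hs' : Rep s' fun x => g' (weyl π' z x)) (h : EGerm.mk s = EGerm.mk s') :
    ∃ t : ℝ, 0 < t ∧ ∀ u v : ℝ, 0 ≤ u → 0 ≤ v → u + v ≤ t →
      g (z + u • dv ε i + v • dv ε.flip j) = g' (z + u • dv ε i + v • dv ε.flip j) := by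
  obtain ⟨q, hr, hr', e⟩ := Quotient.exact h
  refine ⟨q.1, q.2, fun u v hu hv huv => ?_⟩
  have := congrArg (fun w => ev w ⟨_, mem_tri ε hu hv huv⟩) e
  simp only at this
  rw [(hs.incl (triIncl hr) fun _ => rfl) _, (hs'.incl (triIncl hr') fun _ => rfl) _] at this
  simp only [weyl_add_smul_dv, weyl_smul_dv, hi, hj, hi', hj'] at this
  exact this

/-- Two plots that agree on the sides of an angle of 120 degrees, and do not fold it, agree near its
vertex: in the spherical building, two different vertices of the same parity are the endpoints of at
most one path of length two. -/
theorem agree_para (hF : IsConstruction F) (hS : ∀ x : Pts F, (link F x).IsBuilding) {E : Enc}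
    {g g' : Apt → Pts F} (hg : Plot E g) (hg' : Plot E g') {z : Apt} {ε : Parity} {i j : Fin 3}
    (hij : i ≠ j) {r : ℝ} (hr : 0 < r) (hi : z + r • dv ε i ∈ E.carrier)
    (hj : z + r • dv ε j ∈ E.carrier) (ai : Agree g z ε i g' z i) (aj : Agree g z ε j g' z j)
    (ho : ¬Fold g z ε i j) :
    ∃ t : ℝ, 0 < t ∧ ∀ u v : ℝ, 0 ≤ u → u ≤ t → 0 ≤ v → v ≤ t →
      g (z + u • dv ε i + v • dv ε j) = g' (z + u • dv ε i + v • dv ε j) := by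
  obtain ⟨k, hik, hjk⟩ : ∃ k, i ≠ k ∧ j ≠ k := by
    clear * -
    revert i j
    decide
  have e1 : ∀ u v : ℝ, z + u • dv ε i + v • dv ε.flip k =
      z + (u + v) • dv ε i + v • dv ε j := fun u v => by
    rw [dv_flip, ← dv_add_dv ε hij hik hjk]
    module
  have e2 : ∀ u v : ℝ, z + u • dv ε j + v • dv ε.flip k =
      z + v • dv ε i + (u + v) • dv ε j := fun u v => by
    rw [dv_flip, ← dv_add_dv ε hij hik hjk]
    module
  have m1 : ∀ u v : ℝ, 0 ≤ u → 0 ≤ v → u + v ≤ r →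
      z + u • dv ε i + v • dv ε.flip k ∈ E.carrier := fun u v hu hv huv => by
    rw [e1]
    exact E.mem_of_tips hij hi hj (by linarith) huv hv (by linarith)
  have m2 : ∀ u v : ℝ, 0 ≤ u → 0 ≤ v → u + v ≤ r →
      z + u • dv ε j + v • dv ε.flip k ∈ E.carrier := fun u v hu hv huv => by
    rw [e2]
    exact E.mem_of_tips hij hi hj hv (by linarith) (by linarith) huv
  obtain ⟨π₁, s₁, a₁, b₁, h₁⟩ := hg.exists_tri hik ⟨r, hr⟩ m1
  obtain ⟨π₂, s₂, a₂, b₂, h₂⟩ := hg.exists_tri hjk ⟨r, hr⟩ m2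
  obtain ⟨ρ₁, s₁', c₁, d₁, h₁'⟩ := hg'.exists_tri hik ⟨r, hr⟩ m1
  obtain ⟨ρ₂, s₂', c₂, d₂, h₂'⟩ := hg'.exists_tri hjk ⟨r, hr⟩ m2
  have f1 := isGerm_face (ε := ε) h₁
  have f2 := isGerm_face (ε := ε) h₂
  have f1' := isGerm_face (ε := ε) h₁'
  have f2' := isGerm_face (ε := ε) h₂'
  have k1 := isGerm_face (ε := ε.flip) h₁
  have k2 := isGerm_face (ε := ε.flip) h₂
  have k1' := isGerm_face (ε := ε.flip) h₁'
  have k2' := isGerm_face (ε := ε.flip) h₂'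
  rw [a₁] at f1
  rw [a₂] at f2
  rw [c₁] at f1'
  rw [c₂] at f2'
  rw [b₁] at k1
  rw [b₂] at k2
  rw [d₁] at k1'
  rw [d₂] at k2'
  have q1 := (vGerm_eq_iff hF f1 f1').2 ai
  have q2 := (vGerm_eq_iff hF f2 f2').2 aj
  have q3 := (vGerm_eq_iff hF k1 k2).2 Agree.refl
  have q4 := (vGerm_eq_iff hF k1' k2').2 Agree.refl
  have q5 : (EGerm.mk s₁).face ε ≠ (EGerm.mk s₂).face ε := fun h =>
    ho ((vGerm_eq_iff hF f1 f2).1 h)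
  have q6 : (EGerm.mk s₁).face ε.flip = (EGerm.mk s₁').face ε.flip :=
    (JoinedG.eq_or_eq hS (p := (EGerm.mk s₁).face ε) (p' := (EGerm.mk s₂).face ε)
      ⟨EGerm.mk s₁, rfl, rfl⟩ ⟨EGerm.mk s₂, rfl, q3.symm⟩ ⟨EGerm.mk s₂', q2.symm, q4.symm⟩
      ⟨EGerm.mk s₁', q1.symm, rfl⟩).resolve_left q5
  obtain ⟨t₁, ht₁, w₁⟩ := eGerm_eq ε a₁ b₁ c₁ d₁ h₁ h₁' (EGerm.eq_of_face hS ε q1 q6)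
  obtain ⟨t₂, ht₂, w₂⟩ := eGerm_eq ε a₂ b₂ c₂ d₂ h₂ h₂'
    (EGerm.eq_of_face hS ε q2 (q3.symm.trans (q6.trans q4)))
  refine ⟨min t₁ t₂, lt_min ht₁ ht₂, fun u v hu hut hv hvt => ?_⟩
  rcases le_total v u with h | h
  · have := w₁ (u - v) v (by linarith) hv (by linarith [min_le_left t₁ t₂])
    rwa [e1, sub_add_cancel] at this
  · have := w₂ (v - u) u (by linarith) hu (by linarith [min_le_right t₁ t₂])
    rwa [e2, sub_add_cancel] at this

/-- An immersive map does not fold. -/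
theorem IPlot.not_fold (hF : IsConstruction F) {E : Enc} {g : Apt → Pts F} (hg : IPlot E g)
    {z : Apt} (hz : z ∈ E.carrier) {ε : Parity} {i j : Fin 3} (hij : i ≠ j) {r : ℝ} (hr : 0 < r)
    (hi : z + r • dv ε i ∈ E.carrier) (hj : z + r • dv ε j ∈ E.carrier) : ¬Fold g z ε i j := by
  intro hf
  obtain ⟨s, him, hs⟩ := hg
  obtain ⟨π, d, rfl, hl, hd⟩ := exists_dir ⟨z, hz⟩ ⟨r, hr⟩ hi
  obtain ⟨ρ, d', rfl, hl', hd'⟩ := exists_dir ⟨z, hz⟩ ⟨r, hr⟩ hj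
  obtain ⟨n, hn, ha⟩ := him ⟨z, hz⟩ ε ε d d'
  have e : d.image s = d'.image s :=
    Subtype.ext ((vGerm_eq_iff hF (d.isGerm hd hs) (d'.isGerm hd' hs)).2 hf)
  rw [e, SimpleGraph.edist_self] at hn
  have hn0 : n = 0 := by exact_mod_cast hn.symm
  rw [d.vec_eq hd, d'.vec_eq hd', hl, hl', InnerProductGeometry.angle_smul_left_of_pos _ _ hr,
    InnerProductGeometry.angle_smul_right_of_pos _ _ hr, angle_dv_of_ne ε hij, hn0] at ha
  norm_num at ha

/-- A map is immersive if it does not fold and the germs in opposite directions are not joined. -/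
theorem immersive_of (hF : IsConstruction F) (hS : ∀ x : Pts F, (link F x).IsBuilding) {E : Enc}
    {s : Sec F E} {g : Apt → Pts F} (hs : Rep s g)
    (hA : ∀ z ∈ E.carrier, ∀ (ε : Parity) (i j : Fin 3) (r : ℝ), i ≠ j → 0 < r →
      z + r • dv ε i ∈ E.carrier → z + r • dv ε j ∈ E.carrier → ¬Fold g z ε i j)
    (hB : ∀ z ∈ E.carrier, ∀ (i : Fin 3) (r : ℝ), 0 < r →
      z + r • dv .pos i ∈ E.carrier → z + r • dv .neg i ∈ E.carrier →
      ∀ p q, IsGerm g z .pos i p → IsGerm g z .neg i q → ¬JoinedG .pos p q) : Immersive s := by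
  have key : ∀ (z : E.carrier) (ε : Parity) (d : Dir E z ε) (d' : Dir E z ε.flip), ∃ n : ℕ,
      (link F (ev s z)).graph.edist ⟨ε, d.image s⟩ ⟨ε.flip, d'.image s⟩ = n ∧
      InnerProductGeometry.angle d.vec d'.vec = n * (Real.pi / 3) := by
    intro z ε d d'
    obtain ⟨π, hd⟩ := d.exists_idx
    obtain ⟨ρ, hd'⟩ := d'.exists_idx
    have hm := d.mem hd
    have hm' := d'.mem hd'
    have hr : 0 < min d.len.1 d'.len.1 := lt_min d.len.2 d'.len.2
    replace hm := E.mem_segment z.2 hm hr.le (min_le_left _ _)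
    replace hm' := E.mem_segment z.2 hm' hr.le (min_le_right _ _)
    rw [d.vec_eq hd, d'.vec_eq hd', InnerProductGeometry.angle_smul_left_of_pos _ _ d.len.2,
      InnerProductGeometry.angle_smul_right_of_pos _ _ d'.len.2]
    have hp := d.isGerm hd hs
    have hq := d'.isGerm hd' hs
    by_cases hij : π⁻¹ ε.std = ρ⁻¹ ε.flip.std
    · rw [← hij] at hq hm' ⊢
      refine ⟨3, ?_, angle_dv_flip_self _ _⟩
      refine (hS _).edist_eq_three (Parity.flip_ne ε).symm ?_
      rw [link_adj_iff]
      cases ε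
      · exact hB z.1 z.2 _ _ hr hm hm' _ _ hp hq
      · rintro ⟨e, h1, h2⟩
        exact hB z.1 z.2 _ _ hr hm' hm _ _ hq hp ⟨e, h2, h1⟩
    · refine ⟨1, ?_, angle_dv_flip_of_ne _ hij⟩
      rw [Nat.cast_one, SimpleGraph.edist_eq_one_iff_adj, link_adj_iff]
      refine Plot.joinedG hF ⟨s, hs⟩ hij hr (fun u v hu hv huv => ?_) hp hq
      -- the three corners of the triangle lie in `E`
      obtain ⟨k, hik, hjk⟩ : ∃ k, π⁻¹ ε.std ≠ k ∧ ρ⁻¹ ε.flip.std ≠ k := by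
        generalize π⁻¹ ε.std = a
        generalize ρ⁻¹ ε.flip.std = b
        clear * -
        revert a b
        decide
      have hc := dv_add_dv ε hij hik hjk
      generalize π⁻¹ ε.std = a at *
      generalize ρ⁻¹ ε.flip.std = b at *
      apply E.mem_of_roots
      intro p q hpq
      obtain ⟨c, c', h1, h2, h⟩ := root_dv ε hij hpq
      rw [dv_flip] at hm' ⊢
      have f1 : (z.1 + u • dv ε a + v • -dv ε b).1 p - (z.1 + u • dv ε a + v • -dv ε b).1 q =
          z.1.1 p - z.1.1 q + u * c - v * c' := by
        rw [← h1, ← h2]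
        simp
        ring
      have f2 : (z.1 + min d.len.1 d'.len.1 • dv ε a).1 p -
          (z.1 + min d.len.1 d'.len.1 • dv ε a).1 q =
          z.1.1 p - z.1.1 q + min d.len.1 d'.len.1 * c := by
        rw [← h1]
        simp
        ring
      have f3 : (z.1 + min d.len.1 d'.len.1 • -dv ε b).1 p -
          (z.1 + min d.len.1 d'.len.1 • -dv ε b).1 q =
          z.1.1 p - z.1.1 q - min d.len.1 d'.len.1 * c' := by
        rw [← h2]
        simp
        ring
      rcases h with ⟨rfl, rfl⟩ | ⟨rfl, rfl⟩ | ⟨rfl, rfl⟩ | ⟨rfl, rfl⟩ | ⟨rfl, rfl⟩ | ⟨rfl, rfl⟩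
      · exact ⟨_, z.2, by linarith⟩
      · exact ⟨_, hm, by linarith⟩
      · exact ⟨_, hm', by linarith⟩
      · exact ⟨_, z.2, by linarith⟩
      · exact ⟨_, z.2, by linarith⟩
      · exact ⟨_, hm, by linarith⟩
  intro z ε ε' d d'
  rcases ε.eq_or_eq_flip ε' with rfl | rfl
  · obtain ⟨π, hd⟩ := d.exists_idx
    obtain ⟨ρ, hd'⟩ := d'.exists_idx
    have hm := d.mem hd
    have hm' := d'.mem hd'
    rw [d.vec_eq hd, d'.vec_eq hd', InnerProductGeometry.angle_smul_left_of_pos _ _ d.len.2,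
      InnerProductGeometry.angle_smul_right_of_pos _ _ d'.len.2]
    have hp := d.isGerm hd hs
    have hq := d'.isGerm hd' hs
    by_cases hij : π⁻¹ ε'.std = ρ⁻¹ ε'.std
    · rw [← hij] at hq ⊢
      refine ⟨0, ?_, angle_dv_self _ _⟩
      rw [Subtype.ext ((vGerm_eq_iff hF hp hq).2 Agree.refl) (a1 := d.image s)
        (a2 := d'.image s), SimpleGraph.edist_self]
      rfl
    · refine ⟨2, ?_, angle_dv_of_ne _ hij⟩
      have hr : 0 < min d.len.1 d'.len.1 := lt_min d.len.2 d'.len.2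
      refine (hS _).edist_eq_two rfl (link_vertex_ne fun h => ?_)
      exact hA z.1 z.2 _ _ _ _ hij hr (E.mem_segment z.2 hm hr.le (min_le_left _ _))
        (E.mem_segment z.2 hm' hr.le (min_le_right _ _)) ((vGerm_eq_iff hF hp hq).1 h)
  · exact key z ε d d'

/-! ### Uniqueness of maps from parallelograms -/

theorem Enc.isClosed (E : Enc) : IsClosed E.carrier := by
  obtain ⟨L, -, hE⟩ := E.finite_roots
  have hc : ∀ i : Fin 3, Continuous fun x : Apt => x.1 i := fun i =>
    (EuclideanSpace.proj i).continuous.comp continuous_subtype_val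
  have : E.carrier = ⋂ h ∈ L, {x : Apt | h.2.2 ≤ x.1 h.1 - x.1 h.2.1} := by
    rw [hE]
    ext x
    simp [halfSpaces]
  rw [this]
  exact isClosed_biInter fun h _ => isClosed_le continuous_const ((hc _).sub (hc _))

/-- The point of the plane with given coordinates with respect to the unit vectors along the edges
of a standard parallelogram. -/
noncomputable def ppt (ε : Parity) (q : ℝ × ℝ) : Apt :=
  q.1 • dv ε ε.std + q.2 • dv ε (ε.std + 1)

theorem continuous_ppt (ε : Parity) : Continuous (ppt ε) := by
  unfold ppt
  fun_prop

theorem std_ne_std_add_one (ε : Parity) : ε.std ≠ ε.std + 1 := by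
  generalize ε.std = i
  revert i
  decide

/-- An enclosure that contains two points, the second one to the lower right of the first one,
contains the coordinate rectangle that they span. -/
theorem Enc.ppt_mem_of_corners (C : Enc) {ε : Parity} {p q w : ℝ × ℝ} (hp : ppt ε p ∈ C.carrier)
    (hq : ppt ε q ∈ C.carrier) (h1 : p.1 ≤ w.1) (h2 : w.1 ≤ q.1) (h3 : q.2 ≤ w.2)
    (h4 : w.2 ≤ p.2) : ppt ε w ∈ C.carrier := by
  apply C.mem_of_roots
  intro i j hij
  obtain ⟨c, d, hc, hd, h⟩ := root_dv ε (std_ne_std_add_one ε) hij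
  have e : ∀ w, (ppt ε w).1 i - (ppt ε w).1 j = w.1 * c + w.2 * d := fun w => by
    rw [← hc, ← hd]
    simp [ppt]
    ring
  simp only [e]
  have hle : ∀ x : ℝ × ℝ, ppt ε x ∈ C.carrier → x.1 * c + x.2 * d ≤ w.1 * c + w.2 * d →
      ∃ y ∈ C.carrier, y.1 i - y.1 j ≤ w.1 * c + w.2 * d := fun x hx hxw =>
    ⟨_, hx, by rw [e]; exact hxw⟩
  rcases h with ⟨rfl, rfl⟩ | ⟨rfl, rfl⟩ | ⟨rfl, rfl⟩ | ⟨rfl, rfl⟩ | ⟨rfl, rfl⟩ | ⟨rfl, rfl⟩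
  · exact hle p hp (by linarith)
  · exact hle q hq (by linarith)
  · exact hle q hq (by linarith)
  · exact hle p hp (by linarith)
  · exact hle p hp (by linarith)
  · exact hle q hq (by linarith)

/-- A map from a parallelogram is determined by its restriction to the two edges at the origin, if
there is an immersive map with this restriction. If two such maps differ, consider the
lexicographically first point of the closure of the set where they differ. They agree to the left
of this point, on the vertical line through it, and in a small rectangle to its lower right, since
the set where they agree is a finite union of enclosures. In particular they agree on the sides of
the angle of 120 degrees that the point spans to its upper right, hence also near the vertex in
this angle, and thus in a neighbourhood of the point. -/
theorem para_unique (hF : IsConstruction F) (hS : ∀ x : Pts F, (link F x).IsBuilding)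
    {ε : Parity} {a b : Len} {g g' : Apt → Pts F} (hg : IPlot (para ε a b) g)
    (hg' : Plot (para ε a b) g')
    (h1 : ∀ u : ℝ, 0 ≤ u → u ≤ a.1 → g (u • dv ε ε.std) = g' (u • dv ε ε.std))
    (h2 : ∀ v : ℝ, 0 ≤ v → v ≤ b.1 → g (v • dv ε (ε.std + 1)) = g' (v • dv ε (ε.std + 1))) :
    ∀ x ∈ (para ε a b).carrier, g x = g' x := by
  obtain ⟨s, hs⟩ := hg.plot
  obtain ⟨s', hs'⟩ := hg'
  obtain ⟨n, C, hC, hCs, hz⟩ := hF.exists_coincidence s s'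
  have ha := a.2
  have hb := b.2
  have hCg : ∀ k, ∀ x ∈ (C k).carrier, g x = g' x := fun k x hx => by
    have := congrArg (fun w => ev w ⟨x, hx⟩) (hCs k)
    rwa [(hs.incl (Enc.incl (hC k)) fun _ => rfl) _,
      (hs'.incl (Enc.incl (hC k)) fun _ => rfl) _] at this
  let K : Set (ℝ × ℝ) := Set.Icc 0 a.1 ×ˢ Set.Icc 0 b.1
  let S : Set (ℝ × ℝ) := ⋃ k, ppt ε ⁻¹' (C k).carrier
  have hSc : IsClosed S := isClosed_iUnion_of_finite fun k =>
    (C k).isClosed.preimage (continuous_ppt ε)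
  have hK : ∀ q ∈ K, ppt ε q ∈ (para ε a b).carrier := fun q hq =>
    mem_para hq.1.1 hq.1.2 hq.2.1 hq.2.2
  have hSK : ∀ q ∈ K, g (ppt ε q) = g' (ppt ε q) → q ∈ S := fun q hq e => by
    obtain ⟨k, hk⟩ := hz ⟨_, hK q hq⟩ (by rw [hs, hs']; exact e)
    exact Set.mem_iUnion.2 ⟨k, hk⟩
  have hSg : ∀ q ∈ S, g (ppt ε q) = g' (ppt ε q) := fun q hq => by
    obtain ⟨k, hk⟩ := Set.mem_iUnion.1 hq
    exact hCg k _ hk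
  suffices hsub : K ⊆ S by
    intro x hx
    obtain ⟨u, v, hu, hua, hv, hvb, rfl⟩ := exists_of_mem_para hx
    exact hSg (u, v) (hsub ⟨⟨hu, hua⟩, hv, hvb⟩)
  by_contra hsub
  obtain ⟨q₀, hq₀K, hq₀S⟩ := Set.not_subset.1 hsub
  have hKcpt : IsCompact K := isCompact_Icc.prod isCompact_Icc
  have hKcl : IsClosed K := isClosed_Icc.prod isClosed_Icc
  let T : Set (ℝ × ℝ) := closure (K \ S)
  have hTK : T ⊆ K := closure_minimal Set.sdiff_subset hKcl
  have hT : IsCompact T := hKcpt.of_isClosed_subset isClosed_closure hTK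
  have hTS : ∀ q ∈ K, q ∉ T → q ∈ S := fun q hq hqT => by
    by_contra h
    exact hqT (subset_closure ⟨hq, h⟩)
  obtain ⟨⟨c₀, d₀⟩, hz₁T, hz₁⟩ := hT.exists_isMinOn ⟨q₀, subset_closure ⟨hq₀K, hq₀S⟩⟩
    continuous_fst.continuousOn
  have hT' : IsCompact (T ∩ {q | q.1 = c₀}) :=
    hT.inter_right (isClosed_eq continuous_fst continuous_const)
  obtain ⟨⟨c, d⟩, ⟨hzT, hzc⟩, hzmin⟩ := hT'.exists_isMinOn ⟨(c₀, d₀), hz₁T, rfl⟩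
    continuous_snd.continuousOn
  -- the lexicographically first point of `T` is `(c, d)`
  obtain rfl : c = c₀ := hzc
  have hleft : ∀ q ∈ T, c ≤ q.1 := fun q hq => hz₁ hq
  have hbelow : ∀ v, (c, v) ∈ T → d ≤ v := fun v hv => hzmin (a := (c, v)) ⟨hv, rfl⟩
  obtain ⟨⟨hc0, hca⟩, hd0, hdb⟩ := hTK hzT
  simp only at hc0 hca hd0 hdb
  have hcol : ∀ v, 0 ≤ v → v ≤ b.1 → (c, v) ∈ S := by
    intro v hv hvb
    rcases hc0.eq_or_lt with h0 | h0
    · apply hSK (c, v) ⟨⟨hc0, hca⟩, hv, hvb⟩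
      simp only [ppt, ← h0, zero_smul, zero_add]
      exact h2 v hv hvb
    · have hlim : (c, v) ∈ closure (Set.Ico 0 c ×ˢ {v}) := by
        rw [closure_prod_eq, closure_Ico h0.ne, closure_singleton]
        exact ⟨⟨hc0, le_rfl⟩, rfl⟩
      refine closure_minimal ?_ hSc hlim
      rintro ⟨u, w⟩ ⟨⟨hu0, huc⟩, rfl⟩
      exact hTS _ ⟨⟨hu0, huc.le.trans hca⟩, hv, hvb⟩ fun h => absurd (hleft _ h) (not_le.2 huc)
  have hca' : c < a.1 := by
    by_contra hca'
    have hca' : c = a.1 := le_antisymm hca (not_lt.1 hca')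
    have h := hleft q₀ (subset_closure ⟨hq₀K, hq₀S⟩)
    have : q₀ = (c, q₀.2) := Prod.ext (le_antisymm (hca' ▸ hq₀K.1.2) h) rfl
    rw [this] at hq₀S
    exact hq₀S (hcol _ hq₀K.2.1 hq₀K.2.2)
  -- a rectangle to the lower right of the point
  have hbox : ∃ r : ℝ, 0 < r ∧ ∀ u v, c ≤ u → u ≤ c + r → 0 ≤ v → d - r ≤ v → v ≤ d →
      (u, v) ∈ S := by
    rcases hd0.eq_or_lt with h0 | h0
    · refine ⟨a.1 - c, by linarith, fun u v hu hu' hv _ hvd => ?_⟩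
      have hv0 : v = 0 := le_antisymm (h0 ▸ hvd) hv
      apply hSK _ ⟨⟨hc0.trans hu, by linarith⟩, hv, by linarith⟩
      simp only [ppt, hv0, zero_smul, add_zero]
      exact h1 u (hc0.trans hu) (by linarith)
    · have hcl : (c, d) ∈ closure (⋃ k, ppt ε ⁻¹' (C k).carrier ∩ {q | c < q.1 ∧ q.2 < d}) := by
        rw [Metric.mem_closure_iff]
        intro η hη
        obtain ⟨v, hv0, hvd, hvη⟩ : ∃ v, 0 ≤ v ∧ v < d ∧ d - v < η / 2 := by
          refine ⟨max 0 (d - η / 4), le_max_left _ _, max_lt h0 (by linarith), ?_⟩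
          linarith [le_max_right 0 (d - η / 4)]
        have hvT : (c, v) ∉ T := fun h => absurd (hbelow v h) (not_le.2 hvd)
        obtain ⟨η', hη', hball⟩ := Metric.isOpen_iff.1 isClosed_closure.isOpen_compl _ hvT
        obtain ⟨t, ht0, hta, htη, htη'⟩ : ∃ t, 0 < t ∧ c + t ≤ a.1 ∧ t < η / 2 ∧ t < η' := by
          refine ⟨min (a.1 - c) (min (η / 4) (η' / 2)), ?_, ?_, ?_, ?_⟩
          · exact lt_min (by linarith) (lt_min (by linarith) (by linarith))
          · linarith [min_le_left (a.1 - c) (min (η / 4) (η' / 2))]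
          · linarith [min_le_right (a.1 - c) (min (η / 4) (η' / 2)),
              min_le_left (η / 4) (η' / 2)]
          · linarith [min_le_right (a.1 - c) (min (η / 4) (η' / 2)),
              min_le_right (η / 4) (η' / 2)]
        have hmem : (c + t, v) ∈ S := by
          refine hTS _ ⟨⟨by linarith, hta⟩, hv0, hvd.le.trans hdb⟩ (hball ?_)
          rw [Metric.mem_ball, Prod.dist_eq]
          simp only [dist_self, Real.dist_eq, add_sub_cancel_left, abs_of_pos ht0]
          exact max_lt htη' hη'
        obtain ⟨k, hk⟩ := Set.mem_iUnion.1 hmem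
        refine ⟨(c + t, v), Set.mem_iUnion.2 ⟨k, hk, by simpa using ht0, hvd⟩, ?_⟩
        rw [Prod.dist_eq]
        simp only [Real.dist_eq]
        rw [abs_of_pos (by linarith : 0 < d - v), sub_add_cancel_left, abs_neg, abs_of_pos ht0]
        exact max_lt (by linarith) (by linarith)
      rw [closure_iUnion_of_finite] at hcl
      obtain ⟨k, hk⟩ := Set.mem_iUnion.1 hcl
      have hk1 : ppt ε (c, d) ∈ (C k).carrier :=
        closure_minimal Set.inter_subset_left ((C k).isClosed.preimage (continuous_ppt ε)) hk
      obtain ⟨q, hq, hq1, hq2⟩ := closure_nonempty_iff.1 ⟨_, hk⟩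
      refine ⟨min (q.1 - c) (d - q.2), lt_min (by linarith) (by linarith),
        fun u v hu hu' _ hv hvd => Set.mem_iUnion.2 ⟨k, ?_⟩⟩
      exact (C k).ppt_mem_of_corners hk1 hq hu
        (by simp only; linarith [min_le_left (q.1 - c) (d - q.2)])
        (by simp only; linarith [min_le_right (q.1 - c) (d - q.2)]) hvd
  obtain ⟨r, hr, hbox⟩ := hbox
  -- a parallelogram to the upper right of the point
  have hup : ∃ t : ℝ, 0 < t ∧ ∀ u v, c ≤ u → u ≤ c + t → d ≤ v → v ≤ d + t → v ≤ b.1 →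
      (u, v) ∈ S := by
    rcases hdb.eq_or_lt with hd | hd
    · refine ⟨r, hr, fun u v hu hu' hv _ hvb => ?_⟩
      have : v = d := le_antisymm (hd ▸ hvb) hv
      exact hbox u v hu hu' (hd0.trans hv) (by linarith) this.le
    · have e1 : ∀ t, ppt ε (c, d) + t • dv ε ε.std = ppt ε (c + t, d) := fun t => by
        simp only [ppt]
        module
      have e2 : ∀ t, ppt ε (c, d) + t • dv ε (ε.std + 1) = ppt ε (c, d + t) := fun t => by
        simp only [ppt]
        module
      have e3 : ∀ u v, ppt ε (c, d) + u • dv ε ε.std + v • dv ε (ε.std + 1) =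
          ppt ε (c + u, d + v) := fun u v => by
        simp only [ppt]
        module
      have hR : 0 < min (a.1 - c) (b.1 - d) := lt_min (by linarith) (by linarith)
      have i1 : ppt ε (c, d) + min (a.1 - c) (b.1 - d) • dv ε ε.std ∈ (para ε a b).carrier := by
        rw [e1]
        exact hK _ ⟨⟨by simp only; linarith,
          by simp only; linarith [min_le_left (a.1 - c) (b.1 - d)]⟩, hd0, hdb⟩
      have i2 : ppt ε (c, d) + min (a.1 - c) (b.1 - d) • dv ε (ε.std + 1) ∈
          (para ε a b).carrier := by
        rw [e2]
        exact hK _ ⟨⟨hc0, hca⟩, by simp only; linarith,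
          by simp only; linarith [min_le_right (a.1 - c) (b.1 - d)]⟩
      obtain ⟨t, ht, hag⟩ := agree_para hF hS hg.plot ⟨s', hs'⟩ (std_ne_std_add_one ε) hR i1 i2
        ⟨r, hr, fun t h0 htr => by
          rw [e1]
          exact hSg _ (hbox _ _ (by linarith) (by linarith) hd0 (by linarith) le_rfl)⟩
        ⟨b.1 - d, by linarith, fun t h0 htr => by
          rw [e2]
          exact hSg _ (hcol _ (by linarith) (by linarith))⟩
        (hg.not_fold hF (hK _ ⟨⟨hc0, hca⟩, hd0, hdb⟩) (std_ne_std_add_one ε) hR i1 i2)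
      refine ⟨min t (a.1 - c), lt_min ht (by linarith), fun u v hu hu' hv hv' hvb => ?_⟩
      have hm1 := min_le_left t (a.1 - c)
      have hm2 := min_le_right t (a.1 - c)
      apply hSK _ ⟨⟨hc0.trans hu, by simp only; linarith⟩, hd0.trans hv, hvb⟩
      have := hag (u - c) (v - d) (by linarith) (by linarith) (by linarith) (by linarith)
      rwa [e3, add_sub_cancel, add_sub_cancel] at this
  obtain ⟨t, ht, hup⟩ := hup
  obtain ⟨⟨u, v⟩, ⟨hqK, hqS⟩, hq⟩ := Metric.mem_closure_iff.1 hzT (min r t) (lt_min hr ht)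
  obtain ⟨⟨hu0, hua⟩, hv0, hvb⟩ := hqK
  rw [Prod.dist_eq, max_lt_iff, Real.dist_eq, Real.dist_eq, abs_lt, abs_lt] at hq
  simp only at hq hu0 hua hv0 hvb
  have hm1 := min_le_left r t
  have hm2 := min_le_right r t
  rcases lt_or_ge u c with h | h
  · exact hqS (hTS _ ⟨⟨hu0, hua⟩, hv0, hvb⟩ fun h' => absurd (hleft _ h') (not_le.2 h))
  · rcases le_total v d with h' | h'
    · exact hqS (hbox u v h (by linarith) hv0 (by linarith) h')
    · exact hqS (hup u v h (by linarith) h' (by linarith) hvb)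

/-- The uniqueness of maps from parallelograms, for a parallelogram in an enclosure. -/
theorem para_unique_of_mem (hF : IsConstruction F) (hS : ∀ x : Pts F, (link F x).IsBuilding)
    {E : Enc} {g g' : Apt → Pts F} (hg : IPlot E g) (hg' : Plot E g') {z : Apt} {ε : Parity}
    {i j : Fin 3} (hij : i ≠ j) {a b : ℝ} (ha : 0 < a) (hb : 0 < b) (hi : z + a • dv ε i ∈ E.carrier)
    (hj : z + b • dv ε j ∈ E.carrier)
    (h1 : ∀ u : ℝ, 0 ≤ u → u ≤ a → g (z + u • dv ε i) = g' (z + u • dv ε i))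
    (h2 : ∀ v : ℝ, 0 ≤ v → v ≤ b → g (z + v • dv ε j) = g' (z + v • dv ε j)) {u v : ℝ}
    (hu : 0 ≤ u) (hua : u ≤ a) (hv : 0 ≤ v) (hvb : v ≤ b) :
    g (z + u • dv ε i + v • dv ε j) = g' (z + u • dv ε i + v • dv ε j) := by
  obtain ⟨π, rfl, rfl⟩ := exists_perm_add_one ε.std hij
  have hm : ∀ x ∈ (para ε ⟨a, ha⟩ ⟨b, hb⟩).carrier, weyl π z x ∈ E.carrier := by
    intro x hx
    obtain ⟨u, v, hu, hua, hv, hvb, rfl⟩ := exists_of_mem_para hx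
    rw [weyl_add_smul_dv, weyl_smul_dv]
    exact E.mem_of_tips hij hi hj hu hua hv hvb
  have := para_unique hF hS (hg.comp_weyl π z hm) (hg'.comp_weyl π z hm)
    (fun u hu hua => by rw [weyl_smul_dv]; exact h1 u hu hua)
    (fun v hv hvb => by rw [weyl_smul_dv]; exact h2 v hv hvb) _
    (mem_para (a := ⟨a, ha⟩) (b := ⟨b, hb⟩) hu hua hv hvb)
  simpa only [weyl_add_smul_dv, weyl_smul_dv] using this

/-! ### Rays and sectors in buildings -/

variable {B : Sh}

/-- The function on points of a section, extended to the plane by a constant. -/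
theorem exists_rep {E : Enc} (s : Sec B E) (x₀ : Pts B) : ∃ g : Apt → Pts B, Rep s g := by
  classical
  exact ⟨fun x => if hx : x ∈ E.carrier then ev s ⟨x, hx⟩ else x₀, fun z => by simp⟩

theorem IsGerm.base_eq {g : Apt → Pts B} {z : Apt} {ε : Parity} {i : Fin 3} {p : VGerm B ε}
    (h : IsGerm g z ε i p) : p.base = g z := by
  obtain ⟨t, s, rfl, hs⟩ := h
  rw [VGerm.base_mk, hs]
  have : cU ε (segOrigin ε t).1 = 0 := by
    have := cU_smul ε 0
    rwa [zero_smul] at this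
  simp only [this, zero_smul, add_zero]

/-- Every germ of a one-dimensional sector has an opposite germ. -/
theorem exists_opposite_germ (hS : ∀ x : Pts B, (link B x).IsBuilding) {ε : Parity}
    (q : VGerm B ε.flip) : ∃ ν : VGerm B ε, ν.base = q.base ∧ ¬JoinedG ε ν q := by
  obtain ⟨ν, hν⟩ := (hS q.base).exists_opposite ⟨q, rfl⟩
  exact ⟨ν.1, ν.2, fun h => hν (link_adj_iff.2 h).symm⟩

theorem segTip_eq (ε : Parity) (t : Len) : (segTip ε t).1 = t.1 • dv ε ε.std := ray_eq ε t.1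

/-- Extension of straight segments, in terms of functions on points. -/
theorem IsBuilding.exists_extension (hB : IsBuilding B) {ε : Parity} {t t' : Len} (h : t < t')
    {g : Apt → Pts B} (hg : IPlot (seg ε t) g) {ν : VGerm B ε}
    (hν : ν.base = g (t.1 • dv ε ε.std))
    (hop : ∀ q, IsGerm g (t.1 • dv ε ε.std) ε.flip ε.std q → ¬JoinedG ε ν q) :
    ∃ g' : Apt → Pts B, IPlot (seg ε t') g' ∧
      (∀ r, 0 ≤ r → r ≤ t.1 → g' (r • dv ε ε.std) = g (r • dv ε ε.std)) ∧
      IsGerm g' (t.1 • dv ε ε.std) ε ε.std ν := by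
  have hF := hB.construction
  obtain ⟨s, him, hs⟩ := hg
  have htip : ev s (segTip ε t) = g (t.1 • dv ε ε.std) := by rw [hs, segTip_eq]
  obtain ⟨π, d, hπ, -, hd⟩ := exists_dir (E := seg ε t) (segTip ε t) (ε := ε.flip) (i := ε.std) t
    (by
      rw [segTip_eq, dv_flip, smul_neg, add_neg_cancel]
      exact (segOrigin ε t).2)
  have hq := d.isGerm hd hs
  rw [hπ, segTip_eq] at hq
  obtain ⟨φ', hφ', hres, hdir⟩ := hB.exSeg ε t s him d ⟨ν, hν.trans htip.symm⟩ (by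
    exact (hB.spherical _).edist_eq_three (Parity.flip_ne ε) fun hadj =>
      hop _ hq (link_adj_iff.1 hadj.symm)) t' h
  obtain ⟨g', hg'⟩ := exists_rep φ' ν.base
  refine ⟨g', ⟨φ', hφ', hg'⟩, fun r h0 hr => ?_, ?_⟩
  · have := congrArg (fun w => ev w ⟨r • dv ε ε.std, mem_seg h0 hr⟩) hres
    rwa [(hg'.incl (segIncl ε h.le) fun _ => rfl) _, hs] at this
  · have hpt : (segPoint ε t' t h.le).1 = t.1 • dv ε ε.std := ray_eq ε t.1
    have h' : t.1 < t'.1 := h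
    obtain ⟨π', d', hπ', -, hd'⟩ := exists_dir (E := seg ε t') (segPoint ε t' t h.le) (ε := ε)
      (i := ε.std) ⟨t'.1 - t.1, by linarith⟩ (by
        rw [hpt, ← add_smul, add_sub_cancel]
        exact mem_seg t'.2.le le_rfl)
    have := d'.isGerm hd' hg'
    rwa [hdir d', hπ', hpt] at this

/-- A function on the plane is an immersive ray on the half-line in the standard direction of
parity `ε`. -/
def IsRay (ε : Parity) (R : Apt → Pts B) : Prop := ∀ t : Len, IPlot (seg ε t) R

theorem IsBuilding.exists_longer (hB : IsBuilding B) {ε : Parity} {t t' : Len} (h : t < t')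
    {g : Apt → Pts B} (hg : IPlot (seg ε t) g) :
    ∃ g' : Apt → Pts B, IPlot (seg ε t') g' ∧
      ∀ r, 0 ≤ r → r ≤ t.1 → g' (r • dv ε ε.std) = g (r • dv ε ε.std) := by
  obtain ⟨q, hq⟩ := hg.plot.exists_isGerm (z := t.1 • dv ε ε.std) (mem_seg t.2.le le_rfl)
    (ε := ε.flip) (i := ε.std) t.2 (by
      rw [dv_flip, smul_neg, add_neg_cancel]
      exact (segOrigin ε t).2)
  obtain ⟨ν, hνb, hν⟩ := exists_opposite_germ hB.spherical q
  obtain ⟨g', h1, h2, -⟩ := hB.exists_extension h hg (hνb.trans hq.base_eq) (fun q' hq' => by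
    rwa [(vGerm_eq_iff hB.construction hq' hq).2 Agree.refl])
  exact ⟨g', h1, h2⟩

/-- Immersive segments extend to immersive rays. -/
theorem IsBuilding.exists_ray (hB : IsBuilding B) {ε : Parity} {t : Len} {g : Apt → Pts B}
    (hg : IPlot (seg ε t) g) :
    ∃ R : Apt → Pts B, IsRay ε R ∧
      ∀ r, 0 ≤ r → r ≤ t.1 → R (r • dv ε ε.std) = g (r • dv ε ε.std) := by
  let len : ℕ → Len := fun n => ⟨t.1 + n, by have := t.2; positivity⟩
  have hlen : ∀ n, len n < len (n + 1) := fun n => by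
    change t.1 + n < t.1 + (n + 1 : ℕ)
    push_cast
    linarith
  have h0 : len 0 = t := Subtype.ext (by simp [len])
  choose next hnext hagree using fun (n : ℕ) (g : {g : Apt → Pts B // IPlot (seg ε (len n)) g}) =>
    hB.exists_longer (hlen n) g.2
  let G : ∀ n, {g : Apt → Pts B // IPlot (seg ε (len n)) g} := fun n =>
    Nat.rec ⟨g, by rw [h0]; exact hg⟩ (fun n g => ⟨next n g, hnext n g⟩) n
  obtain ⟨Γ, hΓ⟩ : ∃ Γ : ℕ → Apt → Pts B, ∀ n, Γ n = (G n).1 := ⟨fun n => (G n).1, fun _ => rfl⟩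
  have hΓp : ∀ n, IPlot (seg ε (len n)) (Γ n) := fun n => by
    rw [hΓ]
    exact (G n).2
  have hG : ∀ n k (r : ℝ), 0 ≤ r → r ≤ (len n).1 →
      Γ (n + k) (r • dv ε ε.std) = Γ n (r • dv ε ε.std) := by
    intro n k r hr hrn
    induction k with
    | zero => rfl
    | succ k ih =>
      rw [← ih, hΓ, hΓ]
      refine hagree (n + k) (G (n + k)) r hr (hrn.trans ?_)
      change t.1 + n ≤ t.1 + (n + k : ℕ)
      push_cast
      linarith [(Nat.cast_nonneg k : (0 : ℝ) ≤ k)]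
  have key : ∀ n (r : ℝ), 0 ≤ r → r ≤ (len n).1 →
      Γ ⌈r⌉₊ (r • dv ε ε.std) = Γ n (r • dv ε ε.std) := by
    intro n r hr hrn
    have hm : r ≤ (len ⌈r⌉₊).1 := by
      change r ≤ t.1 + (⌈r⌉₊ : ℕ)
      linarith [Nat.le_ceil r, t.2]
    rcases le_total n ⌈r⌉₊ with h | h
    · obtain ⟨k, hk⟩ := Nat.exists_eq_add_of_le h
      rw [hk, hG n k r hr hrn]
    · obtain ⟨k, hk⟩ := Nat.exists_eq_add_of_le h
      rw [hk, hG ⌈r⌉₊ k r hr hm]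
  refine ⟨fun x => Γ ⌈cU ε x⌉₊ x, fun T => ?_, fun r hr hrt => ?_⟩
  · obtain ⟨n, hn⟩ := exists_nat_ge T.1
    have hTn : T.1 ≤ (len n).1 := by
      change T.1 ≤ t.1 + n
      linarith [t.2]
    have h1 : IPlot (seg ε T) (Γ n) := (hΓp n).mono fun x hx => by
      obtain ⟨r, hr, hrT, rfl⟩ := exists_of_mem_seg hx
      exact mem_seg hr (hrT.trans hTn)
    refine h1.congr fun x hx => ?_
    obtain ⟨r, hr, hrT, rfl⟩ := exists_of_mem_seg hx
    simp only [cU_smul]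
    exact (key n r hr (hrT.trans hTn)).symm
  · simp only [cU_smul]
    rw [key 0 r hr (by rw [h0]; exact hrt), hΓ]
    rfl

theorem weyl_one (z x : Apt) : weyl 1 z x = z + x := by
  apply Apt.ext'
  intro i
  simp [add_comm]

/-- Extension for obtuse angles, in terms of functions on points. -/
theorem IsBuilding.exists_para (hB : IsBuilding B) {ε : Parity} {R R' : Apt → Pts B} {a b : Len}
    (hR : IPlot (seg ε a) R) (hR' : IPlot (seg ε b) R') (h0 : R 0 = R' 0)
    (hne : ¬Agree R 0 ε ε.std R' 0 ε.std) :
    ∃ g : Apt → Pts B, IPlot (para ε a b) g ∧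
      (∀ r, 0 ≤ r → r ≤ a.1 → g (r • dv ε ε.std) = R (r • dv ε ε.std)) ∧
      ∀ r, 0 ≤ r → r ≤ b.1 → g (r • dv ε (ε.std + 1)) = R' (r • dv ε ε.std) := by
  obtain ⟨φ, hφ, hRφ⟩ := hR
  obtain ⟨ψ, hψ, hRψ⟩ := hR'
  have hgerm : ∀ {t : Len} {s : Sec B (seg ε t)} {g : Apt → Pts B}, Rep s g →
      IsGerm g 0 ε ε.std (VGerm.mk s) := fun hs =>
    isGerm_mk (π := 1) (by simp) (hs.congr fun x _ => by rw [weyl_one, zero_add])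
  obtain ⟨ζ, hζ, h1, h2⟩ := hB.exObt ε a b φ ψ (by
    rw [hRφ, hRψ]
    exact h0) (fun e => hne ((vGerm_eq_iff hB.construction (hgerm hRφ) (hgerm hRψ)).1 e)) hφ hψ
  obtain ⟨g, hg⟩ := exists_rep ζ (R 0)
  refine ⟨g, ⟨ζ, hζ, hg⟩, fun r hr hra => ?_, fun r hr hrb => ?_⟩
  · have := congrArg (fun w => ev w ⟨r • dv ε ε.std, mem_seg hr hra⟩) h1
    rwa [(hg.incl (edge₁ ε a b) fun _ => rfl) _, hRφ] at this
  · have := congrArg (fun w => ev w ⟨r • dv ε ε.std, mem_seg hr hrb⟩) h2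
    rw [(hg.res (edge₂ ε a b) fun _ => rfl) _, hRψ] at this
    have hrot : ∀ i : Fin 3, finRotate 3 i = i + 1 := by decide
    simp only at this
    rwa [weyl_smul_dv, zero_add, inv_inv, hrot] at this

/-- Two immersive rays with the same origin and different directions span an infinite sector of 120
degrees. -/
theorem IsBuilding.exists_sector (hB : IsBuilding B) {ε : Parity} {R R' : Apt → Pts B}
    (hR : IsRay ε R) (hR' : IsRay ε R') (h0 : R 0 = R' 0)
    (hne : ¬Agree R 0 ε ε.std R' 0 ε.std) :
    ∃ Z : Apt → Pts B, (∀ a b, IPlot (para ε a b) Z) ∧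
      (∀ r : ℝ, 0 ≤ r → Z (r • dv ε ε.std) = R (r • dv ε ε.std)) ∧
      ∀ r : ℝ, 0 ≤ r → Z (r • dv ε (ε.std + 1)) = R' (r • dv ε ε.std) := by
  choose ζ hζ h1 h2 using fun a b => hB.exists_para (hR a) (hR' b) h0 hne
  have hcompat : ∀ (a b a' b' : Len) (x : Apt), x ∈ (para ε a b).carrier →
      x ∈ (para ε a' b').carrier → ζ a b x = ζ a' b' x := by
    intro a b a' b' x hx hx'
    have hm : x ∈ (para ε (min a a') (min b b')).carrier := by
      rw [mem_para_iff] at hx hx' ⊢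
      have e1 : (min a a').1 = min a.1 a'.1 := rfl
      have e2 : (min b b').1 = min b.1 b'.1 := rfl
      exact ⟨hx.1, e1 ▸ le_min hx.2.1 hx'.2.1, hx.2.2.1, e2 ▸ le_min hx.2.2.2 hx'.2.2.2⟩
    have l1 : (min a a').1 ≤ a.1 := min_le_left a a'
    have l2 : (min a a').1 ≤ a'.1 := min_le_right a a'
    have l3 : (min b b').1 ≤ b.1 := min_le_left b b'
    have l4 : (min b b').1 ≤ b'.1 := min_le_right b b'
    refine para_unique hB.construction hB.spherical ((hζ a b).mono fun y hy => ?_)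
      ((hζ a' b').plot.mono fun y hy => ?_) (fun r hr hra => ?_) (fun r hr hrb => ?_) x hm
    · rw [mem_para_iff] at hy ⊢
      exact ⟨hy.1, hy.2.1.trans l1, hy.2.2.1, hy.2.2.2.trans l3⟩
    · rw [mem_para_iff] at hy ⊢
      exact ⟨hy.1, hy.2.1.trans l2, hy.2.2.1, hy.2.2.2.trans l4⟩
    · rw [h1 a b r hr (hra.trans l1), h1 a' b' r hr (hra.trans l2)]
    · rw [h2 a b r hr (hrb.trans l3), h2 a' b' r hr (hrb.trans l4)]
  let L : ℝ → Len := fun c => ⟨max c 0 + 1, by positivity⟩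
  have hL : ∀ c, c ≤ (L c).1 := fun c => by
    change c ≤ max c 0 + 1
    linarith [le_max_left c 0]
  have key : ∀ (a b : Len) (x : Apt), x ∈ (para ε a b).carrier →
      ζ (L (cU ε x)) (L (cV ε x)) x = ζ a b x := fun a b x hx => by
    refine hcompat _ _ _ _ x ?_ hx
    rw [mem_para_iff] at hx ⊢
    exact ⟨hx.1, hL _, hx.2.2.1, hL _⟩
  refine ⟨fun x => ζ (L (cU ε x)) (L (cV ε x)) x,
    fun a b => (hζ a b).congr fun x hx => (key a b x hx).symm, fun r hr => ?_, fun r hr => ?_⟩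
  · rw [← h1 (L r) 1 r hr (hL r)]
    apply key
    have := mem_para (ε := ε) (a := L r) (b := 1) hr (hL r) le_rfl zero_le_one
    simpa using this
  · rw [← h2 1 (L r) r hr (hL r)]
    apply key
    have := mem_para (ε := ε) (a := 1) (b := L r) le_rfl zero_le_one hr (hL r)
    simpa using this

theorem std_add_two_ne (ε : Parity) : ε.std ≠ ε.std + 2 ∧ ε.std + 1 ≠ ε.std + 2 := by
  generalize ε.std = i
  revert i
  decide

theorem dv_add_dv_std (ε : Parity) :
    dv ε ε.std + dv ε (ε.std + 1) = -dv ε (ε.std + 2) :=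
  dv_add_dv ε (std_ne_std_add_one ε) (std_add_two_ne ε).1 (std_add_two_ne ε).2

/-- The bisector of a sector of 120 degrees extends, beyond the vertex of the sector, to a ray whose
direction is opposite to the bisector. -/
theorem IsBuilding.exists_opposite_ray (hB : IsBuilding B) {ε : Parity} {Z : Apt → Pts B}
    (hZ : ∀ a b, IPlot (para ε a b) Z) : ∃ R : Apt → Pts B, IsRay ε R ∧ R 0 = Z 0 ∧
      ∀ p m, IsGerm R 0 ε ε.std p → IsGerm Z 0 ε.flip (ε.std + 2) m → ¬JoinedG ε p m := by
  have hF := hB.construction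
  have hmem : ∀ r : ℝ, 0 ≤ r → r ≤ 1 → r • dv ε.flip (ε.std + 2) ∈ (para ε 1 1).carrier := by
    intro r h0 h1
    have := mem_para (ε := ε) (a := 1) (b := 1) h0 h1 h0 h1
    rwa [← smul_add, dv_add_dv_std, ← dv_flip] at this
  obtain ⟨m, hm⟩ := (hZ 1 1).plot.exists_isGerm (z := 0) (by simpa using hmem 0 le_rfl zero_le_one)
    (ε := ε.flip) (i := ε.std + 2) one_pos (by simpa using hmem 1 zero_le_one le_rfl)
  obtain ⟨ν, hνb, hν⟩ := exists_opposite_germ hB.spherical m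
  obtain ⟨π, hπ⟩ := exists_perm_std ε (ε.std + 2)
  -- the segment of length one on the bisector, traversed towards the origin
  let g : Apt → Pts B := fun x => Z (weyl π (dv ε.flip (ε.std + 2)) x)
  have hgr : ∀ r : ℝ, g (r • dv ε ε.std) = Z ((1 - r) • dv ε.flip (ε.std + 2)) := by
    intro r
    simp only [g]
    rw [weyl_smul_dv, hπ, dv_flip]
    congr 1
    module
  have hg : IPlot (seg ε 1) g := (hZ 1 1).comp_weyl _ _ fun x hx => by
    obtain ⟨r, h0, h1, rfl⟩ := exists_of_mem_seg hx
    have h1 : r ≤ 1 := h1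
    rw [weyl_smul_dv, hπ]
    have := hmem (1 - r) (by linarith) (by linarith)
    rw [dv_flip] at this ⊢
    convert this using 1
    module
  have hlt : (1 : Len) < ⟨2, two_pos⟩ := by
    change (1 : ℝ) < 2
    norm_num
  have h1 : g ((1 : Len).1 • dv ε ε.std) = Z 0 := by
    rw [hgr]
    change Z (((1 : ℝ) - 1) • _) = _
    rw [sub_self, zero_smul]
  obtain ⟨g', hg', hgg', hgerm⟩ := hB.exists_extension (t' := ⟨2, two_pos⟩) hlt hg (ν := ν)
    (by rw [h1, hνb, hm.base_eq]) (by
      intro q hq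
      have : q = m := by
        refine (vGerm_eq_iff hF hq hm).2 ⟨1, one_pos, fun t _ _ => ?_⟩
        have := hgr (1 - t)
        rw [sub_sub_cancel] at this
        rw [zero_add, ← this, dv_flip]
        congr 1
        change (1 : ℝ) • _ + _ = _
        module
      rw [this]
      exact hν)
  have hg2 : IPlot (seg ε 1) fun x => g' (weyl 1 (dv ε ε.std) x) := hg'.comp_weyl _ _ fun x hx => by
    obtain ⟨r, h0, h1, rfl⟩ := exists_of_mem_seg hx
    have h1 : r ≤ 1 := h1
    rw [weyl_one]
    have := mem_seg (ε := ε) (t := ⟨2, two_pos⟩) (r := 1 + r) (by linarith) (by linarith)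
    rwa [add_smul, one_smul] at this
  obtain ⟨R, hR, hRg⟩ := hB.exists_ray hg2
  refine ⟨R, hR, ?_, fun p m' hp hm' => ?_⟩
  · have := hRg 0 le_rfl zero_le_one
    rw [zero_smul, weyl_one, add_zero] at this
    rw [this, ← h1]
    have h2 := hgg' 1 zero_le_one le_rfl
    rw [one_smul] at h2
    rw [h2]
    congr 1
    exact (one_smul ℝ _).symm
  · have e1 : m' = m := (vGerm_eq_iff hF hm' hm).2 Agree.refl
    have e2 : p = ν := by
      refine (vGerm_eq_iff hF hp hgerm).2 ⟨1, one_pos, fun t h0 h1 => ?_⟩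
      rw [zero_add, hRg t h0 h1, weyl_one]
      congr 2
      exact (one_smul ℝ _).symm
    rw [e1, e2]
    exact hν

/-! ### Three sectors -/

/-- The rotation of the plane that maps the direction `i` to the direction `i + m`. The affine map
`weyl π` permutes the directions by the inverse of `π`, therefore `rot m` subtracts `m`. -/
def rot (m : Fin 3) : Equiv.Perm (Fin 3) := Equiv.subRight m

theorem rot_inv (m i : Fin 3) : (rot m)⁻¹ i = i + m := rfl

theorem rot_mul (k m : Fin 3) : rot k * rot m = rot (k + m) := by
  revert k m
  decide

theorem weyl_rot (k : Fin 3) (ε : Parity) (c : ℝ) (i : Fin 3) :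
    weyl (rot k) 0 (c • dv ε i) = c • dv ε (i + k) := by
  rw [weyl_smul_dv, zero_add, rot_inv]

theorem weyl_rot_ppt (k : Fin 3) (ε : Parity) (q : ℝ × ℝ) :
    weyl (rot k) 0 (ppt ε q) = q.1 • dv ε (ε.std + k) + q.2 • dv ε (ε.std + k + 1) := by
  rw [ppt, weyl_add_smul_dv, weyl_rot, rot_inv, add_right_comm]

/-- The hexagon with centre at the origin. -/
def hex (N : Len) : Enc where
  carrier := halfSpaces [(0, 1, -N.1), (1, 0, -N.1), (1, 2, -N.1), (2, 1, -N.1), (0, 2, -N.1),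
    (2, 0, -N.1)]
  bounded := by
    apply isBounded_of_diff N.1
    intro x hx i j
    have hN := N.2
    simp only [halfSpaces, List.mem_cons, List.not_mem_nil, or_false,
      Set.mem_ofPred_eq, forall_eq_or_imp, forall_eq] at hx
    obtain ⟨h1, h2, h3, h4, h5, h6⟩ := hx
    fin_cases i <;> fin_cases j <;> simp <;> linarith
  finite_roots := ⟨_, by simp, rfl⟩

theorem mem_hex {N : Len} {x : Apt} : x ∈ (hex N).carrier ↔
    ∀ i j, x.1 i - x.1 j ≤ N.1 := by
  have hN := N.2
  simp only [hex, halfSpaces, List.mem_cons, List.not_mem_nil, or_false,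
    Set.mem_ofPred_eq, forall_eq_or_imp, forall_eq]
  constructor
  · rintro ⟨h1, h2, h3, h4, h5, h6⟩ i j
    fin_cases i <;> fin_cases j <;> simp <;> linarith
  · intro h
    exact ⟨by linarith [h 1 0], by linarith [h 0 1], by linarith [h 2 1], by linarith [h 1 2],
      by linarith [h 2 0], by linarith [h 0 2]⟩

theorem mem_hex_of_norm {M : ℝ} {N : Len} (hN : 2 * M ≤ N.1) {x : Apt} (hx : ‖x‖ ≤ M) :
    x ∈ (hex N).carrier := by
  rw [mem_hex]
  intro i j
  have h : ∀ i, |x.1 i| ≤ M := fun i => (PiLp.norm_apply_le x.1 i).trans hx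
  linarith [abs_le.1 (h i), (abs_le.1 (h i)).2, (abs_le.1 (h j)).1]

theorem norm_dv_le (ε : Parity) (i : Fin 3) : ‖dv ε i‖ ≤ 1 := by
  rw [norm_dv]
  exact Real.sqrt_le_one.2 (by norm_num)

/-- The plane is the union of the three images of the standard sector of 120 degrees under
rotations. -/
theorem exists_sector_coords (ε : Parity) (x : Apt) : ∃ (k : Fin 3) (q : ℝ × ℝ),
    0 ≤ q.1 ∧ 0 ≤ q.2 ∧ x = weyl (rot k) 0 (ppt ε q) := by
  have hx := eq_cU_cV ε x
  have h0 : dv ε (ε.std + 2) = -(dv ε ε.std + dv ε (ε.std + 1)) := by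
    rw [dv_add_dv_std, neg_neg]
  have a2 : ε.std + 1 + 1 = ε.std + 2 := by
    generalize ε.std = i
    revert i
    decide
  have a3 : ε.std + 2 + 1 = ε.std := by
    generalize ε.std = i
    revert i
    decide
  generalize cU ε x = u at hx
  generalize cV ε x = v at hx
  simp only [weyl_rot_ppt]
  by_cases h : 0 ≤ u ∧ 0 ≤ v
  · exact ⟨0, (u, v), h.1, h.2, by simpa using hx⟩
  · rcases le_or_gt u v with huv | huv
    · have hu : u < 0 := by
        by_contra hu
        exact h ⟨not_lt.1 hu, (not_lt.1 hu).trans huv⟩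
      refine ⟨1, (v - u, -u), by simpa using huv, by simpa using hu.le, ?_⟩
      simp only [a2]
      rw [hx, h0]
      module
    · have hv : v < 0 := by
        by_contra hv
        exact h ⟨(not_lt.1 hv).trans huv.le, not_lt.1 hv⟩
      refine ⟨2, (-v, u - v), by simpa using hv.le, by simpa using huv.le, ?_⟩
      simp only [a3]
      rw [hx, h0]
      module

theorem eq_of_combination (ε : Parity) (i : Fin 3) {u v w : ℝ}
    (h : u • dv ε i + v • dv ε (i + 1) + w • dv ε (i + 2) = 0) : u = v ∧ v = w := by
  have e : ∀ j, (u • dv ε i + v • dv ε (i + 1) + w • dv ε (i + 2)).1 j = 0 := fun j => by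
    rw [h]
    rfl
  have e0 := e 0
  have e1 := e 1
  have e2 := e 2
  simp only [Submodule.coe_add, Submodule.coe_smul, PiLp.add_apply, PiLp.smul_apply, dv_apply,
    smul_eq_mul] at e0 e1 e2
  cases ε <;> fin_cases i <;> simp [Parity.sgn] at e0 e1 e2 <;> constructor <;> linarith

/-- A function on the plane that is a plot on all enclosures, is immersive on the three sectors of
120 degrees at the origin and does not fold at the origin. -/
structure IsTripod (ε : Parity) (f : Apt → Pts B) : Prop where
  plot : ∀ (E : Enc) (π : Equiv.Perm (Fin 3)) (t : Apt), Plot E fun x => f (weyl π t x)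
  sector : ∀ (k : Fin 3) (a b : Len), IPlot (para ε a b) fun x => f (weyl (rot k) 0 x)
  origin : ∀ (ε' : Parity) (i j : Fin 3), i ≠ j → ¬Fold f 0 ε' i j

/-- Functions on the three sectors that agree on the common rays are combined to a function on the
plane. -/
theorem exists_of_sectors (ε : Parity) {R G : Fin 3 → Apt → Pts B}
    (h1 : ∀ k (r : ℝ), 0 ≤ r → G k (r • dv ε ε.std) = R k (r • dv ε ε.std))
    (h2 : ∀ k (r : ℝ), 0 ≤ r → G k (r • dv ε (ε.std + 1)) = R (k + 1) (r • dv ε ε.std)) :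
    ∃ f : Apt → Pts B, ∀ k (q : ℝ × ℝ), 0 ≤ q.1 → 0 ≤ q.2 →
      f (weyl (rot k) 0 (ppt ε q)) = G k (ppt ε q) := by
  have step : ∀ (k : Fin 3) (q q' : ℝ × ℝ), 0 ≤ q.1 → 0 ≤ q.2 → 0 ≤ q'.1 → 0 ≤ q'.2 →
      weyl (rot k) 0 (ppt ε q) = weyl (rot (k + 1)) 0 (ppt ε q') →
      G k (ppt ε q) = G (k + 1) (ppt ε q') := by
    intro k q q' hq1 hq2 hq1' hq2' e
    rw [weyl_rot_ppt, weyl_rot_ppt, ← sub_eq_zero] at e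
    have a1 : ε.std + (k + 1) = ε.std + k + 1 := by rw [add_assoc]
    have a2 : ε.std + k + 1 + 1 = ε.std + k + 2 := by rw [add_assoc _ 1 1]; rfl
    rw [a1, a2] at e
    obtain ⟨e1, e2⟩ := eq_of_combination ε (ε.std + k) (u := q.1) (v := q.2 - q'.1) (w := -q'.2)
      (by rw [← e]; module)
    have z1 : q.1 = 0 := by linarith
    have z2 : q'.2 = 0 := by linarith
    have z3 : q'.1 = q.2 := by linarith
    simp only [ppt, z1, z2, z3, zero_smul, zero_add, add_zero]
    rw [h1 _ _ hq2, h2 _ _ hq2]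
  have key : ∀ (k l : Fin 3) (q q' : ℝ × ℝ), 0 ≤ q.1 → 0 ≤ q.2 → 0 ≤ q'.1 → 0 ≤ q'.2 →
      weyl (rot k) 0 (ppt ε q) = weyl (rot l) 0 (ppt ε q') →
      G k (ppt ε q) = G l (ppt ε q') := by
    intro k l q q' hq1 hq2 hq1' hq2' e
    have hkl : l = k ∨ l = k + 1 ∨ k = l + 1 := by
      clear * -
      revert k l
      decide
    rcases hkl with rfl | rfl | rfl
    · have := congrArg (weyl (rot l)⁻¹ (weylInvTrans (rot l) 0)) e
      rw [weyl_inv_left, weyl_inv_left] at this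
      rw [this]
    · exact step k q q' hq1 hq2 hq1' hq2' e
    · exact (step l q' q hq1' hq2' hq1 hq2 e.symm).symm
  choose K Q hQ1 hQ2 hx using exists_sector_coords ε
  exact ⟨fun x => G (K x) (ppt ε (Q x)), fun k q hq1 hq2 =>
    key _ _ _ _ (hQ1 _) (hQ2 _) hq1 hq2 (hx _).symm⟩

theorem para_subset_hex {ε : Parity} {N : Len} (k : Fin 3) :
    ∀ x ∈ (para ε N N).carrier, weyl (rot k) 0 x ∈ (hex N).carrier := by
  intro x hx
  rw [mem_hex]
  intro i j
  simp only [weyl_apply, ZeroMemClass.coe_zero, PiLp.zero_apply, add_zero]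
  generalize rot k i = p
  generalize rot k j = q
  rw [mem_para_iff] at hx
  obtain ⟨h1, h2, h3, h4⟩ := hx
  have hN := N.2
  cases ε <;> simp only [cU, cV, Parity.std, Parity.sgn, Fin.reduceAdd] at h1 h2 h3 h4 <;>
    fin_cases p <;> fin_cases q <;> simp <;> linarith

/-- A function that restricts to plots on the three sectors is a plot on every enclosure. -/
theorem plot_of_sectors (hF : IsConstruction B) (ε : Parity) {f : Apt → Pts B}
    (hf : ∀ (k : Fin 3) (a b : Len), Plot (para ε a b) fun x => f (weyl (rot k) 0 x)) (E : Enc)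
    (π : Equiv.Perm (Fin 3)) (t : Apt) : Plot E fun x => f (weyl π t x) := by
  have hhex : ∀ N : Len, Plot (hex N) f := by
    intro N
    choose s hs using fun k => hf k N N
    obtain ⟨σ, hσ⟩ := hF.exists_glue (E := hex N) (fun _ : Fin 3 => para ε N N)
      (fun k => Enc.homOf (rot k) 0 (para_subset_hex k)) (fun x => by
        obtain ⟨k, q, hq1, hq2, hq⟩ := exists_sector_coords ε x.1
        refine ⟨k, ⟨ppt ε q, ?_⟩, Subtype.ext hq.symm⟩
        have hx := x.2
        rw [mem_hex] at hx
        have hxU : ∀ i j, (ppt ε q).1 i - (ppt ε q).1 j ≤ N.1 := fun i j => by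
          have := hx ((rot k)⁻¹ i) ((rot k)⁻¹ j)
          rw [hq] at this
          simpa using this
        rw [mem_para_iff]
        refine ⟨by rw [ppt, cU_eq]; exact hq1, ?_, by rw [ppt, cV_eq]; exact hq2, ?_⟩
        · cases ε <;> simp only [cU, Parity.sgn, one_mul, neg_one_mul, neg_sub] <;> apply hxU
        · cases ε <;> simp only [cV, Parity.sgn, one_mul, neg_one_mul, neg_sub] <;> apply hxU)
      s (fun x => f x.1) (fun k y => hs k y)
    exact ⟨σ, hσ⟩
  obtain ⟨M, hM⟩ := isBounded_iff_forall_norm_le.1 E.bounded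
  have hb : ∀ x ∈ E.carrier, ‖weyl π t x‖ ≤ |M| + ‖t‖ := by
    intro x hx
    have h1 : weyl π t x = t + weyl π 0 x := by
      apply Apt.ext'
      intro i
      simp [add_comm]
    have h2 : ‖weyl π 0 x‖ = ‖x‖ := by
      rw [norm_eq_sqrt_real_inner, norm_eq_sqrt_real_inner (F := Apt) x, inner_weyl]
    rw [h1]
    refine (norm_add_le _ _).trans ?_
    rw [h2]
    linarith [hM x hx, le_abs_self M]
  exact (hhex ⟨2 * (|M| + ‖t‖) + 1, by positivity⟩).comp_weyl π t fun x hx =>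
    mem_hex_of_norm (by simp only; linarith) (hb x hx)

theorem fold_weyl {f : Apt → Pts B} {π : Equiv.Perm (Fin 3)} {t z : Apt} {ε : Parity}
    {i j : Fin 3} : Fold (fun x => f (weyl π t x)) z ε i j ↔
      Fold f (weyl π t z) ε (π⁻¹ i) (π⁻¹ j) := by
  simp only [Fold, Agree, weyl_add_smul_dv]

theorem IsTripod.rotate {ε : Parity} {f : Apt → Pts B} (h : IsTripod ε f) (m : Fin 3) :
    IsTripod ε fun x => f (weyl (rot m) 0 x) where
  plot E π t := by
    simp only [weyl_weyl]
    exact h.plot E _ _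
  sector k a b := by
    have h0 : weyl (rot m) 0 0 = 0 := by
      apply Apt.ext'
      intro i
      simp
    simp only [weyl_weyl, rot_mul, h0]
    exact h.sector _ a b
  origin ε' i j hij := by
    have h0 : weyl (rot m) 0 0 = 0 := by
      apply Apt.ext'
      intro i
      simp
    rw [fold_weyl, h0]
    exact h.origin _ _ _ fun e => hij ((rot m)⁻¹.injective e)

theorem IsTripod.sector_zero {ε : Parity} {f : Apt → Pts B} (h : IsTripod ε f) (a b : Len) :
    IPlot (para ε a b) f :=
  (h.sector 0 a b).congr fun x _ => by
    have : rot 0 = 1 := by decide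
    rw [this, weyl_one_zero]

theorem abs_cU_dv (ε ε' : Parity) (i : Fin 3) : |cU ε (dv ε' i)| ≤ 1 := by
  cases ε <;> cases ε' <;> fin_cases i <;> simp [cU, dv_apply, Parity.sgn, Parity.std] <;> norm_num

theorem abs_cV_dv (ε ε' : Parity) (i : Fin 3) : |cV ε (dv ε' i)| ≤ 1 := by
  cases ε <;> cases ε' <;> fin_cases i <;> simp [cV, dv_apply, Parity.sgn, Parity.std] <;> norm_num

theorem cU_add_smul (ε : Parity) (x y : Apt) (r : ℝ) : cU ε (x + r • y) = cU ε x + r * cU ε y := by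
  simp [cU]
  ring

theorem cV_add_smul (ε : Parity) (x y : Apt) (r : ℝ) : cV ε (x + r • y) = cV ε x + r * cV ε y := by
  simp [cV]
  ring

theorem eq_or_eq_or_eq (p i : Fin 3) : i = p ∨ i = p + 1 ∨ i = p + 2 := by
  revert p i
  decide

/-- A symmetric relation on the three directions that does not relate any two of them. -/
theorem not_of_pairs {r : Fin 3 → Fin 3 → Prop} (hr : ∀ i j, r i j → r j i) (p : Fin 3)
    (h1 : ¬r p (p + 1)) (h2 : ¬r p (p + 2)) (h3 : ¬r (p + 1) (p + 2)) {i j : Fin 3} (hij : i ≠ j) :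
    ¬r i j := by
  intro h
  rcases eq_or_eq_or_eq p i with ei | ei | ei <;> rcases eq_or_eq_or_eq p j with ej | ej | ej <;>
    rw [ei, ej] at h hij
  exacts [hij rfl, h1 h, h2 h, h1 (hr _ _ h), hij rfl, h3 h, h2 (hr _ _ h), h3 (hr _ _ h), hij rfl]

/-- A tripod does not fold at the points of the open ray between two of its sectors. If it did, it
would be invariant near the point under the reflection in the ray. The uniqueness of maps
from a parallelogram, with one edge that leads back to the origin, implies that it folds at the
origin. -/
theorem IsTripod.not_fold_ray (hF : IsConstruction B) (hS : ∀ x : Pts B, (link B x).IsBuilding)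
    {ε : Parity} {f : Apt → Pts B} (h : IsTripod ε f) {u : ℝ} (hu : 0 < u) (ε' : Parity)
    {i j : Fin 3} (hij : i ≠ j) : ¬Fold f (u • dv ε ε.std) ε' i j := by
  obtain ⟨c, hc⟩ : ∃ c, c = ε.std := ⟨_, rfl⟩
  have hn1 : c ≠ c + 1 := by rw [hc]; exact std_ne_std_add_one ε
  have hn2 : c ≠ c + 2 := by rw [hc]; exact (std_add_two_ne ε).1
  have hn3 : c + 1 ≠ c + 2 := by rw [hc]; exact (std_add_two_ne ε).2
  have hd2 : dv ε (c + 2) = -(dv ε c + dv ε (c + 1)) := by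
    rw [hc, dv_add_dv_std, neg_neg]
  rw [← hc]
  have hmem : ∀ (a b : Len) (x y : ℝ), 0 ≤ x → x ≤ a.1 → 0 ≤ y → y ≤ b.1 →
      x • dv ε c + y • dv ε (c + 1) ∈ (para ε a b).carrier := by
    intro a b x y h1 h2 h3 h4
    rw [hc]
    exact mem_para h1 h2 h3 h4
  have hr : 0 < min u 1 := lt_min hu one_pos
  have hr1 := min_le_left u 1
  have hr2 := min_le_right u 1
  set r := min u 1
  let a : Len := ⟨u + 1, by linarith⟩
  have s0 : IPlot (para ε a a) f := h.sector_zero a a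
  have mz : u • dv ε c ∈ (para ε a a).carrier := by
    have := hmem a a u 0 hu.le (by simp only [a]; linarith) le_rfl a.2.le
    simpa using this
  have m0 : u • dv ε c + r • dv ε c ∈ (para ε a a).carrier := by
    have := hmem a a (u + r) 0 (by linarith) (by simp only [a]; linarith) le_rfl a.2.le
    simpa [add_smul] using this
  have m1 : u • dv ε c + r • dv ε (c + 1) ∈ (para ε a a).carrier :=
    hmem a a u r hu.le (by simp only [a]; linarith) hr.le (by simp only [a]; linarith)
  -- the sector on one side of the ray
  have A1 : ¬Fold f (u • dv ε c) ε c (c + 1) := s0.not_fold hF mz hn1 hr m0 m1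
  have A2 : ¬Fold f (u • dv ε c) ε.flip c (c + 2) := by
    refine s0.not_fold hF mz hn2 hr ?_ ?_
    · have := hmem a a (u - r) 0 (by linarith) (by simp only [a]; linarith) le_rfl a.2.le
      rw [dv_flip]
      convert this using 1
      module
    · have := hmem a a (u + r) r (by linarith) (by simp only [a]; linarith) hr.le
        (by simp only [a]; linarith)
      rw [dv_flip, hd2]
      convert this using 1
      module
  -- the sector on the other side
  have s2 : IPlot (para ε a a) fun x => f (weyl (rot 2) 0 x) := h.sector 2 a a
  have r1 : c + 1 + 2 = c := by
    clear * -
    revert c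
    decide
  have r2 : c + 2 + 2 = c + 1 := by
    clear * -
    revert c
    decide
  have nz : u • dv ε (c + 1) ∈ (para ε a a).carrier := by
    have := hmem a a 0 u le_rfl a.2.le hu.le (by simp only [a]; linarith)
    simpa using this
  have A3 : ¬Fold f (u • dv ε c) ε c (c + 2) := by
    have : ¬Fold (fun x => f (weyl (rot 2) 0 x)) (u • dv ε (c + 1)) ε (c + 1) c := by
      refine s2.not_fold hF nz hn1.symm hr ?_ ?_
      · have := hmem a a 0 (u + r) le_rfl a.2.le (by linarith) (by simp only [a]; linarith)
        convert this using 1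
        module
      · have := hmem a a r u hr.le (by simp only [a]; linarith) hu.le (by simp only [a]; linarith)
        convert this using 1
        module
    rwa [fold_weyl, weyl_rot, rot_inv, rot_inv, r1] at this
  have A4 : ¬Fold f (u • dv ε c) ε.flip c (c + 1) := by
    have : ¬Fold (fun x => f (weyl (rot 2) 0 x)) (u • dv ε (c + 1)) ε.flip (c + 1) (c + 2) := by
      refine s2.not_fold hF nz hn3 hr ?_ ?_
      · have := hmem a a 0 (u - r) le_rfl a.2.le (by linarith) (by simp only [a]; linarith)
        rw [dv_flip]
        convert this using 1
        module
      · have := hmem a a r (u + r) hr.le (by simp only [a]; linarith) (by linarith)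
          (by simp only [a]; linarith)
        rw [dv_flip, hd2]
        convert this using 1
        module
    rwa [fold_weyl, weyl_rot, rot_inv, rot_inv, r1, r2] at this
  -- the reflection in the ray
  obtain ⟨σ, σ0, σ1, σ2⟩ : ∃ σ : Equiv.Perm (Fin 3), σ⁻¹ c = c ∧ σ⁻¹ (c + 1) = c + 2 ∧
      σ⁻¹ (c + 2) = c + 1 := by
    clear * -
    revert c
    decide
  have σz : ∀ x : ℝ, weyl σ 0 (x • dv ε c) = x • dv ε c := fun x => by
    rw [weyl_smul_dv, zero_add, σ0]
  have A5 : ¬Fold f (u • dv ε c) ε.flip (c + 2) (c + 1) := by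
    rintro ⟨r', hr', hfold⟩
    apply h.origin ε.flip (c + 2) (c + 1) hn3.symm
    refine ⟨r', hr', fun t h0 ht => ?_⟩
    let b : Len := ⟨u + r', by linarith⟩
    have e := para_unique_of_mem hF hS (h.sector_zero b b) (h.plot (para ε b b) σ 0)
      (z := u • dv ε c) (ε := ε.flip) hn2.symm (a := r') (b := u) hr' hu
      (by
        have := hmem b b (u + r') r' (by linarith) le_rfl hr'.le (by simp only [b]; linarith)
        rw [dv_flip, hd2]
        convert this using 1
        module)
      (by
        have := hmem b b 0 0 le_rfl b.2.le le_rfl b.2.le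
        rw [dv_flip]
        convert this using 1
        module)
      (fun t h0 ht => by
        rw [weyl_add_smul_dv, σz, σ2]
        exact hfold t h0 ht)
      (fun t h0 ht => by rw [weyl_add_smul_dv, σz, σ0]) h0 ht hu.le le_rfl
    have e1 : u • dv ε c + t • dv ε.flip (c + 2) + u • dv ε.flip c =
        0 + t • dv ε.flip (c + 2) := by
      rw [dv_flip ε c]
      module
    rw [e1, weyl_add_smul_dv, σ2] at e
    rw [e]
    congr 2
    apply Apt.ext'
    intro i
    simp
  have A6 : ¬Fold f (u • dv ε c) ε (c + 1) (c + 2) := by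
    rintro ⟨r', hr', hfold⟩
    obtain ⟨t, ht, hag⟩ := agree_para hF hS s0.plot (h.plot (para ε a a) σ 0) hn1 hr m0 m1
      ⟨1, one_pos, fun t _ _ => by simp only [weyl_add_smul_dv, σz, σ0]⟩
      ⟨r', hr', fun t h0 ht => by
        simp only [weyl_add_smul_dv, σz, σ1]
        exact hfold t h0 ht⟩ A1
    refine A5 ⟨t, ht, fun x h0 hx => ?_⟩
    have := hag x x h0 hx h0 hx
    rw [weyl_add_smul_dv, weyl_add_smul_dv, σz, σ0, σ1] at this
    have e1 : u • dv ε c + x • dv ε.flip (c + 2) =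
        u • dv ε c + x • dv ε c + x • dv ε (c + 1) := by
      rw [dv_flip, hd2]
      module
    have e2 : u • dv ε c + x • dv ε.flip (c + 1) =
        u • dv ε c + x • dv ε c + x • dv ε (c + 2) := by
      rw [dv_flip, hd2]
      module
    rw [e1, e2]
    exact this
  rcases ε.eq_or_eq_flip ε' with rfl | rfl
  · exact not_of_pairs (r := Fold f _ ε') (fun _ _ => Agree.symm) c A1 A3 A6 hij
  · exact not_of_pairs (r := Fold f _ ε.flip) (fun _ _ => Agree.symm) c A4 A2
      (fun h => A5 h.symm) hij

/-- A tripod does not fold. -/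
theorem IsTripod.not_fold (hF : IsConstruction B) (hS : ∀ x : Pts B, (link B x).IsBuilding)
    {ε : Parity} {f : Apt → Pts B} (h : IsTripod ε f) (z : Apt) (ε' : Parity)
    {i j : Fin 3} (hij : i ≠ j) : ¬Fold f z ε' i j := by
  have transport : ∀ (k : Fin 3) (w : Apt),
      (∀ i j, i ≠ j → ¬Fold (fun x => f (weyl (rot k) 0 x)) w ε' i j) →
      ¬Fold f (weyl (rot k) 0 w) ε' i j := by
    intro k w hw hfold
    refine hw (rot k i) (rot k j) (fun e => hij ((rot k).injective e)) ?_
    rw [fold_weyl]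
    simpa using hfold
  obtain ⟨k, ⟨u, v⟩, hu, hv, rfl⟩ := exists_sector_coords ε z
  simp only at hu hv
  rcases hu.eq_or_lt with rfl | hu
  · rcases hv.eq_or_lt with rfl | hv
    · refine transport k _ fun i j hij => ?_
      have : ppt ε (0, 0) = 0 := by simp [ppt]
      rw [this]
      exact (h.rotate k).origin ε' i j hij
    · -- the second edge of the sector is the first edge of the next one
      have : weyl (rot k) 0 (ppt ε (0, v)) = weyl (rot (k + 1)) 0 (v • dv ε ε.std) := by
        rw [weyl_rot_ppt, weyl_rot]
        simp [add_assoc]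
      rw [this]
      exact transport (k + 1) _ fun i j hij => (h.rotate (k + 1)).not_fold_ray hF hS hv ε' hij
  · refine transport k _ fun i j hij => ?_
    rcases hv.eq_or_lt with rfl | hv
    · have : ppt ε (u, 0) = u • dv ε ε.std := by simp [ppt]
      rw [this]
      exact (h.rotate k).not_fold_ray hF hS hu ε' hij
    · have hr : 0 < min (min u v) 1 := lt_min (lt_min hu hv) one_pos
      have hr1 : min (min u v) 1 ≤ u := (min_le_left _ _).trans (min_le_left _ _)
      have hr2 : min (min u v) 1 ≤ v := (min_le_left _ _).trans (min_le_right _ _)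
      have hr3 : min (min u v) 1 ≤ 1 := min_le_right _ _
      set r := min (min u v) 1
      have hm : ∀ i, ppt ε (u, v) + r • dv ε' i ∈
          (para ε ⟨u + 1, by linarith⟩ ⟨v + 1, by linarith⟩).carrier := by
        intro i
        rw [mem_para_iff, cU_add_smul, cV_add_smul, ppt, cU_eq, cV_eq]
        have h1 := abs_le.1 (abs_cU_dv ε ε' i)
        have h2 := abs_le.1 (abs_cV_dv ε ε' i)
        refine ⟨?_, ?_, ?_, ?_⟩ <;> simp only <;> nlinarith
      exact ((h.rotate k).sector_zero ⟨u + 1, by linarith⟩ ⟨v + 1, by linarith⟩).not_fold hF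
        (mem_para hu.le (by simp) hv.le (by simp)) hij hr (hm i) (hm j)

/-! ### Apartments -/

/-- Large hexagons contain a neighbourhood of a given point. -/
theorem exists_hex_mem (z : Apt) : ∃ N : Len, ∀ (ε ε' : Parity) (i j : Fin 3) (u v : ℝ), 0 ≤ u →
    0 ≤ v → u + v ≤ 1 → z + u • dv ε i + v • dv ε' j ∈ (hex N).carrier := by
  refine ⟨⟨2 * (‖z‖ + 1), by positivity⟩, fun ε ε' i j u v hu hv huv => ?_⟩
  apply mem_hex_of_norm (M := ‖z‖ + 1) le_rfl
  have h1 : ‖u • dv ε i‖ ≤ u := by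
    rw [norm_smul, Real.norm_of_nonneg hu]
    exact mul_le_of_le_one_right hu (norm_dv_le ε i)
  have h2 : ‖v • dv ε' j‖ ≤ v := by
    rw [norm_smul, Real.norm_of_nonneg hv]
    exact mul_le_of_le_one_right hv (norm_dv_le ε' j)
  linarith [norm_add_le (z + u • dv ε i) (v • dv ε' j), norm_add_le z (u • dv ε i)]

theorem exists_germ_of_plot {f : Apt → Pts B} (hf : ∀ E, Plot E f) (z : Apt) (ε : Parity)
    (i : Fin 3) : ∃ p, IsGerm f z ε i p := by
  obtain ⟨N, hN⟩ := exists_hex_mem z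
  refine (hf (hex N)).exists_isGerm ?_ one_pos ?_
  · simpa using hN ε ε i i 0 0 le_rfl le_rfl (by norm_num)
  · simpa using hN ε ε i i 1 0 zero_le_one le_rfl (by norm_num)

theorem joinedG_of_plot (hF : IsConstruction B) {f : Apt → Pts B} (hf : ∀ E, Plot E f) {z : Apt}
    {ε : Parity} {i j : Fin 3} (hij : i ≠ j) {p : VGerm B ε} {q : VGerm B ε.flip}
    (hp : IsGerm f z ε i p) (hq : IsGerm f z ε.flip j q) : JoinedG ε p q := by
  obtain ⟨N, hN⟩ := exists_hex_mem z
  exact (hf (hex N)).joinedG hF hij one_pos (fun u v hu hv huv => hN _ _ _ _ u v hu hv huv) hp hq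

/-- Two immersive rays with the same origin and different directions lie in the image of a tripod.
The third ray is opposite to the bisector of the sector that is spanned by the first
two; this makes the six germs at the origin a hexagon. -/
theorem IsBuilding.exists_tripod (hB : IsBuilding B) {ε : Parity} {R R' : Apt → Pts B}
    (hR : IsRay ε R) (hR' : IsRay ε R') (h0 : R 0 = R' 0)
    (hne : ¬Agree R 0 ε ε.std R' 0 ε.std) :
    ∃ f : Apt → Pts B, IsTripod ε f ∧
      (∀ r : ℝ, 0 ≤ r → f (r • dv ε ε.std) = R (r • dv ε ε.std)) ∧
      ∀ r : ℝ, 0 ≤ r → f (r • dv ε (ε.std + 1)) = R' (r • dv ε ε.std) := by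
  have hF := hB.construction
  have hS := hB.spherical
  obtain ⟨Z, hZ, hZ1, hZ2⟩ := hB.exists_sector hR hR' h0 hne
  obtain ⟨R'', hR'', hR0, hopp⟩ := hB.exists_opposite_ray hZ
  have hZ0 : Z 0 = R 0 := by simpa using hZ1 0 le_rfl
  have hd2 : dv ε (ε.std + 2) = -(dv ε ε.std + dv ε (ε.std + 1)) := by
    rw [dv_add_dv_std, neg_neg]
  have hmem : ∀ u v : ℝ, 0 ≤ u → u ≤ 1 → 0 ≤ v → v ≤ 1 →
      u • dv ε ε.std + v • dv ε (ε.std + 1) ∈ (para ε 1 1).carrier := fun u v h1 h2 h3 h4 =>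
    mem_para h1 h2 h3 h4
  have hm0 : (0 : Apt) ∈ (para ε 1 1).carrier := by
    simpa using hmem 0 0 le_rfl zero_le_one le_rfl zero_le_one
  obtain ⟨p₀, hp₀⟩ := (hZ 1 1).plot.exists_isGerm hm0 (i := ε.std) one_pos
    (by simpa using hmem 1 0 zero_le_one le_rfl le_rfl zero_le_one)
  obtain ⟨p₁, hp₁⟩ := (hZ 1 1).plot.exists_isGerm hm0 (i := ε.std + 1) one_pos
    (by simpa using hmem 0 1 le_rfl zero_le_one zero_le_one le_rfl)
  obtain ⟨m, hm⟩ := (hZ 1 1).plot.exists_isGerm hm0 (ε := ε.flip) (i := ε.std + 2) one_pos (by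
    have := hmem 1 1 zero_le_one le_rfl zero_le_one le_rfl
    rw [dv_flip, hd2]
    convert this using 1
    module)
  have j₀ : JoinedG ε p₀ m := (hZ 1 1).plot.joinedG hF (std_add_two_ne ε).1 one_pos
    (fun u v hu hv huv => by
      have := hmem (u + v) v (by linarith) huv hv (by linarith)
      rw [dv_flip, hd2]
      convert this using 1
      module) hp₀ hm
  have j₁ : JoinedG ε p₁ m := (hZ 1 1).plot.joinedG hF (std_add_two_ne ε).2 one_pos
    (fun u v hu hv huv => by
      have := hmem v (u + v) hv (by linarith) (by linarith) huv
      rw [dv_flip, hd2]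
      convert this using 1
      module) hp₁ hm
  have hrayGerm : ∀ {R : Apt → Pts B}, IsRay ε R → ∃ p, IsGerm R 0 ε ε.std p := fun {R} hR =>
    (hR 1).plot.exists_isGerm (z := 0) (segOrigin ε 1).2 one_pos
      (by simpa using mem_seg (ε := ε) (t := 1) zero_le_one le_rfl)
  obtain ⟨χ, hχ⟩ := hrayGerm hR''
  have hχm := hopp χ m hχ hm
  -- the new ray differs from the given ones, because their germs are joined to `m`
  have ne₁ : ¬Agree R' 0 ε ε.std R'' 0 ε.std := fun ⟨r, hr, h⟩ => hχm (by
    rw [(vGerm_eq_iff hF hχ hp₁).2 ⟨r, hr, fun t h0 ht => by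
      rw [← h t h0 ht, zero_add, zero_add, hZ2 t h0]⟩]
    exact j₁)
  have ne₂ : ¬Agree R'' 0 ε ε.std R 0 ε.std := fun ⟨r, hr, h⟩ => hχm (by
    rw [(vGerm_eq_iff hF hχ hp₀).2 ⟨r, hr, fun t h0 ht => by
      rw [h t h0 ht, zero_add, hZ1 t h0]⟩]
    exact j₀)
  obtain ⟨Z', hZ', hZ1', hZ2'⟩ := hB.exists_sector hR' hR'' (by rw [hR0, hZ0, h0]) ne₁
  obtain ⟨Z'', hZ'', hZ1'', hZ2''⟩ := hB.exists_sector hR'' hR (by rw [hR0, hZ0]) ne₂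
  obtain ⟨f, hf⟩ := exists_of_sectors ε (R := ![R, R', R'']) (G := ![Z, Z', Z''])
    (fun k r hr => by fin_cases k; exacts [hZ1 r hr, hZ1' r hr, hZ1'' r hr])
    (fun k r hr => by fin_cases k; exacts [hZ2 r hr, hZ2' r hr, hZ2'' r hr])
  have hsec : ∀ (k : Fin 3) (a b : Len), IPlot (para ε a b) fun x => f (weyl (rot k) 0 x) := by
    intro k a b
    have h1 : IPlot (para ε a b) ((![Z, Z', Z''] : Fin 3 → Apt → Pts B) k) := by
      fin_cases k
      exacts [hZ a b, hZ' a b, hZ'' a b]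
    refine h1.congr fun x hx => ?_
    obtain ⟨u, v, hu, -, hv, -, rfl⟩ := exists_of_mem_para hx
    exact (hf k (u, v) hu hv).symm
  have hplot := plot_of_sectors hF ε (f := f) fun k a b => (hsec k a b).plot
  have hplot' : ∀ E, Plot E f := fun E => (hplot E 1 0).congr fun x _ => by rw [weyl_one_zero]
  have hray : ∀ (k : Fin 3) (r : ℝ), 0 ≤ r → f (r • dv ε (ε.std + k)) =
      (![R, R', R''] : Fin 3 → Apt → Pts B) k (r • dv ε ε.std) := by
    intro k r hr
    have := hf k (r, 0) hr le_rfl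
    rw [weyl_rot_ppt] at this
    simp only [ppt, zero_smul, add_zero] at this
    rw [this]
    fin_cases k
    exacts [hZ1 r hr, hZ1' r hr, hZ1'' r hr]
  have hray0 : ∀ r : ℝ, 0 ≤ r → f (r • dv ε ε.std) = R (r • dv ε ε.std) := fun r hr => by
    have := hray 0 r hr
    rwa [add_zero] at this
  have hfZ : ∀ r : ℝ, 0 ≤ r → f (r • dv ε.flip (ε.std + 2)) = Z (r • dv ε.flip (ε.std + 2)) := by
    intro r hr
    have := hf 0 (r, r) hr hr
    rw [weyl_rot_ppt] at this
    simp only [add_zero] at this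
    have e : r • dv ε.flip (ε.std + 2) = r • dv ε ε.std + r • dv ε (ε.std + 1) := by
      rw [dv_flip, hd2]
      module
    rw [e]
    exact this
  -- the germs in the directions of parity `ε` are different
  have fε : ∀ i j, i ≠ j → ¬Fold f 0 ε i j := by
    intro i j hij
    refine not_of_pairs (r := Fold f 0 ε) (fun _ _ => Agree.symm) ε.std ?_ ?_ ?_ hij
    · rintro ⟨r, hr, h⟩
      refine hne ⟨r, hr, fun t h0 ht => ?_⟩
      have := h t h0 ht
      simp only [zero_add] at this ⊢
      rwa [hray0 t h0, hray 1 t h0] at this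
    · rintro ⟨r, hr, h⟩
      refine ne₂ ⟨r, hr, fun t h0 ht => ?_⟩
      have := h t h0 ht
      simp only [zero_add] at this ⊢
      rw [hray0 t h0, hray 2 t h0] at this
      exact this.symm
    · rintro ⟨r, hr, h⟩
      refine ne₁ ⟨r, hr, fun t h0 ht => ?_⟩
      have := h t h0 ht
      simp only [zero_add] at this ⊢
      rwa [hray 1 t h0, hray 2 t h0] at this
  refine ⟨f, ⟨hplot, hsec, fun ε' i j hij => ?_⟩, hray0, hray 1⟩
  rcases ε.eq_or_eq_flip ε' with rfl | rfl
  · exact fε i j hij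
  intro hfold
  choose P hP using exists_germ_of_plot hplot' 0 ε
  choose Q hQ using exists_germ_of_plot hplot' 0 ε.flip
  have hj : ∀ i j, i ≠ j → JoinedG ε (P i) (Q j) := fun i j hij =>
    joinedG_of_plot hF hplot' hij (hP i) (hQ j)
  have hQij : Q i = Q j := (vGerm_eq_iff hF (hQ i) (hQ j)).2 hfold
  -- a common germ of two bisectors would be joined to the germs of all three rays, hence it
  -- would be the germ `m`
  have hall : ∀ k, JoinedG ε (P k) (Q i) := by
    intro k
    by_cases hk : k = i
    · subst hk
      rw [hQij]
      exact hj k j hij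
    · exact hj k i hk
  have hQm : Q (ε.std + 2) = m := (vGerm_eq_iff hF (hQ _) hm).2
    ⟨1, one_pos, fun t h0 _ => by rw [zero_add, hfZ t h0]⟩
  have hPχ : P (ε.std + 2) = χ := (vGerm_eq_iff hF (hP _) hχ).2
    ⟨1, one_pos, fun t h0 _ => by
      rw [zero_add, zero_add, hray 2 t h0]
      rfl⟩
  have hPP : P ε.std ≠ P (ε.std + 1) := fun e =>
    fε _ _ (std_ne_std_add_one ε) ((vGerm_eq_iff hF (hP _) (hP _)).1 e)
  have hQQ : Q i = Q (ε.std + 2) :=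
    (JoinedG.eq_or_eq hS (hall _) (hall _) (hj _ _ (std_add_two_ne ε).2)
      (hj _ _ (std_add_two_ne ε).1)).resolve_left hPP
  apply hχm
  rw [← hPχ, ← hQm, ← hQQ]
  exact hall _

/-- The restriction of a tripod to an enclosure is immersive. -/
theorem IsTripod.immersive (hF : IsConstruction B) (hS : ∀ x : Pts B, (link B x).IsBuilding)
    {ε : Parity} {f : Apt → Pts B} (h : IsTripod ε f) {E : Enc} {s : Sec B E} (hs : Rep s f) :
    Immersive s := by
  have hplot : ∀ E, Plot E f := fun E => (h.plot E 1 0).congr fun x _ => by rw [weyl_one_zero]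
  refine immersive_of hF hS hs (fun z _ ε' i j r hij _ _ _ => h.not_fold hF hS z ε' hij) ?_
  intro z _ i r _ _ _ p q hp hq
  obtain ⟨j, k, hij, hik, hjk⟩ : ∃ j k, i ≠ j ∧ i ≠ k ∧ j ≠ k := by
    clear * -
    revert i
    decide
  obtain ⟨p', hp'⟩ := exists_germ_of_plot hplot z .pos j
  obtain ⟨q', hq'⟩ := exists_germ_of_plot hplot z .neg k
  -- the directions `i`, `-k`, `j`, `-i` form a half circle
  exact not_joinedG_of_path hS (joinedG_of_plot hF hplot hik hp hq')
    (joinedG_of_plot hF hplot hjk hp' hq') (joinedG_of_plot hF hplot hij.symm hp' hq)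
    (fun e => h.not_fold hF hS z .pos hij ((vGerm_eq_iff hF hp hp').1 e))
    (fun e => h.not_fold hF hS z .neg hik.symm ((vGerm_eq_iff hF hq' hq).1 e))

/-- A function that is a plot on every enclosure is the function on points of a map from the
plane. -/
theorem exists_hom_aptSheaf (hF : IsConstruction B) {f : Apt → Pts B}
    (hf : ∀ (E : Enc) (π : Equiv.Perm (Fin 3)) (t : Apt), Plot E fun x => f (weyl π t x)) :
    ∃ α : aptSheaf ⟶ B, ∀ (E : Enc) (j : {j : E.carrier → Apt // IsWeyl j}) (z : E.carrier),
      ev (push (toAptSheaf j ≫ α) (taut E)) z = f (j.1 z) := by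
  have hex : ∀ (E : Enc) (j : {j : E.carrier → Apt // IsWeyl j}),
      ∃ s : Sec B E, ∀ z, ev s z = f (j.1 z) := by
    rintro E ⟨j, π, t, hj⟩
    obtain ⟨s, hs⟩ := hf E π t
    exact ⟨s, fun z => (hs z).trans (congrArg f (hj z).symm)⟩
  choose σ hσ using hex
  let α' : aptPresheaf ⟶ B.obj :=
    { app := fun E => TypeCat.ofHom fun j => σ E.unop j
      naturality := by
        intro E D u
        ext j
        change σ D.unop (aptPresheaf.map u j) = res u.unop (σ E.unop j)
        apply hF.sec_ext
        intro z
        rw [ev_res]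
        exact (hσ D.unop (aptPresheaf.map u j) z).trans (hσ E.unop j (u.unop.1 z)).symm }
  refine ⟨⟨sheafifyLift encTopology α' B.property⟩, fun E j z => ?_⟩
  have key : push (toAptSheaf j ≫ ⟨sheafifyLift encTopology α' B.property⟩) (taut E) = σ E j := by
    have h1 : toSheafify encTopology (yoneda.obj E) ≫
        (toAptSheaf j ≫ ⟨sheafifyLift encTopology α' B.property⟩ : tilde.obj E ⟶ B).hom =
        yonedaEquiv.symm (show aptPresheaf.obj (op E) from j) ≫ α' := by
      change toSheafify encTopology (yoneda.obj E) ≫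
        sheafifyMap encTopology (yonedaEquiv.symm (show aptPresheaf.obj (op E) from j)) ≫
          sheafifyLift encTopology α' B.property = _
      rw [← toSheafify_naturality_assoc, toSheafify_sheafifyLift]
    have h2 := congrArg (fun w => w.app (op E) (𝟙 E)) h1
    refine Eq.trans h2 ?_
    change σ E (yonedaEquiv (yonedaEquiv.symm (show aptPresheaf.obj (op E) from j))) = σ E j
    rw [Equiv.apply_symm_apply]
  rw [key, hσ]

/-- A map from an enclosure is determined by its value at the tautological section. -/
theorem tilde_hom_ext {F : Sh} {E : Enc} {φ ψ : tilde.obj E ⟶ F}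
    (h : push φ (taut E) = push ψ (taut E)) : φ = ψ := by
  apply Sheaf.hom_ext
  apply sheafify_hom_ext encTopology _ _ F.property
  apply yonedaEquiv.injective
  exact h

theorem push_tilde_map {F : Sh} {D E : Enc} (u : D ⟶ E) (φ : tilde.obj E ⟶ F) :
    push (tilde.map u ≫ φ) (taut D) = res u (push φ (taut E)) := by
  rw [res_push]
  change push φ (push (tilde.map u) (taut D)) = _
  congr 1
  have h1 := toSheafify_naturality encTopology (yoneda.map u)
  have h2 := congrArg (fun w => w.app (op D) (𝟙 D)) h1
  refine Eq.trans h2.symm ?_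
  have h3 := NatTrans.naturality_apply (toSheafify encTopology (yoneda.obj E)) u.op (𝟙 E)
  refine Eq.trans ?_ h3
  change (toSheafify encTopology (yoneda.obj E)).app (op D) (𝟙 D ≫ u) =
    (toSheafify encTopology (yoneda.obj E)).app (op D) (u ≫ 𝟙 E)
  rw [Category.id_comp, Category.comp_id]

/-! ### Scaffoldings and the union of two parallelograms -/

theorem EGerm.face_push {F G : Sh} (f : F ⟶ G) (ε : Parity) {t : Len} (e : EGerm F)
    {s : Sec F (seg ε t)} (h : e.face ε = VGerm.mk s) :
    (e.push f).face ε = VGerm.mk (SL3.push f s) := by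
  induction e using Quotient.inductionOn with
  | h e =>
    obtain ⟨r, hr, hr', h⟩ := Quotient.exact h
    refine Quotient.sound ⟨r, hr, hr', ?_⟩
    have := congrArg (SL3.push f) h
    simp only [← res_push] at this
    exact this

theorem EGerm.face_push_eq {F G : Sh} (f : F ⟶ G) (ε : Parity) (e e' : EGerm F)
    (h : e.face ε = e'.face ε) : (e.push f).face ε = (e'.push f).face ε := by
  induction e' using Quotient.inductionOn with
  | h e' => exact (e.face_push f ε h).trans (EGerm.face_push f ε (⟦e'⟧ : EGerm F) rfl).symm

/-- A compatible map separates the two edges of an edge germ that is open for the scaffolding. -/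
theorem Scaffolding.OpenAt.push_ne {F G : Sh} {σ : Scaffolding F} {f : F ⟶ G}
    (hf : σ.Compatible f) {ε : Parity} {a b : EGerm F} (h : σ.OpenAt ε a b) :
    a.push f ≠ b.push f := by
  obtain ⟨g, hg, -, ⟨rfl, rfl⟩ | ⟨rfl, rfl⟩⟩ := h
  · exact hf.2 g hg
  · exact fun e => hf.2 g hg e.symm

/-- A compatible map to a building is immersive on straight segments: the forward and backward
directions at an interior point are the endpoints of a path of length three that does not
backtrack. -/
theorem Scaffolding.Straight.immersive (hB : IsBuilding B) {F : Sh} {σ : Scaffolding F}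
    {f : F ⟶ B} (hf : σ.Compatible f) {ε : Parity} {t : Len} {φ : Sec F (seg ε t)}
    (h : σ.Straight φ) : Immersive (push f φ) := by
  have hF := hB.construction
  have hS := hB.spherical
  obtain ⟨g, hg⟩ := exists_rep (push f φ) (ev (push f φ) (segOrigin ε t))
  -- the only directions of a segment are its own direction and the opposite one
  have hdir : ∀ z ∈ (seg ε t).carrier, ∀ (ε' : Parity) (i : Fin 3) (r : ℝ), 0 < r →
      z + r • dv ε' i ∈ (seg ε t).carrier → i = ε.std := by
    intro z hz ε' i r hr hi
    rw [mem_seg_iff] at hz hi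
    rw [cV_add_smul, hz.2.2, zero_add] at hi
    have h0 : cV ε (dv ε' i) = 0 := (mul_eq_zero.1 hi.2.2).resolve_left hr.ne'
    revert h0
    cases ε <;> cases ε' <;> fin_cases i <;> simp [cV, dv_apply, Parity.sgn, Parity.std]; norm_num
  refine immersive_of hF hS hg (fun z hz ε' i j r hij hr hi hj => ?_) ?_
  · exact absurd ((hdir z hz ε' i r hr hi).trans (hdir z hz ε' j r hr hj).symm) hij
  intro z hz i r hr hi hj p q hp hq
  obtain ⟨π, d, rfl, -, hd⟩ := exists_dir (⟨z, hz⟩ : (seg ε t).carrier) ⟨r, hr⟩ hi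
  obtain ⟨ρ, d', hρ, -, hd'⟩ := exists_dir (⟨z, hz⟩ : (seg ε t).carrier) ⟨r, hr⟩ hj
  have hp' := d.isGerm hd hg
  have hq' := d'.isGerm hd' hg
  rw [hρ] at hq'
  rw [(vGerm_eq_iff hF hp hp').2 Agree.refl, (vGerm_eq_iff hF hq hq').2 Agree.refl]
  obtain ⟨a, b, c, ha, hab, hbc, hc, o₁, o₂⟩ := h ⟨z, hz⟩ d d'
  have n₁ := o₁.push_ne hf
  have n₂ := o₂.push_ne hf
  have e₁ : (a.push f).face .pos = (d.image (push f φ)).1 := by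
    refine (a.face_push f .pos ha).trans ?_
    rw [← res_push]
    rfl
  have e₂ : (c.push f).face .neg = (d'.image (push f φ)).1 := by
    refine (c.face_push f .neg hc).trans ?_
    rw [← res_push]
    rfl
  have e₃ := EGerm.face_push_eq f .neg _ _ hab
  have e₄ := EGerm.face_push_eq f .pos _ _ hbc
  rw [← e₁, ← e₂]
  refine not_joinedG_of_path hS (ε := .pos) (p' := (b.push f).face .pos)
    (q := (b.push f).face .neg) ⟨a.push f, rfl, e₃⟩ ⟨b.push f, rfl, rfl⟩ ⟨c.push f, e₄.symm, rfl⟩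
    (fun e => n₁ (EGerm.eq_of_face hS .pos e e₃)) (fun e => n₂ (EGerm.eq_of_face hS .pos e₄ e))

/-- The two corners at the origin of the standard parallelogram are the two halves of its angle of
120 degrees. -/
theorem corner_cases {ε : Parity} {a b : Len} (c : Corner (para ε a b) (paraOrigin ε a b)) :
    ∃ π : Equiv.Perm (Fin 3), (∀ x, (c.map.1 x).1 = weyl π 0 x.1) ∧
      π⁻¹ ε.flip.std = ε.std + 2 := by
  obtain ⟨π, t, h⟩ := c.map.2
  have h : ∀ x, (c.map.1 x).1 = weyl π t x.1 := h
  have ht : t = 0 := by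
    have := h (triOrigin c.len)
    rw [c.start] at this
    apply Apt.ext'
    intro i
    have h1 := congrArg (fun w : Apt => w.1 i) this
    simpa [triOrigin, paraOrigin] using h1.symm
  subst ht
  refine ⟨π, h, ?_⟩
  -- both sides of the sector point into the parallelogram
  have key : ∀ (u v : ℝ) (hu : 0 ≤ u) (hv : 0 ≤ v) (huv : u + v ≤ c.len.1),
      0 ≤ cU ε (u • dv ε (π⁻¹ ε.std) + v • dv ε.flip (π⁻¹ ε.flip.std)) ∧
      0 ≤ cV ε (u • dv ε (π⁻¹ ε.std) + v • dv ε.flip (π⁻¹ ε.flip.std)) := by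
    intro u v hu hv huv
    have h1 := (c.map.1 ⟨_, mem_tri ε hu hv huv⟩).2
    rw [h, weyl_add_smul_dv, weyl_smul_dv, zero_add, mem_para_iff] at h1
    exact ⟨h1.1, h1.2.2.1⟩
  have hc := c.len.2
  obtain ⟨h3, h4⟩ := key 0 c.len.1 le_rfl hc.le (by simp)
  rw [zero_smul, cU_add_smul] at h3
  rw [zero_smul, cV_add_smul] at h4
  rw [dv_flip] at h3 h4
  generalize π⁻¹ ε.flip.std = j at *
  have hU : cU ε (0 : Apt) = 0 := by simp [cU]
  have hV : cV ε (0 : Apt) = 0 := by simp [cV]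
  rw [hU, zero_add] at h3
  rw [hV, zero_add] at h4
  have h3 := nonneg_of_mul_nonneg_right h3 hc
  have h4 := nonneg_of_mul_nonneg_right h4 hc
  revert h3 h4
  cases ε <;> fin_cases j <;> simp [cU, cV, dv_apply, Parity.sgn, Parity.std]

/-- If the edge germ at the origin is open, then the two edges of the parallelogram have different
directions. -/
theorem not_fold_of_middle (hF : IsConstruction B) (hS : ∀ x : Pts B, (link B x).IsBuilding)
    {ε : Parity} {a b : Len} {F : Sh} {s : Sec F (para ε a b)} {f : F ⟶ B} {γ : EdgeGerm F}
    (hγ : IsMiddle s γ) (ho : ¬γ.Folds f) {g : Apt → Pts B} (hg : Rep (push f s) g) :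
    ¬Fold g 0 ε ε.std (ε.std + 1) := by
  intro hfold
  obtain ⟨-, c, c', hc, hc'⟩ := hγ
  apply ho
  obtain ⟨π, hπ, k⟩ := corner_cases c
  obtain ⟨ρ, hρ, k'⟩ := corner_cases c'
  have r : Rep (res c.map (push f s)) fun x => g (weyl π 0 x) := hg.res _ hπ
  have r' : Rep (res c'.map (push f s)) fun x => g (weyl ρ 0 x) := hg.res _ hρ
  have e : γ.a.push f = EGerm.mk (res c.map (push f s)) := by
    rw [hc, res_push]
    rfl
  have e' : γ.b.push f = EGerm.mk (res c'.map (push f s)) := by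
    rw [hc', res_push]
    rfl
  rw [EdgeGerm.Folds, e, e']
  have i1 := isGerm_face (ε := ε) r
  have i2 := isGerm_face (ε := ε) r'
  have i3 := isGerm_face (ε := ε.flip) r
  have i4 := isGerm_face (ε := ε.flip) r'
  rw [k] at i3
  rw [k'] at i4
  have hcase : ∀ π : Equiv.Perm (Fin 3), π⁻¹ ε.flip.std = ε.std + 2 →
      π⁻¹ ε.std = ε.std ∨ π⁻¹ ε.std = ε.std + 1 := by
    intro π hπ
    rcases eq_or_eq_or_eq ε.std (π⁻¹ ε.std) with h | h | h
    · exact Or.inl h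
    · exact Or.inr h
    · exact absurd (π⁻¹.injective (h.trans hπ.symm)) (Parity.std_ne ε)
  refine EGerm.eq_of_face hS ε ((vGerm_eq_iff hF i1 i2).2 ?_)
    ((vGerm_eq_iff hF i3 i4).2 Agree.refl)
  rcases hcase π k with h | h <;> rcases hcase ρ k' with h' | h' <;> rw [h, h']
  exacts [Agree.refl, hfold, Agree.symm hfold, Agree.refl]

end SL3

theorem mainTheorem7 (ε : SL3.Parity) (a b : SL3.Len)
    (σ : SL3.Scaffolding (SL3.W ε a b)) (hσ : σ.Coherent)
    (hv₁ : ∃ g ∈ σ.opn, SL3.IsMiddle (SL3.push (SL3.piece₁ ε a b) (SL3.taut (SL3.para ε a b))) g)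
    (hv₂ : ∃ g ∈ σ.opn, SL3.IsMiddle (SL3.push (SL3.piece₂ ε a b) (SL3.taut (SL3.para ε a b))) g)
    (hs₁ : σ.Straight (SL3.res (SL3.edge₁ ε a b)
      (SL3.push (SL3.piece₁ ε a b) (SL3.taut (SL3.para ε a b)))))
    (hs₂ : σ.Straight (SL3.res (SL3.edge₂ ε a b)
      (SL3.push (SL3.piece₁ ε a b) (SL3.taut (SL3.para ε a b)))))
    (B : SL3.Sh) (hB : SL3.IsBuilding B) (h : SL3.W ε a b ⟶ B) (hh : σ.Compatible h) :
    ∃ hP : SL3.tilde.obj (SL3.para ε a b) ⟶ B,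
      SL3.proj ε a b ≫ hP = h ∧ SL3.IsIsometricInApartment hP := by
  have hF := hB.construction
  have hS := hB.spherical
  obtain ⟨γ, hγ, hγm⟩ := hv₁
  -- the two maps from the parallelogram
  let s₁ := SL3.push h (SL3.push (SL3.piece₁ ε a b) (SL3.taut (SL3.para ε a b)))
  let s₂ := SL3.push h (SL3.push (SL3.piece₂ ε a b) (SL3.taut (SL3.para ε a b)))
  let x₀ : SL3.Pts B := SL3.ev s₁ (SL3.paraOrigin ε a b)
  obtain ⟨g₁, hg₁⟩ := SL3.exists_rep s₁ x₀
  obtain ⟨g₂, hg₂⟩ := SL3.exists_rep s₂ x₀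
  have hcond : SL3.VtoP ε a b ≫ SL3.piece₁ ε a b = SL3.VtoP ε a b ≫ SL3.piece₂ ε a b :=
    pushout.condition
  -- the two pieces agree on the edges that are glued
  have hglue : ∀ {X : SL3.Sh} (i : X ⟶ SL3.V ε a b) (e : X ⟶ SL3.tilde.obj (SL3.para ε a b)),
      i ≫ SL3.VtoP ε a b = e → e ≫ SL3.piece₁ ε a b = e ≫ SL3.piece₂ ε a b := by
    rintro X i _ rfl
    rw [Category.assoc, Category.assoc, hcond]
  have he₁ : SL3.tilde.map (SL3.edge₁ ε a b) ≫ SL3.piece₁ ε a b =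
      SL3.tilde.map (SL3.edge₁ ε a b) ≫ SL3.piece₂ ε a b :=
    hglue (pushout.inl _ _) _ (pushout.inl_desc _ _ _)
  have he₂ : SL3.tilde.map (SL3.edge₂ ε a b) ≫ SL3.piece₁ ε a b =
      SL3.tilde.map (SL3.edge₂ ε a b) ≫ SL3.piece₂ ε a b :=
    hglue (pushout.inr _ _) _ (pushout.inr_desc _ _ _)
  have hr₁ : SL3.res (SL3.edge₁ ε a b) s₁ = SL3.res (SL3.edge₁ ε a b) s₂ := by
    refine (SL3.res_push _ _ _).trans (Eq.trans ?_ (SL3.res_push _ _ _).symm)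
    rw [← SL3.push_tilde_map, ← SL3.push_tilde_map, he₁]
  have hr₂ : SL3.res (SL3.edge₂ ε a b) s₁ = SL3.res (SL3.edge₂ ε a b) s₂ := by
    refine (SL3.res_push _ _ _).trans (Eq.trans ?_ (SL3.res_push _ _ _).symm)
    rw [← SL3.push_tilde_map, ← SL3.push_tilde_map, he₂]
  -- the edges are immersive segments in different directions
  have him₁ : SL3.Immersive (SL3.res (SL3.edge₁ ε a b) s₁) := by
    have := hs₁.immersive hB hh
    rwa [← SL3.res_push] at this
  have him₂ : SL3.Immersive (SL3.res (SL3.edge₂ ε a b) s₁) := by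
    have := hs₂.immersive hB hh
    rwa [← SL3.res_push] at this
  have hrot : ∀ i : Fin 3, finRotate 3 i = i + 1 := by decide
  have hw : ∀ r : ℝ, SL3.weyl (finRotate 3)⁻¹ 0 (r • SL3.dv ε ε.std) =
      r • SL3.dv ε (ε.std + 1) := fun r => by
    rw [SL3.weyl_smul_dv, zero_add, inv_inv, hrot]
  have p₁ : SL3.IPlot (SL3.seg ε a) g₁ := ⟨_, him₁, hg₁.incl (SL3.edge₁ ε a b) fun _ => rfl⟩
  have p₂ : SL3.IPlot (SL3.seg ε b) fun x => g₁ (SL3.weyl (finRotate 3)⁻¹ 0 x) :=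
    ⟨_, him₂, hg₁.res (SL3.edge₂ ε a b) fun _ => rfl⟩
  have hnf : ¬SL3.Fold g₁ 0 ε ε.std (ε.std + 1) :=
    SL3.not_fold_of_middle hF hS hγm (hh.2 γ hγ) hg₁
  -- the edges extend to rays, which lie in a common tripod
  obtain ⟨R, hR, hRg⟩ := hB.exists_ray p₁
  obtain ⟨R', hR', hRg'⟩ := hB.exists_ray p₂
  simp only [hw] at hRg'
  obtain ⟨f, hf, hfR, hfR'⟩ := hB.exists_tripod hR hR'
    (by
      have h1 := hRg 0 le_rfl a.2.le
      have h2 := hRg' 0 le_rfl b.2.le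
      rw [zero_smul] at h1
      rw [zero_smul, zero_smul] at h2
      rw [h1, h2])
    (by
      intro hag
      obtain ⟨r, hr, hrm, hag⟩ := hag.exists_lt (lt_min a.2 b.2)
      refine hnf ⟨r, hr, fun t h0 ht => ?_⟩
      have := hag t h0 ht
      rwa [zero_add, hRg t h0 (ht.trans (hrm.trans (min_le_left _ _))),
        hRg' t h0 (ht.trans (hrm.trans (min_le_right _ _))), ← zero_add (t • SL3.dv ε ε.std),
        ← zero_add (t • SL3.dv ε (ε.std + 1))] at this)
  -- both maps agree with the tripod on the two edges
  have hq₁ : ∀ x ∈ (SL3.para ε a b).carrier, f x = g₁ x :=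
    SL3.para_unique hF hS (hf.sector_zero a b) ⟨s₁, hg₁⟩
      (fun u hu hua => by rw [hfR u hu, hRg u hu hua])
      (fun v hv hvb => by rw [hfR' v hv, hRg' v hv hvb])
  have hq₂ : ∀ x ∈ (SL3.para ε a b).carrier, f x = g₂ x := by
    refine SL3.para_unique hF hS (hf.sector_zero a b) ⟨s₂, hg₂⟩
      (fun u hu hua => ?_) (fun v hv hvb => ?_)
    · rw [hfR u hu, hRg u hu hua]
      have := congrArg (fun w => SL3.ev w ⟨_, SL3.mem_seg hu hua⟩) hr₁
      rwa [(hg₁.incl (SL3.edge₁ ε a b) fun _ => rfl) _,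
        (hg₂.incl (SL3.edge₁ ε a b) fun _ => rfl) _] at this
    · rw [hfR' v hv, hRg' v hv hvb]
      have := congrArg (fun w => SL3.ev w ⟨_, SL3.mem_seg hv hvb⟩) hr₂
      rw [(hg₁.res (SL3.edge₂ ε a b) fun _ => rfl) _,
        (hg₂.res (SL3.edge₂ ε a b) fun _ => rfl) _] at this
      simpa only [hw] using this
  have hs₁₂ : s₁ = s₂ := hF.rep_ext hg₁ hg₂ fun x hx => (hq₁ x hx).symm.trans (hq₂ x hx)
  have hpieces : SL3.piece₁ ε a b ≫ h = SL3.piece₂ ε a b ≫ h := SL3.tilde_hom_ext hs₁₂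
  -- the tripod is the function on points of an apartment
  obtain ⟨α, hα⟩ := SL3.exists_hom_aptSheaf hF hf.plot
  refine ⟨SL3.piece₁ ε a b ≫ h, ?_, α, SL3.aptIncl _, fun E => ?_, isometry_subtype_coe, ?_⟩
  · apply pushout.hom_ext
    · change SL3.piece₁ ε a b ≫ SL3.proj ε a b ≫ _ = SL3.piece₁ ε a b ≫ h
      have : SL3.piece₁ ε a b ≫ SL3.proj ε a b = 𝟙 _ := pushout.inl_desc _ _ _
      rw [reassoc_of% this]
    · change SL3.piece₂ ε a b ≫ SL3.proj ε a b ≫ _ = SL3.piece₂ ε a b ≫ h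
      have : SL3.piece₂ ε a b ≫ SL3.proj ε a b = 𝟙 _ := pushout.inr_desc _ _ _
      rw [reassoc_of% this, hpieces]
  · exact hf.immersive hF hS fun z => hα E _ z
  · apply SL3.tilde_hom_ext
    apply hF.sec_ext
    intro z
    rw [hα]
    exact (hq₁ z.1 z.2).trans (hg₁ z).symm
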